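/- Let $1\le p\le 2$, let $A\in\mathbb{R}^{n\times d}$ with $n\ge 2$, $d\ge 1$, rows $a_1,\dots,a_n$, and let $A^{(t)}$ consist of the first $t$ rows of $A$. For a matrix $M$ with rows $m_1,m_2,\dots$, its $\ell_p$ Lewis weights are the unique numbers $w_i(M)\ge 0$, positive for nonzero rows, with $w_i(M)=\big(m_i^\top(M^\top W^{1-2/p}M)^\dagger m_i\big)^{p/2}$, $W=\mathrm{diag}(w_i(M))$ (zero rows have weight $0$ and do not contribute to $M^\top W^{1-2/p}M$); $w_{\rm last}(M)$ is the weight of the last row, and $w_t(A^{(t)})$ is the $t$-th online Lewis weight of $A$. Let $\circ$ denote vertical concatenation. **Compression algorithm** with parameters $\eta,\delta\in(0,1)$, $\beta=\Theta(\eta^{-2}\log(n/\delta)\log^2 n)$, $Q=\Theta(\eta^{-2}d\log^3 n)$, where the constants in the $\Theta$'s are sufficiently large. It maintains matrices (blocks) $B_0,\dots,B_{\lfloor\log_2 n\rfloor}$, initially empty. The first $\min(d,n)$ rows of $A$ are appended to $B_0$ one by one. For each further row $a_t$: append $a_t$ to $B_0$; if $B_0$ now has more than $Q$ rows, let $i$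 be the smallest index such that $B_i$ is empty, let $M=B_{i-1}\circ\cdots\circ B_0$, independently keep each row $m_j$ of $M$ with probability $p_j=\min\{\beta w_j(M),1\}$ (fresh randomness each time), replace $B_i$ by the matrix of the kept rows, each rescaled to $p_j^{-1/p}m_j$, and make $B_0,\dots,B_{i-1}$ empty. Let $\tilde w_t=w_{\rm last}(B_{\lfloor\log_2 n\rfloor}\circ\cdots\circ B_0)$, evaluated right after $a_t$ has been appended to $B_0$ (and before a possible compression at that step). **Theorem.** For every $c\in\mathbb{N}$, if the constants in the $\Theta$'s are large enough (depending on $c$ only), then with probability at least $1-\delta/n^{c}$ the following hold simultaneously for all $t\le n$. 1. $(1-\eta)\,w_t(A^{(t)})\le\tilde w_t\le(1+\eta)\,w_t(A^{(t)})$. 2. No block of index larger than $\lfloor\log_2 n\rfloor$ is ever needed, and at step $t$ the algorithm (its blocks before and after the step, together with the matrix $M$ and the sampling probabilities) uses $O\big(\frac{d^2}{\eta^2}\,\mathrm{poly}(\log\frac n\delta)\big)$ words of space. 3. From the current blocks $B_{\lfloor\log_2 n\rfloor}\circ\cdots\circ B_0$, a $(1\pm\eta)$-approximation of $\tilde w_t$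 can be computed in $O\big(\frac{d^3}{\eta^2}\,\mathrm{poly}(\log\frac{n}{\delta\eta})\big)$ time and $O\big(\frac{d^2}{\eta^2}\,\mathrm{poly}(\log\frac n\delta)\big)$ words of space, by one fixed program for a unit-cost random access machine over the reals (with integer registers used as addresses, with instructions $+,-,\times,\div$, powers of positive numbers, and comparisons). The program and the exponents of the polylogarithmic factors are absolute; the constants in the $O$'s depend only on $c$ and on the constants in the $\Theta$'s, and not on $n,d,p,\eta,\delta,A$. -/

import Mathlib

open scoped NNReal ENNReal Matrix

noncomputable section

namespace OnlineLewis

/-! ### Lewis weights -/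

/-- The four Penrose conditions: `X` is the Moore–Penrose inverse of the real square matrix `A`. -/
def IsMoorePenrose {d : ℕ} (A X : Matrix (Fin d) (Fin d) ℝ) : Prop :=
  A * X * A = A ∧ X * A * X = X ∧ (A * X)ᵀ = A * X ∧ (X * A)ᵀ = X * A

open Classical in
/-- The Moore–Penrose inverse `A†`. -/
def pinv {d : ℕ} (A : Matrix (Fin d) (Fin d) ℝ) : Matrix (Fin d) (Fin d) ℝ :=
  if h : ∃ X, IsMoorePenrose A X then h.choose else 0

/-- `w` satisfies the equations `w_i = (a_iᵀ (Aᵀ W^{1-2/p} A)† a_i)^{p/2}`, `W = diag w`.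
The exponent `1 - 2/p` is nonpositive when `p ≤ 2`, so the equations presuppose that the weights of
the nonzero rows are positive (Lean evaluates `0 ^ (1 - 2/p)` as `0` if `p < 2`, and without the
second clause `w = 0` would be a spurious solution). The weight of a zero row is `0`, and its entry
of `W` is irrelevant. -/
def IsLewisWeights {m d : ℕ} (p : ℝ) (A : Matrix (Fin m) (Fin d) ℝ) (w : Fin m → ℝ) : Prop :=
  (∀ i, 0 ≤ w i) ∧ (∀ i, A i ≠ 0 → 0 < w i) ∧
    ∀ i, w i =
      (A i ⬝ᵥ (pinv (Aᵀ * Matrix.diagonal (fun j => w j ^ (1 - 2 / p)) * A) *ᵥ A i)) ^ (p / 2)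

open Classical in
/-- The `ℓ_p` Lewis weights `w_1(A), …, w_m(A)`: the unique solution of the Lewis equations. -/
def lewisWeight {m d : ℕ} (p : ℝ) (A : Matrix (Fin m) (Fin d) ℝ) : Fin m → ℝ :=
  if h : ∃ w, IsLewisWeights p A w then h.choose else 0

/-- The online Lewis weight of row `t`: its Lewis weight in the matrix `A^(t)` that consists of the
rows up to and including row `t` (rows are numbered from `0`). -/
def onlineLewisWeight {n d : ℕ} (p : ℝ) (A : Matrix (Fin n) (Fin d) ℝ) (t : Fin n) : ℝ :=
  lewisWeight p (A.submatrix (Fin.castLE t.isLt : Fin (t.val + 1) → Fin n) id) (Fin.last t.val)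

/-! ### Matrices with a varying number of rows -/

/-- A matrix with `d` columns as the list of its rows; vertical concatenation `∘` is `++`. -/
abbrev Rows (d : ℕ) : Type := List (Fin d → ℝ)

/-- The matrix with the given rows. -/
def Rows.toMatrix {d : ℕ} (X : Rows d) : Matrix (Fin X.length) (Fin d) ℝ :=
  Matrix.of fun i => X.get i

/-- `w_last(X)`, the Lewis weight of the last row (`0` if there is no row). -/
def lastLewisWeight {d : ℕ} (p : ℝ) (X : Rows d) : ℝ :=
  if h : 0 < X.length then lewisWeight p X.toMatrix ⟨X.length - 1, Nat.sub_lt h Nat.one_pos⟩ else 0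

/-! ### The compression algorithm -/

/-- A coin that shows `true` with probability `q`. -/
def coin (q : ℝ≥0) (hq : q ≤ 1) : PMF Bool :=
  PMF.ofFintype (fun b => cond b (q : ℝ≥0∞) (1 - (q : ℝ≥0∞))) (by
    have h : (q : ℝ≥0∞) ≤ 1 := by exact_mod_cast hq
    simp [add_tsub_cancel_of_le h])

/-- The law of `S M`, where `M` has the rows `a` and `S` is the rescaled sampling matrix for the
probabilities `min q 1`, for the pairs `(q, a)` of the list: independently for each row, the row is
kept, multiplied by `(min q 1)^{-1/p}`, with probability `min q 1`, and deleted otherwise. -/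
def sampleRows {d : ℕ} (p : ℝ) : List (ℝ≥0 × (Fin d → ℝ)) → PMF (Rows d)
  | [] => PMF.pure []
  | (q, a) :: l =>
    (coin (min q 1) (min_le_right q 1)).bind fun keep =>
      (sampleRows p l).bind fun X =>
        PMF.pure (if keep then ((((min q 1 : ℝ≥0) : ℝ) ^ (-(1 / p))) • a) :: X else X)

/-- Sampling of the rows of `M` with the probabilities `min {β w_i(M), 1}`. -/
def lewisSample {d : ℕ} (p β : ℝ) (M : Rows d) : PMF (Rows d) :=
  sampleRows p
    (List.ofFn fun i : Fin M.length => ((β * lewisWeight p M.toMatrix i).toNNReal, M.get i))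

/-- The blocks `B_0, B_1, …`. -/
abbrev Blocks (d : ℕ) : Type := ℕ → Rows d

/-- `B_{k-1} ∘ B_{k-2} ∘ ⋯ ∘ B_0`. -/
def Blocks.concat {d : ℕ} (B : Blocks d) : ℕ → Rows d
  | 0 => []
  | k + 1 => B k ++ Blocks.concat B k

/-- `B_0 ← B_0 ∘ a`. -/
def Blocks.push {d : ℕ} (B : Blocks d) (a : Fin d → ℝ) : Blocks d :=
  Function.update B 0 (B 0 ++ [a])

/-- The index of the first empty block. -/
def Blocks.firstEmpty {d : ℕ} (B : Blocks d) : ℕ := sInf {i | B i = []}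

/-- The merge-and-reduce step: with `i` the smallest index of an empty block, the concatenation
`M = B_{i-1} ∘ ⋯ ∘ B_0` is sampled into `B_i`, and `B_0, …, B_{i-1}` are emptied. -/
def Blocks.compress {d : ℕ} (p β : ℝ) (B : Blocks d) : PMF (Blocks d) :=
  (lewisSample p β (B.concat B.firstEmpty)).bind fun X =>
    PMF.pure fun j =>
      if j < B.firstEmpty then [] else if j = B.firstEmpty then X else B j

/-- The blocks at one stage of the stream: `pre` right after the new row has been appended to `B_0`,
and `post` at the end of the stage, after the merge-and-reduce step, if there was one. -/
structure Snapshot (d : ℕ) where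
  pre : Blocks d
  post : Blocks d

/-- One stage: row number `t` (from `0`) is appended to `B_0`. The first `d` rows only initialize
`B_0`; from then on the blocks are compressed as soon as `B_0` has more than `Q` rows. -/
def stage {d : ℕ} (p β Q : ℝ) (t : ℕ) (B : Blocks d) (a : Fin d → ℝ) : PMF (Snapshot d) :=
  if d ≤ t ∧ Q < ((B.push a 0).length : ℝ) then
    ((B.push a).compress p β).bind fun B' => PMF.pure ⟨B.push a, B'⟩
  else PMF.pure ⟨B.push a, B.push a⟩

/-- The joint law of the snapshots of `m` consecutive stages that start from the blocks `B`, the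
first of them with row number `t`. -/
def runFrom {d : ℕ} (p β Q : ℝ) :
    (m : ℕ) → (t : ℕ) → Blocks d → (Fin m → Fin d → ℝ) → PMF (Fin m → Snapshot d)
  | 0, _, _, _ => PMF.pure Fin.elim0
  | m + 1, t, B, rows =>
    (stage p β Q t B (rows 0)).bind fun s =>
      (runFrom p β Q m (t + 1) s.post (Fin.tail rows)).bind fun hist =>
        PMF.pure (Fin.cons s hist : Fin (m + 1) → Snapshot d)

/-- The joint law of all `n` stages of the compression algorithm on the rows of `A`. -/
def run {n d : ℕ} (p β Q : ℝ) (A : Matrix (Fin n) (Fin d) ℝ) : PMF (Fin n → Snapshot d) :=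
  runFrom p β Q n 0 (fun _ => []) (fun i => A i)

/-- The largest block index `log n` (base 2, rounded down). -/
def topIndex (n : ℕ) : ℕ := Nat.log 2 n

/-- `B_{log n} ∘ ⋯ ∘ B_0` in the stage of the snapshot, when the last row of `B_0` is the new one. -/
def Snapshot.current {d : ℕ} (n : ℕ) (s : Snapshot d) : Rows d := s.pre.concat (topIndex n + 1)

/-- The estimate `w̃_t = w_last(B_{log n} ∘ ⋯ ∘ B_0)`. -/
def Snapshot.estimate {d : ℕ} (p : ℝ) (n : ℕ) (s : Snapshot d) : ℝ :=
  lastLewisWeight p (s.current n)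

/-- The number of real words held by the variables of the algorithm during one stage, all of them
counted as if they were stored separately: the blocks, the concatenated matrix `M` with one
sampling probability per row (at most as many rows as the blocks), and the new blocks. -/
def Snapshot.words {d : ℕ} (n : ℕ) (s : Snapshot d) : ℕ :=
  d * (s.current n).length + (d + 1) * (s.current n).length +
    d * (s.post.concat (topIndex n + 1)).length

/-! ### A unit-cost random access machine over the reals

The machine has integer registers, which also serve as addresses, and a memory of real numbers that
is addressed indirectly through the registers. With memory size `S`, all addresses in use and all
integers computed are smaller than `S`. -/

structure MachineState where
  reg : ℕ → ℕ
  mem : ℕ → ℝ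

/-- Elementary instructions; `x y z` are register numbers, and `⟦x⟧` is the memory cell whose
address is in register `x`. -/
inductive Instr where
  | const (x c : ℕ)     -- `x := c`
  | plus (x y z : ℕ)    -- `x := y + z`
  | minus (x y z : ℕ)   -- `x := y - z` (truncated at `0`)
  | times (x y z : ℕ)   -- `x := y * z`
  | rcast (x y : ℕ)     -- `⟦x⟧ := y`
  | rplus (x y z : ℕ)   -- `⟦x⟧ := ⟦y⟧ + ⟦z⟧`
  | rminus (x y z : ℕ)  -- `⟦x⟧ := ⟦y⟧ - ⟦z⟧`
  | rtimes (x y z : ℕ)  -- `⟦x⟧ := ⟦y⟧ * ⟦z⟧`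
  | rdiv (x y z : ℕ)    -- `⟦x⟧ := ⟦y⟧ / ⟦z⟧`, provided that `⟦z⟧ ≠ 0`
  | rpow (x y z : ℕ)    -- `⟦x⟧ := ⟦y⟧ ^ ⟦z⟧`, provided that `0 < ⟦y⟧`

/-- The test of a branch or a loop: comparison of two registers or of two memory cells. -/
inductive Test where
  | lt (x y : ℕ)
  | rlt (x y : ℕ)

inductive Program where
  | skip
  | instr (i : Instr)
  | seq (P P' : Program)
  | ite (b : Test) (P P' : Program)
  | while (b : Test) (P : Program)

namespace MachineState

def read (s : MachineState) (x : ℕ) : ℝ := s.mem (s.reg x)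

def setReg (s : MachineState) (x v : ℕ) : MachineState := ⟨Function.update s.reg x v, s.mem⟩

def setMem (s : MachineState) (x : ℕ) (v : ℝ) : MachineState :=
  ⟨s.reg, Function.update s.mem (s.reg x) v⟩

end MachineState

/-- The instruction may be executed within memory size `S`. -/
def Instr.Legal (S : ℕ) (s : MachineState) : Instr → Prop
  | .const _ c => c < S
  | .plus _ y z => s.reg y + s.reg z < S
  | .minus _ y z => s.reg y - s.reg z < S
  | .times _ y z => s.reg y * s.reg z < S
  | .rcast x _ => s.reg x < S
  | .rplus x y z | .rminus x y z | .rtimes x y z => s.reg x < S ∧ s.reg y < S ∧ s.reg z < S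
  | .rdiv x y z => s.reg x < S ∧ s.reg y < S ∧ s.reg z < S ∧ s.read z ≠ 0
  | .rpow x y z => s.reg x < S ∧ s.reg y < S ∧ s.reg z < S ∧ 0 < s.read y

/-- The effect of an instruction. -/
def Instr.effect (s : MachineState) : Instr → MachineState
  | .const x c => s.setReg x c
  | .plus x y z => s.setReg x (s.reg y + s.reg z)
  | .minus x y z => s.setReg x (s.reg y - s.reg z)
  | .times x y z => s.setReg x (s.reg y * s.reg z)
  | .rcast x y => s.setMem x (s.reg y : ℝ)
  | .rplus x y z => s.setMem x (s.read y + s.read z)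
  | .rminus x y z => s.setMem x (s.read y - s.read z)
  | .rtimes x y z => s.setMem x (s.read y * s.read z)
  | .rdiv x y z => s.setMem x (s.read y / s.read z)
  | .rpow x y z => s.setMem x (s.read y ^ s.read z)

def Test.Legal (S : ℕ) (s : MachineState) : Test → Prop
  | .lt _ _ => True
  | .rlt x y => s.reg x < S ∧ s.reg y < S

def Test.Holds (s : MachineState) : Test → Prop
  | .lt x y => s.reg x < s.reg y
  | .rlt x y => s.read x < s.read y

/-- `Exec S P s T s'`: started in `s`, the program `P` stops in `s'` after `T` steps and stays within
memory size `S`. Every instruction and every evaluation of a test is one step. -/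
inductive Exec (S : ℕ) : Program → MachineState → ℕ → MachineState → Prop where
  | skip (s : MachineState) : Exec S .skip s 0 s
  | instr (i : Instr) (s : MachineState) (h : i.Legal S s) : Exec S (.instr i) s 1 (i.effect s)
  | seq {P P' : Program} {s s' s'' : MachineState} {T T' : ℕ}
      (h : Exec S P s T s') (h' : Exec S P' s' T' s'') : Exec S (.seq P P') s (T + T') s''
  | iteTrue {b : Test} {P P' : Program} {s s' : MachineState} {T : ℕ}
      (hl : b.Legal S s) (hb : b.Holds s) (h : Exec S P s T s') : Exec S (.ite b P P') s (T + 1) s'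
  | iteFalse {b : Test} {P P' : Program} {s s' : MachineState} {T : ℕ}
      (hl : b.Legal S s) (hb : ¬ b.Holds s) (h : Exec S P' s T s') :
      Exec S (.ite b P P') s (T + 1) s'
  | whileFalse {b : Test} {P : Program} {s : MachineState}
      (hl : b.Legal S s) (hb : ¬ b.Holds s) : Exec S (.while b P) s 1 s
  | whileTrue {b : Test} {P : Program} {s s' s'' : MachineState} {T T' : ℕ}
      (hl : b.Legal S s) (hb : b.Holds s) (h : Exec S P s T s')
      (h' : Exec S (.while b P) s' T' s'') : Exec S (.while b P) s (T + T' + 1) s''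

/-- The input `(p, η, X)`: registers `0`, `1` hold the number of rows and `d`; cells `0`, `1` hold
`p` and `η`; the entries of `X` follow row by row from cell `2` on. Everything else is `0`. -/
def machineInput {d : ℕ} (p η : ℝ) (X : Rows d) : MachineState where
  reg x := if x = 0 then X.length else if x = 1 then d else 0
  mem a :=
    if a = 0 then p else if a = 1 then η else
      if h : (a - 2) / d < X.length ∧ (a - 2) % d < d then
        X.get ⟨(a - 2) / d, h.1⟩ ⟨(a - 2) % d, h.2⟩ else 0

/-- Within `T` steps and memory size `S`, the program computes from `(p, η, X)` a number, left in
cell `0`, that is a `(1 ± η)`-approximation of the Lewis weight of the last row of `X`. -/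
def ComputesLastWeight {d : ℕ} (P : Program) (S T : ℕ) (p η : ℝ) (X : Rows d) : Prop :=
  ∃ (T' : ℕ) (s : MachineState), T' ≤ T ∧ Exec S P (machineInput p η X) T' s ∧
    (1 - η) * lastLewisWeight p X ≤ s.mem 0 ∧ s.mem 0 ≤ (1 + η) * lastLewisWeight p X

end OnlineLewis

end

open scoped NNReal ENNReal Matrix

noncomputable section

namespace OnlineLewis

/-! ### The Golden–Thompson inequality -/

section GoldenThompson

set_option linter.unusedSectionVars false

open Matrix Filter Topology NormedSpace

/-! ### The Lie product formula in a Banach algebra. -/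

section Trotter

variable {𝔸 : Type*} [NormedRing 𝔸] [NormedAlgebra ℝ 𝔸] [CompleteSpace 𝔸] [NormOneClass 𝔸]

/-! Lewis weights are read off a fixed point `U = F(U)` of the map `F(U) = ∑ (a_iᵀ U† a_i)^(p/2-1)
a_i a_iᵀ` on quadratic forms. The exponent `p/2-1` lies in `[-1/2, 0]`, so `F` contracts by `1 - p/2
≤ 1/2` on a logarithmic scale. This yields existence (`contracting_logStep`), a fast iteration
(`IsLewisIterate.next`), and the comparison lemma `lev_rpow_le`: if some form `U` satisfies `κ' U ≼
F_X(U) ≼ κ U` for the rows `X`, then the numbers `(uᵀ U† u)^(p/2)` are between `κ'` and `κ` times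
the Lewis weights of `X`, without any loss in the constants.

For the accuracy, fix a row `t` and let `U` be the Lewis form of the first `t` rows. In coordinates
in which `U` is the identity, a row `u` contributes the rank-one matrix `yrow`, and the
contributions of the rows of `A` up to `t` add up to `1`. The contribution is homogeneous of degree
`p` in `u`, so the rescaling by `q^(-1/p)` makes every sampling step unbiased. By the comparison
lemma it suffices that the contributions of the rows in the current blocks add up to a matrix
between `1 - η/2` and `1 + η/2`.

This is shown with a potential `tr exp(∑_j γ_j Y_j + γ_0 Y_future)`, where `Y_j` is the sum over
block `j` and the future runs only up to row `t`. The coefficients are `θ(1+e)^(-j)` for the upper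
bound and `-θ(1+e)^j` for the lower one. Appending a row leaves the potential unchanged. Merging
into block `i` moves rows from coefficients at least `γ_(i-1)` to `γ_i`; the gap of a factor `1+e`
pays for the variance of the sampling, one coin at a time, by the Golden–Thompson inequality
(`convexComb_trace_exp_le`, `expect_trace_exp_sampleRows_le`, `expect_compress_le`). The sampling
probabilities are large enough as long as the current sum is at most `2`. That is the case while the
normalized potential is below `1`, and once it is not, the bound for the failure probability is
trivial, so no stopping time is needed (`toOuterMeasure_runFrom_bad_le`). There are `O(log n)`
levels and `e` is of order `η / log n`, so the factors `(1+e)^j` cost only a fraction of `η`; a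
union bound over `t` finishes this part.

The number of blocks is that of a binary counter (`BlocksInv`). A sampled block is short because the
Lewis weights sum to at most `d` and the number of kept rows has an exponential moment
(`toOuterMeasure_lewisSample_length_le`).

The program iterates `F` from the unweighted Gram matrix. The error factor starts at the number of
rows and is replaced by at most its square root in each round. Leverages come from symmetric
elimination on the form, carried out simultaneously on copies of the rows, and the squares collected
at the pivots add up to the leverage (`Eliminated.pivot`). The machine is handled by a small
calculus of triples, `Does`. -/

theorem norm_exp_le_exp_norm (x : 𝔸) : ‖exp x‖ ≤ Real.exp ‖x‖ := by
  have h1 : Summable fun n : ℕ => ‖((n.factorial : ℝ)⁻¹) • x ^ n‖ := norm_expSeries_summable' (𝕂 := ℝ) x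
  have h2 : Summable fun n : ℕ => ((n.factorial : ℝ)⁻¹) • ‖x‖ ^ n := expSeries_summable' (𝕂 := ℝ) ‖x‖
  rw [Real.exp_eq_exp_ℝ, exp_eq_tsum ℝ, exp_eq_tsum ℝ]
  refine (norm_tsum_le_tsum_norm h1).trans (h1.tsum_le_tsum (fun n => ?_) h2)
  rw [norm_smul, smul_eq_mul]
  have : ‖((n.factorial : ℝ)⁻¹)‖ = ((n.factorial : ℝ)⁻¹) := by
    rw [Real.norm_of_nonneg (by positivity)]
  rw [this]
  gcongr
  exact norm_pow_le _ _

/-- Telescoping the difference of powers. The extra factor `r` on both sides avoids the exponent `n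
- 1`. -/
theorem norm_pow_sub_pow_le (x y : 𝔸) {r : ℝ} (hx : ‖x‖ ≤ r) (hy : ‖y‖ ≤ r) (n : ℕ) :
    ‖x ^ n - y ^ n‖ * r ≤ n * ‖x - y‖ * r ^ n := by
  have hr : 0 ≤ r := (norm_nonneg x).trans hx
  induction n with
  | zero => simp
  | succ n ih =>
    have e : x ^ (n + 1) - y ^ (n + 1) = x ^ n * (x - y) + (x ^ n - y ^ n) * y := by
      rw [mul_sub, sub_mul, pow_succ, pow_succ]; abel
    have h1 : ‖x ^ (n + 1) - y ^ (n + 1)‖ ≤ r ^ n * ‖x - y‖ + ‖x ^ n - y ^ n‖ * r := by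
      rw [e]
      refine (norm_add_le _ _).trans (add_le_add ?_ ?_)
      · refine (norm_mul_le _ _).trans ?_
        gcongr
        exact (norm_pow_le _ _).trans (by gcongr)
      · refine (norm_mul_le _ _).trans ?_
        gcongr
    calc ‖x ^ (n + 1) - y ^ (n + 1)‖ * r ≤ (r ^ n * ‖x - y‖ + n * ‖x - y‖ * r ^ n) * r := by
          gcongr; linarith
      _ = _ := by push_cast; ring

/-- The Lie product formula. -/
theorem tendsto_exp_mul_exp_pow (a b : 𝔸) :
    Tendsto (fun n : ℕ => (exp ((n : ℝ)⁻¹ • a) * exp ((n : ℝ)⁻¹ • b)) ^ n) atTop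
      (𝓝 (exp (a + b))) := by
  -- `f` vanishes to second order at `0` in the sense that `f 0 = 0` and `f' 0 = 0`; hence `n ‖f
  -- (1/n)‖` tends to `0`, and that is what the telescoping bound multiplies by `exp (‖a‖ + ‖b‖)`.
  set f : ℝ → 𝔸 := fun t => exp (t • a) * exp (t • b) - exp (t • (a + b)) with hf
  have hd : HasDerivAt f 0 0 := by
    have h := ((hasDerivAt_exp_smul_const a (0 : ℝ)).mul (hasDerivAt_exp_smul_const b (0 : ℝ))).sub
      (hasDerivAt_exp_smul_const (a + b) (0 : ℝ))
    exact h.congr_deriv (by simp)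
  have hlim : Tendsto (fun n : ℕ => (n : ℝ) * ‖f ((n : ℝ)⁻¹)‖) atTop (𝓝 0) := by
    have h := hasDerivAt_iff_tendsto_slope.1 hd
    have h2 : Tendsto (fun n : ℕ => (n : ℝ)⁻¹) atTop (𝓝[≠] 0) :=
      (tendsto_inv_atTop_nhdsGT_zero.comp tendsto_natCast_atTop_atTop).mono_right
        (nhdsWithin_mono _ fun x hx => ne_of_gt hx)
    have h3 := (h.comp h2).norm
    rw [norm_zero] at h3
    refine h3.congr fun n => ?_
    have f0 : f 0 = 0 := by simp [hf]
    simp [slope, f0, norm_smul]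
  rw [tendsto_iff_norm_sub_tendsto_zero]
  refine squeeze_zero' (Eventually.of_forall fun _ => norm_nonneg _) ?_
    (by simpa using hlim.mul_const (Real.exp (‖a‖ + ‖b‖)))
  filter_upwards [eventually_ge_atTop 1] with n hn
  have hn' : (0 : ℝ) < n := by exact_mod_cast hn
  set r := Real.exp ((n : ℝ)⁻¹ * (‖a‖ + ‖b‖)) with hr
  let _ : NormedAlgebra ℚ 𝔸 := .restrictScalars ℚ ℝ 𝔸
  have e1 : exp (a + b) = exp ((n : ℝ)⁻¹ • (a + b)) ^ n := by
    rw [← NormedSpace.exp_nsmul, ← Nat.cast_smul_eq_nsmul ℝ, smul_smul, mul_inv_cancel₀ hn'.ne', one_smul]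
  have hx : ‖exp ((n : ℝ)⁻¹ • a) * exp ((n : ℝ)⁻¹ • b)‖ ≤ r := by
    refine (norm_mul_le _ _).trans ?_
    rw [hr, mul_add, Real.exp_add]
    gcongr
    · refine (norm_exp_le_exp_norm _).trans ?_
      rw [norm_smul, Real.norm_of_nonneg (by positivity)]
    · refine (norm_exp_le_exp_norm _).trans ?_
      rw [norm_smul, Real.norm_of_nonneg (by positivity)]
  have hy : ‖exp ((n : ℝ)⁻¹ • (a + b))‖ ≤ r := by
    refine (norm_exp_le_exp_norm _).trans ?_
    rw [norm_smul, Real.norm_of_nonneg (by positivity), hr]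
    gcongr
    exact norm_add_le _ _
  have key := norm_pow_sub_pow_le _ _ hx hy n
  -- The spare factor `r` in `norm_pow_sub_pow_le` can be dropped because it is at least `1`.
  have hr1 : 1 ≤ r := Real.one_le_exp (by positivity)
  have hrn : r ^ n = Real.exp (‖a‖ + ‖b‖) := by
    rw [hr, ← Real.exp_nat_mul]; congr 1; field_simp
  rw [e1, ← hrn]
  refine le_trans ?_ key
  exact le_mul_of_one_le_right (norm_nonneg _) hr1

end Trotter

/-! ### Trace inequalities for matrices and the trace exponential. -/

variable {ι : Type*} [Fintype ι] [DecidableEq ι]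

theorem trace_mul_le_sqrt_mul_sqrt (A B : Matrix ι ι ℝ) :
    trace (A * B) ≤ √(trace (A * Aᵀ)) * √(trace (B * Bᵀ)) := by
  have h := Real.sum_mul_le_sqrt_mul_sqrt (Finset.univ : Finset (ι × ι))
    (fun z => A z.1 z.2) (fun z => B z.2 z.1)
  have e1 : trace (A * B) = ∑ z : ι × ι, A z.1 z.2 * B z.2 z.1 := by
    simp [trace, mul_apply, Fintype.sum_prod_type]
  have e2 : trace (A * Aᵀ) = ∑ z : ι × ι, A z.1 z.2 ^ 2 := by
    simp [trace, mul_apply, Fintype.sum_prod_type, sq]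
  have e3 : trace (B * Bᵀ) = ∑ z : ι × ι, B z.2 z.1 ^ 2 := by
    rw [Fintype.sum_prod_type, Finset.sum_comm]
    simp [trace, mul_apply, sq]
  rw [e1, e2, e3]
  exact h

theorem trace_mul_pow_comm (A B : Matrix ι ι ℝ) (n : ℕ) :
    trace ((A * B) ^ n) = trace ((B * A) ^ n) := by
  cases n with
  | zero => simp
  | succ n =>
    have h : (A * B) ^ (n + 1) = A * ((B * A) ^ n * B) := by
      have : ∀ n : ℕ, (A * B) ^ n * A = A * (B * A) ^ n := fun n => by
        induction n with
        | zero => simp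
        | succ n ih => rw [pow_succ', pow_succ', mul_assoc, ih]; simp only [mul_assoc]
      rw [pow_succ, ← mul_assoc, this, mul_assoc]
    rw [h, trace_mul_comm, mul_assoc, pow_succ]

/-- A joint induction. The first inequality for `k + 1` follows from the first for `M²`, cyclicity
of the trace, the second for `M Mᵀ` and `Mᵀ M`, and Cauchy–Schwarz; the second one follows from the
first for `P Q` and the second for `P²` and `Q²`. Powers of two are enough, since the Lie formula
can be used along a subsequence. -/
theorem trace_pow_two_pow_le (k : ℕ) :
    (∀ M : Matrix ι ι ℝ, trace (M ^ 2 ^ (k + 1)) ≤ trace ((M * Mᵀ) ^ 2 ^ k)) ∧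
    ∀ P Q : Matrix ι ι ℝ, Pᵀ = P → Qᵀ = Q →
      trace ((P * Q) ^ 2 ^ k) ≤ trace (P ^ 2 ^ k * Q ^ 2 ^ k) := by
  induction k with
  | zero =>
    refine ⟨fun M => ?_, fun P Q _ _ => by simp⟩
    have h := trace_mul_le_sqrt_mul_sqrt M M
    rw [Real.mul_self_sqrt] at h
    · simpa [sq] using h
    · simp only [trace, diag, mul_apply, transpose_apply]
      exact Finset.sum_nonneg fun _ _ => Finset.sum_nonneg fun _ _ => mul_self_nonneg _
  | succ k ih =>
    obtain ⟨ih1, ih2⟩ := ih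
    constructor
    · intro M
      have h1 := ih1 (M ^ 2)
      rw [← pow_mul, ← pow_succ'] at h1
      refine h1.trans ?_
      have e1 : M ^ 2 * (M ^ 2)ᵀ = M * (M * Mᵀ * Mᵀ) := by
        rw [transpose_pow, sq, sq]; simp only [mul_assoc]
      have e2 : M * Mᵀ * Mᵀ * M = (M * Mᵀ) * (Mᵀ * M) := by simp only [mul_assoc]
      rw [e1, trace_mul_pow_comm, e2]
      refine (ih2 _ _ (by simp) (by simp)).trans ?_
      refine (trace_mul_le_sqrt_mul_sqrt _ _).trans ?_
      simp only [transpose_pow, transpose_mul, transpose_transpose, ← pow_add]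
      have e3 : 2 ^ k + 2 ^ k = 2 ^ (k + 1) := by rw [pow_succ]; ring
      rw [e3, trace_mul_pow_comm Mᵀ M, Real.mul_self_sqrt]
      have : (M * Mᵀ) ^ 2 ^ (k + 1) = ((M * Mᵀ) ^ 2 ^ k) * ((M * Mᵀ) ^ 2 ^ k)ᵀ := by
        rw [transpose_pow, transpose_mul, transpose_transpose, ← pow_add, e3]
      rw [this]
      simp only [trace, diag, mul_apply, transpose_apply]
      exact Finset.sum_nonneg fun _ _ => Finset.sum_nonneg fun _ _ => mul_self_nonneg _
    · intro P Q hP hQ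
      refine (ih1 (P * Q)).trans ?_
      have e1 : P * Q * (P * Q)ᵀ = P * (Q * Q * P) := by
        rw [transpose_mul, hP, hQ]; simp only [mul_assoc]
      have e2 : Q * Q * P * P = Q ^ 2 * P ^ 2 := by rw [sq, sq]; simp only [mul_assoc]
      rw [e1, trace_mul_pow_comm, e2, trace_mul_pow_comm]
      refine (ih2 (P ^ 2) (Q ^ 2) (by rw [transpose_pow, hP]) (by rw [transpose_pow, hQ])).trans ?_
      rw [← pow_mul, ← pow_mul, ← pow_succ']

-- The operator norm only supplies a Banach algebra structure, with `‖1‖ = 1` by nonemptiness; the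
-- limit itself is independent of the norm.
open scoped Matrix.Norms.Operator in
theorem tendsto_matrix_exp_mul_exp_pow [Nonempty ι] (A B : Matrix ι ι ℝ) :
    Tendsto (fun n : ℕ => (exp ((n : ℝ)⁻¹ • A) * exp ((n : ℝ)⁻¹ • B)) ^ n) atTop
      (𝓝 (exp (A + B))) :=
  tendsto_exp_mul_exp_pow A B

/-- The **Golden–Thompson inequality**. -/
theorem trace_exp_add_le {A B : Matrix ι ι ℝ} (hA : Aᵀ = A) (hB : Bᵀ = B) :
    trace (exp (A + B)) ≤ trace (exp A * exp B) := by
  rcases isEmpty_or_nonempty ι with h | h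
  · simp [trace]
  have ht := (tendsto_matrix_exp_mul_exp_pow A B).comp
    (tendsto_pow_atTop_atTop_of_one_lt (one_lt_two : 1 < 2))
  have hc : Continuous (fun M : Matrix ι ι ℝ => trace M) := by fun_prop
  refine le_of_tendsto ((hc.tendsto _).comp ht) (Eventually.of_forall fun k => ?_)
  simp only [Function.comp]
  refine ((trace_pow_two_pow_le k).2 _ _ ?_ ?_).trans ?_
  · rw [← Matrix.exp_transpose, transpose_smul, hA]
  · rw [← Matrix.exp_transpose, transpose_smul, hB]
  · have e : ∀ X : Matrix ι ι ℝ, exp (((2 ^ k : ℕ) : ℝ)⁻¹ • X) ^ 2 ^ k = exp X := fun X => by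
      rw [← Matrix.exp_nsmul, ← Nat.cast_smul_eq_nsmul ℝ, smul_smul, mul_inv_cancel₀ (by positivity), one_smul]
    rw [e, e]

/-- `v vᵀ / |v|²` is a projection, so all powers are explicit; only the zeroth power sees the
complementary projection. -/
theorem exp_smul_vecMulVec {v : ι → ℝ} (hv : v ⬝ᵥ v ≠ 0) (z : ℝ) :
    exp (z • vecMulVec v v) =
      1 + ((Real.exp (z * (v ⬝ᵥ v)) - 1) / (v ⬝ᵥ v)) • vecMulVec v v := by
  set s := v ⬝ᵥ v
  have hp : ∀ n : ℕ, (z • vecMulVec v v) ^ n =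
      (if n = 0 then 1 - s⁻¹ • vecMulVec v v else 0) + (s⁻¹ * (z * s) ^ n) • vecMulVec v v := by
    intro n
    induction n with
    | zero => simp
    | succ n ih =>
      have hm : vecMulVec v v * vecMulVec v v = s • vecMulVec v v := by
        rw [vecMulVec_mul_vecMulVec]; ext i j; simp [vecMulVec_apply, s]; ring
      rw [pow_succ, ih, add_mul]
      rcases n with _ | n
      · simp only [if_true, sub_mul, one_mul, smul_mul_smul_comm, hm, smul_smul, pow_zero, mul_one,
          zero_add, pow_one, one_ne_zero, if_false]
        rw [← sub_smul, ← add_smul]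
        congr 1
        field_simp
        ring
      · simp only [Nat.add_eq_zero_iff, one_ne_zero, and_false, if_false, zero_mul, zero_add,
          smul_mul_smul_comm, hm, smul_smul]
        congr 1
        ring
  have h2 : HasSum (fun n : ℕ => ((n.factorial : ℝ)⁻¹) • (z • vecMulVec v v) ^ n)
      ((1 - s⁻¹ • vecMulVec v v) + (s⁻¹ * Real.exp (z * s)) • vecMulVec v v) := by
    simp only [hp, smul_add]
    refine HasSum.add ?_ ?_
    · convert hasSum_ite_eq (0 : ℕ) (1 - s⁻¹ • vecMulVec v v) using 2 with n
      by_cases hn : n = 0 <;> simp [hn]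
    · have h : HasSum (fun n : ℕ => ((n.factorial : ℝ)⁻¹) • (z * s) ^ n) (Real.exp (z * s)) := by
        rw [Real.exp_eq_exp_ℝ]; exact exp_series_hasSum_exp' (𝕂 := ℝ) (z * s)
      convert (h.mul_left s⁻¹).smul_const (vecMulVec v v) using 2 with n
      rw [smul_smul]; congr 1; simp only [smul_eq_mul]; ring
  rw [exp_eq_tsum ℝ]
  refine h2.tsum_eq.trans ?_
  rw [sub_add_eq_add_sub, add_sub_assoc, ← sub_smul]
  congr 2
  field_simp

/-- `exp D` is the square of the symmetric matrix `exp (D/2)`. -/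
theorem posSemidef_exp {D : Matrix ι ι ℝ} (hD : Dᵀ = D) : (exp D).PosSemidef := by
  have h : exp D = (exp ((2 : ℝ)⁻¹ • D))ᴴ * exp ((2 : ℝ)⁻¹ • D) := by
    rw [conjTranspose_eq_transpose_of_trivial, ← Matrix.exp_transpose, transpose_smul, hD,
      ← Matrix.exp_add_of_commute _ _ (Commute.refl _), ← add_smul]
    norm_num
  rw [h]
  exact posSemidef_conjTranspose_mul_self _

theorem trace_exp_nonneg {D : Matrix ι ι ℝ} (hD : Dᵀ = D) : 0 ≤ trace (exp D) :=
  (posSemidef_exp hD).trace_nonneg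

/-- If `ζ` is a random number with `E exp (ζ |v|²) ≤ 1`, then
`E tr exp (D + ζ v vᵀ) ≤ tr exp D`. -/
theorem convexComb_trace_exp_le {D : Matrix ι ι ℝ} (hD : Dᵀ = D) (v : ι → ℝ) {r r' z z' : ℝ}
    (hr : 0 ≤ r) (hr' : 0 ≤ r') (hrr : r + r' = 1)
    (h : r * Real.exp (z * (v ⬝ᵥ v)) + r' * Real.exp (z' * (v ⬝ᵥ v)) ≤ 1) :
    r * trace (exp (D + z • vecMulVec v v)) + r' * trace (exp (D + z' • vecMulVec v v)) ≤
      trace (exp D) := by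
  by_cases hv : v ⬝ᵥ v = 0
  · have : v = 0 := dotProduct_self_eq_zero.1 hv
    simp [this, ← add_mul, hrr]
  -- Golden–Thompson splits off the rank-one exponential. The bound is affine in `exp (z |v|²)`, so
  -- averaging over `z` only needs the scalar hypothesis.
  have key : ∀ z : ℝ, trace (exp (D + z • vecMulVec v v)) ≤ trace (exp D) +
      (Real.exp (z * (v ⬝ᵥ v)) - 1) / (v ⬝ᵥ v) * (v ⬝ᵥ exp D *ᵥ v) := fun z => by
    refine (trace_exp_add_le hD (by rw [transpose_smul, transpose_vecMulVec])).trans ?_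
    rw [exp_smul_vecMulVec hv, mul_add, mul_one, trace_add, Matrix.mul_smul, trace_smul,
      mul_vecMulVec, trace_vecMulVec, smul_eq_mul, dotProduct_comm v (exp D *ᵥ v)]
  have hpos : 0 ≤ (v ⬝ᵥ exp D *ᵥ v) / (v ⬝ᵥ v) := by
    have := (posSemidef_exp hD).dotProduct_mulVec_nonneg v
    refine div_nonneg (by simpa using this) ?_
    exact Finset.sum_nonneg fun _ _ => mul_self_nonneg _
  have h1 := mul_le_mul_of_nonneg_left (key z) hr
  have h2 := mul_le_mul_of_nonneg_left (key z') hr'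
  have h3 := mul_le_mul_of_nonneg_right h hpos
  have e : r * (trace (exp D) + (Real.exp (z * (v ⬝ᵥ v)) - 1) / (v ⬝ᵥ v) * (v ⬝ᵥ exp D *ᵥ v)) +
      r' * (trace (exp D) + (Real.exp (z' * (v ⬝ᵥ v)) - 1) / (v ⬝ᵥ v) * (v ⬝ᵥ exp D *ᵥ v)) =
      (r + r') * trace (exp D) + (r * Real.exp (z * (v ⬝ᵥ v)) + r' * Real.exp (z' * (v ⬝ᵥ v))
        - (r + r')) * ((v ⬝ᵥ exp D *ᵥ v) / (v ⬝ᵥ v)) := by ring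
  rw [hrr] at e
  nlinarith

theorem trace_exp_smul_one (t : ℝ) :
    trace (exp (t • (1 : Matrix ι ι ℝ))) = Fintype.card ι * Real.exp t := by
  rw [smul_one_eq_diagonal, Matrix.exp_diagonal, trace_diagonal]
  simp [Pi.coe_exp, Real.exp_eq_exp_ℝ]

/-- Each `exp λ`, for an eigenvalue `λ`, is at most the trace. This turns a bound for the potential
into a spectral bound. -/
theorem dotProduct_mulVec_le_of_trace_exp_le {D : Matrix ι ι ℝ} (hD : Dᵀ = D) {t : ℝ}
    (h : trace (exp D) ≤ Real.exp t) (y : ι → ℝ) : y ⬝ᵥ D *ᵥ y ≤ t * (y ⬝ᵥ y) := by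
  have hH : D.IsHermitian := by rw [IsHermitian, conjTranspose_eq_transpose_of_trivial, hD]
  set V : Matrix ι ι ℝ := (hH.eigenvectorUnitary : Matrix ι ι ℝ)
  have hV : V * star V = 1 := (Unitary.mul_star_self_of_mem hH.eigenvectorUnitary.2)
  have hV' : star V * V = 1 := (Unitary.star_mul_self_of_mem hH.eigenvectorUnitary.2)
  have hs : D = V * diagonal hH.eigenvalues * star V := by
    conv_lhs => rw [hH.spectral_theorem, Unitary.conjStarAlgAut_apply]
    simp [V]
  have hst : star V = Vᵀ := by rw [star_eq_conjTranspose, conjTranspose_eq_transpose_of_trivial]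
  rw [hst] at hV hV' hs
  have hinv : V⁻¹ = Vᵀ := inv_eq_right_inv hV
  have htr : trace (exp D) = ∑ i, Real.exp (hH.eigenvalues i) := by
    conv_lhs => rw [hs, ← hinv]
    rw [Matrix.exp_conj _ _ (IsUnit.of_mul_eq_one _ hV), hinv, trace_mul_comm, ← mul_assoc, hV',
      one_mul, Matrix.exp_diagonal, trace_diagonal]
    simp [Pi.coe_exp, Real.exp_eq_exp_ℝ]
  have hle : ∀ i, hH.eigenvalues i ≤ t := fun i => by
    rw [← Real.exp_le_exp]
    refine le_trans ?_ (htr.symm.trans_le h)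
    exact Finset.single_le_sum (f := fun i => Real.exp (hH.eigenvalues i))
      (fun _ _ => (Real.exp_pos _).le) (Finset.mem_univ i)
  have e1 : y ⬝ᵥ D *ᵥ y = ∑ i, hH.eigenvalues i * ((Vᵀ *ᵥ y) i) ^ 2 := by
    conv_lhs => rw [hs]
    rw [← mulVec_mulVec, ← mulVec_mulVec, dotProduct_mulVec, ← mulVec_transpose, dotProduct]
    refine Finset.sum_congr rfl fun i _ => ?_
    rw [mulVec_diagonal]; ring
  have e2 : y ⬝ᵥ y = ∑ i, ((Vᵀ *ᵥ y) i) ^ 2 := by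
    calc y ⬝ᵥ y = y ⬝ᵥ (V * Vᵀ) *ᵥ y := by rw [hV, one_mulVec]
      _ = _ := by
        rw [← mulVec_mulVec, dotProduct_mulVec, ← mulVec_transpose, dotProduct]
        exact Finset.sum_congr rfl fun i _ => (sq _).symm
  rw [e1, e2, Finset.mul_sum]
  gcongr with i _
  exact hle i

end GoldenThompson

/-! ### Leverages -/

section Leverage

open Matrix

variable {d : ℕ}

/-- A normalization of a positive semidefinite matrix `U`: a matrix `B` with `B U Bᵀ = 1` such that
`Bᵀ B` is a generalized inverse of `U`. -/
theorem exists_normalizer {U : Matrix (Fin d) (Fin d) ℝ} (hU : U.PosSemidef) :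
    ∃ (s : Finset (Fin d)) (B : Matrix s (Fin d) ℝ),
      B * U * Bᵀ = 1 ∧ U * Bᵀ * B * U = U ∧ (U * (Bᵀ * B))ᵀ = U * (Bᵀ * B) := by
  classical
  set hH := hU.1
  set V : Matrix (Fin d) (Fin d) ℝ := (hH.eigenvectorUnitary : Matrix (Fin d) (Fin d) ℝ)
  have hV : V * star V = 1 := (Unitary.mul_star_self_of_mem hH.eigenvectorUnitary.2)
  have hV' : star V * V = 1 := (Unitary.star_mul_self_of_mem hH.eigenvectorUnitary.2)
  set l := hH.eigenvalues
  have hl : ∀ i, 0 ≤ l i := hU.eigenvalues_nonneg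
  have hs : U = V * diagonal l * star V := by
    conv_lhs => rw [hH.spectral_theorem, Unitary.conjStarAlgAut_apply]
    simp [V, l]
  have hst : star V = Vᵀ := by rw [star_eq_conjTranspose, conjTranspose_eq_transpose_of_trivial]
  rw [hst] at hV hV' hs
  set s : Finset (Fin d) := Finset.univ.filter fun i => l i ≠ 0
  have hmem : ∀ i : s, l i ≠ 0 := fun i => (Finset.mem_filter.1 i.2).2
  -- `E` selects the nonzero eigenvalues and rescales them to `1`; the normalizer is `E Vᵀ`, with as
  -- many rows as the rank of `U`.
  set E : Matrix s (Fin d) ℝ := of fun i j => if (i : Fin d) = j then (√(l j))⁻¹ else 0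
  have hEE : Eᵀ * E = diagonal fun i => (l i)⁻¹ := by
    ext i j
    rw [mul_apply, diagonal_apply]
    simp only [E, transpose_apply, of_apply, ite_mul, zero_mul, mul_ite, mul_zero]
    by_cases hi : l i = 0
    · rw [Finset.sum_eq_zero]
      · simp [hi]
      · intro k _
        have : (k : Fin d) ≠ i := fun h => hmem k (h ▸ hi)
        simp [this]
    · rw [Finset.sum_eq_single ⟨i, Finset.mem_filter.2 ⟨Finset.mem_univ _, hi⟩⟩]
      · by_cases hij : i = j
        · subst hij
          simp only [if_true]
          rw [← mul_inv, Real.mul_self_sqrt (hl i)]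
        · simp [hij]
      · intro k _ hk
        have : (k : Fin d) ≠ i := fun h => hk (Subtype.ext h)
        simp [this]
      · simp
  have hELE : E * diagonal l * Eᵀ = 1 := by
    ext i j
    rw [mul_apply, one_apply]
    simp only [mul_diagonal, E, transpose_apply, of_apply, ite_mul, zero_mul, mul_ite, mul_zero]
    rw [Finset.sum_ite_eq]
    simp only [Finset.mem_univ, if_true]
    by_cases hij : i = j
    · subst hij
      simp only [if_true]
      have := hmem i
      rw [mul_comm _ (l i), mul_assoc, ← mul_inv, Real.mul_self_sqrt (hl i), mul_inv_cancel₀ this]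
    · have : (i : Fin d) ≠ j := fun h => hij (Subtype.ext h)
      simp [this, hij]
  have hBB : (E * Vᵀ)ᵀ * (E * Vᵀ) = V * (diagonal fun i => (l i)⁻¹) * Vᵀ := by
    rw [← hEE, transpose_mul, transpose_transpose]; simp only [Matrix.mul_assoc]
  have c1 : ∀ X : Matrix (Fin d) (Fin d) ℝ, Vᵀ * (V * X) = X := fun X => by
    rw [← Matrix.mul_assoc, hV', Matrix.one_mul]
  have hUB : U * ((E * Vᵀ)ᵀ * (E * Vᵀ)) = V * (diagonal fun i => l i * (l i)⁻¹) * Vᵀ := by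
    rw [hBB, hs]
    simp only [Matrix.mul_assoc, c1]
    rw [← Matrix.mul_assoc (diagonal l), diagonal_mul_diagonal]
  refine ⟨s, E * Vᵀ, ?_, ?_, ?_⟩
  · have c2 : ∀ X : Matrix (Fin d) s ℝ, Vᵀ * (V * X) = X := fun X => by
      rw [← Matrix.mul_assoc, hV', Matrix.one_mul]
    rw [hs, transpose_mul, transpose_transpose]
    simp only [Matrix.mul_assoc, c2]
    rw [← Matrix.mul_assoc]; exact hELE
  · rw [Matrix.mul_assoc U, hUB, hs]
    simp only [Matrix.mul_assoc, c1]
    rw [← Matrix.mul_assoc (diagonal _) (diagonal _), diagonal_mul_diagonal]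
    congr 3
    ext i
    by_cases hi : l i = 0
    · simp [hi]
    · field_simp
  · rw [hUB]
    simp [transpose_mul, Matrix.mul_assoc]

/-- `pinv` is a choice among the Penrose inverses, so it is enough to exhibit one, namely `Bᵀ B` for
a normalizer `B`. Its uniqueness plays no role. -/
theorem isMoorePenrose_pinv {U : Matrix (Fin d) (Fin d) ℝ} (hU : U.PosSemidef) :
    IsMoorePenrose U (pinv U) := by
  have h : ∃ X, IsMoorePenrose U X := by
    obtain ⟨s, B, h1, h2, h3⟩ := exists_normalizer hU
    refine ⟨Bᵀ * B, ?_, ?_, h3, ?_⟩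
    · rw [← Matrix.mul_assoc]; exact h2
    · calc Bᵀ * B * U * (Bᵀ * B) = Bᵀ * (B * U * Bᵀ) * B := by simp only [Matrix.mul_assoc]
        _ = _ := by rw [h1, Matrix.mul_one]
    · have hUt : Uᵀ = U := by
        rw [← conjTranspose_eq_transpose_of_trivial]; exact hU.1
      have h4 : Bᵀ * B * U = U * (Bᵀ * B) := by
        rw [← h3, transpose_mul, transpose_mul, transpose_transpose, hUt]
      rw [h4, h3]
  rw [pinv, dif_pos h]
  exact h.choose_spec

/-- The leverage `uᵀ U† u`. -/
def lev (U : Matrix (Fin d) (Fin d) ℝ) (u : Fin d → ℝ) : ℝ := u ⬝ᵥ pinv U *ᵥ u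

/-- `u uᵀ ≼ t U`. -/
def Dom (U : Matrix (Fin d) (Fin d) ℝ) (u : Fin d → ℝ) (t : ℝ) : Prop :=
  ∀ x, (u ⬝ᵥ x) ^ 2 ≤ t * (x ⬝ᵥ U *ᵥ x)

/-- `u uᵀ ≼ t U` for some `t`. -/
def Dominated (U : Matrix (Fin d) (Fin d) ℝ) (u : Fin d → ℝ) : Prop := ∃ t, 0 ≤ t ∧ Dom U u t

variable {U V : Matrix (Fin d) (Fin d) ℝ} {u : Fin d → ℝ}

theorem quad_nonneg (hU : U.PosSemidef) (x : Fin d → ℝ) : 0 ≤ x ⬝ᵥ U *ᵥ x := by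
  simpa using hU.dotProduct_mulVec_nonneg x

theorem PosSemidef.transpose_eq (hU : U.PosSemidef) : Uᵀ = U := by
  rw [← conjTranspose_eq_transpose_of_trivial]; exact hU.1

theorem dotProduct_mulVec_comm (hU : U.PosSemidef) (x y : Fin d → ℝ) :
    x ⬝ᵥ U *ᵥ y = y ⬝ᵥ U *ᵥ x := by
  rw [dotProduct_mulVec, ← mulVec_transpose, PosSemidef.transpose_eq hU, dotProduct_comm]

theorem sq_dotProduct_mulVec_le (hU : U.PosSemidef) (x y : Fin d → ℝ) :
    (x ⬝ᵥ U *ᵥ y) ^ 2 ≤ (x ⬝ᵥ U *ᵥ x) * (y ⬝ᵥ U *ᵥ y) := by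
  have h : ∀ t : ℝ, 0 ≤ (y ⬝ᵥ U *ᵥ y) * (t * t) + (2 * (x ⬝ᵥ U *ᵥ y)) * t + x ⬝ᵥ U *ᵥ x := fun t => by
    have := quad_nonneg hU (x + t • y)
    simp only [mulVec_add, mulVec_smul, add_dotProduct, dotProduct_add, smul_dotProduct,
      dotProduct_smul, smul_eq_mul, dotProduct_mulVec_comm hU y x] at this
    linarith
  have := discrim_le_zero h
  rw [discrim] at this
  linarith

/-- The residual `u - U U† u` lies in the kernel of `U`; domination makes `u` orthogonal to that
kernel, so the residual is orthogonal to itself. Afterwards leverages can be handled as `zᵀ U z`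
with `u = U z`, without the pseudoinverse. -/
theorem exists_mulVec_eq (hU : U.PosSemidef) (hu : Dominated U u) :
    ∃ z, u = U *ᵥ z ∧ lev U u = z ⬝ᵥ U *ᵥ z := by
  obtain ⟨t, _, ht⟩ := hu
  obtain ⟨h1, -, h3, -⟩ := isMoorePenrose_pinv hU
  set X := pinv U with hX
  have hPU : U * (U * X) = U := by
    rw [← h3, transpose_mul, PosSemidef.transpose_eq hU]
    have := congrArg transpose h1
    rw [transpose_mul, transpose_mul, PosSemidef.transpose_eq hU] at this
    exact this
  set r := u - U *ᵥ X *ᵥ u with hr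
  have hUr : U *ᵥ r = 0 := by
    rw [hr, mulVec_sub, mulVec_mulVec, mulVec_mulVec, Matrix.mul_assoc, hPU, sub_self]
  have hur : u ⬝ᵥ r = 0 := by
    have := ht r
    rw [hUr, dotProduct_zero, mul_zero] at this
    exact pow_eq_zero_iff two_ne_zero |>.1 (le_antisymm this (sq_nonneg _))
  have hr0 : r = 0 := by
    apply dotProduct_self_eq_zero.1
    nth_rewrite 1 [hr]
    rw [sub_dotProduct, hur, zero_sub, neg_eq_zero, dotProduct_comm, dotProduct_mulVec_comm hU, hUr,
      dotProduct_zero]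
  have hu : u = U *ᵥ X *ᵥ u := by rwa [hr, sub_eq_zero] at hr0
  refine ⟨X *ᵥ u, hu, ?_⟩
  rw [← hu, lev, dotProduct_comm]

theorem dom_lev (hU : U.PosSemidef) (hu : Dominated U u) : Dom U u (lev U u) := by
  obtain ⟨z, hz, hl⟩ := exists_mulVec_eq hU hu
  intro x
  rw [hl]
  conv_lhs => rw [hz, dotProduct_comm, dotProduct_mulVec_comm hU]
  exact sq_dotProduct_mulVec_le hU z x

theorem lev_nonneg (hU : U.PosSemidef) (hu : Dominated U u) : 0 ≤ lev U u := by
  obtain ⟨z, hz, hl⟩ := exists_mulVec_eq hU hu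
  rw [hl]; exact quad_nonneg hU z

/-- Test the domination at the vector `z` with `u = U z`. Together with `dom_lev`, the leverage is
the least `t` with `u uᵀ ≼ t U`, which is why it is antitone in `U` (`lev_le_mul`). -/
theorem lev_le (hU : U.PosSemidef) {t : ℝ} (ht : 0 ≤ t) (hu : Dom U u t) : lev U u ≤ t := by
  obtain ⟨z, hz, hl⟩ := exists_mulVec_eq hU ⟨t, ht, hu⟩
  have h := hu z
  conv_lhs at h => rw [hz, dotProduct_comm]
  rw [hl]
  by_contra hc
  push Not at hc
  nlinarith [quad_nonneg hU z]

theorem lev_le_mul (hU : U.PosSemidef) (hV : V.PosSemidef) (hu : Dominated U u) {k : ℝ} (hk : 0 ≤ k)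
    (h : ∀ x, x ⬝ᵥ U *ᵥ x ≤ k * (x ⬝ᵥ V *ᵥ x)) : lev V u ≤ k * lev U u := by
  refine lev_le hV (mul_nonneg hk (lev_nonneg hU hu)) fun x => (dom_lev hU hu x).trans ?_
  rw [mul_comm k, mul_assoc]
  exact mul_le_mul_of_nonneg_left (h x) (lev_nonneg hU hu)

theorem lev_pos (hU : U.PosSemidef) (hu : Dominated U u) (h0 : u ≠ 0) : 0 < lev U u := by
  refine lt_of_le_of_ne (lev_nonneg hU hu) fun h => h0 ?_
  have := dom_lev hU hu u
  rw [← h, zero_mul] at this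
  exact dotProduct_self_eq_zero.1 (pow_eq_zero_iff two_ne_zero |>.1 (le_antisymm this (sq_nonneg _)))

@[simp] theorem lev_zero (U : Matrix (Fin d) (Fin d) ℝ) : lev U 0 = 0 := by simp [lev]

theorem lev_smul (U : Matrix (Fin d) (Fin d) ℝ) (c : ℝ) (u : Fin d → ℝ) :
    lev U (c • u) = c ^ 2 * lev U u := by
  simp only [lev, mulVec_smul, smul_dotProduct, dotProduct_smul, smul_eq_mul]; ring

theorem dominated_zero (U : Matrix (Fin d) (Fin d) ℝ) : Dominated U 0 :=
  ⟨0, le_rfl, fun x => by simp⟩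

theorem Dominated.smul (hu : Dominated U u) (c : ℝ) : Dominated U (c • u) := by
  obtain ⟨t, ht, hu⟩ := hu
  refine ⟨c ^ 2 * t, by positivity, fun x => ?_⟩
  rw [smul_dotProduct, smul_eq_mul, mul_pow, mul_assoc]
  exact mul_le_mul_of_nonneg_left (hu x) (sq_nonneg c)

/-- The leverage is the squared norm after normalization. -/
theorem dotProduct_normalizer {s : Finset (Fin d)} {B : Matrix s (Fin d) ℝ} (hU : U.PosSemidef)
    (hB : U * Bᵀ * B * U = U) (hu : Dominated U u) : (B *ᵥ u) ⬝ᵥ (B *ᵥ u) = lev U u := by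
  obtain ⟨z, hz, hl⟩ := exists_mulVec_eq hU hu
  rw [hl, hz, dotProduct_mulVec, ← mulVec_transpose, mulVec_mulVec, mulVec_mulVec,
    dotProduct_mulVec_comm hU, mulVec_mulVec]
  congr 2
  rw [← Matrix.mul_assoc, ← Matrix.mul_assoc, hB]

end Leverage

/-! ### Lewis weights: existence, comparison -/

section Lewis

set_option linter.unusedSectionVars false

open Matrix

variable {d : ℕ} {m : Type*} [Fintype m]

/-- The weighted Gram matrix `∑ c_i a_i a_iᵀ`. -/
def wgram (a : m → Fin d → ℝ) (c : m → ℝ) : Matrix (Fin d) (Fin d) ℝ :=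
  ∑ i, c i • vecMulVec (a i) (a i)

theorem wgram_quad (a : m → Fin d → ℝ) (c : m → ℝ) (x : Fin d → ℝ) :
    x ⬝ᵥ wgram a c *ᵥ x = ∑ i, c i * (a i ⬝ᵥ x) ^ 2 := by
  rw [wgram, sum_mulVec, dotProduct_sum]
  refine Finset.sum_congr rfl fun i _ => ?_
  rw [smul_mulVec, vecMulVec_mulVec, dotProduct_smul, smul_eq_mul]
  simp only [op_smul_eq_smul, dotProduct_smul, smul_eq_mul, dotProduct_comm x (a i)]
  ring

theorem wgram_posSemidef (a : m → Fin d → ℝ) {c : m → ℝ} (hc : ∀ i, 0 ≤ c i) :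
    (wgram a c).PosSemidef :=
  posSemidef_sum _ fun i _ => (posSemidef_vecMulVec_self_star (a i)).smul (hc i)

theorem wgram_eq_transpose_mul {k : ℕ} (A : Matrix (Fin k) (Fin d) ℝ) (c : Fin k → ℝ) :
    Aᵀ * diagonal c * A = wgram (fun i => A i) c := by
  ext i j
  rw [mul_apply, wgram, Matrix.sum_apply]
  refine Finset.sum_congr rfl fun k _ => ?_
  simp [vecMulVec_apply]; ring

theorem wgram_le {a : m → Fin d → ℝ} {c c' : m → ℝ} {k : ℝ} (h : ∀ i, a i ≠ 0 → c i ≤ k * c' i)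
    (x : Fin d → ℝ) : x ⬝ᵥ wgram a c *ᵥ x ≤ k * (x ⬝ᵥ wgram a c' *ᵥ x) := by
  rw [wgram_quad, wgram_quad, Finset.mul_sum]
  refine Finset.sum_le_sum fun i _ => ?_
  by_cases hi : a i = 0
  · simp [hi]
  · rw [← mul_assoc]
    exact mul_le_mul_of_nonneg_right (h i hi) (sq_nonneg _)

theorem dominated_wgram {a : m → Fin d → ℝ} {c : m → ℝ} (hc : ∀ i, 0 ≤ c i)
    (h : ∀ i, a i ≠ 0 → 0 < c i) (i : m) : Dominated (wgram a c) (a i) := by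
  by_cases hi : a i = 0
  · rw [hi]; exact dominated_zero _
  refine ⟨(c i)⁻¹, by have := h i hi; positivity, fun x => ?_⟩
  rw [wgram_quad, ← div_eq_inv_mul, le_div_iff₀ (h i hi), mul_comm]
  exact Finset.single_le_sum (f := fun i => c i * (a i ⬝ᵥ x) ^ 2)
    (fun i _ => mul_nonneg (hc i) (sq_nonneg _)) (Finset.mem_univ i)

variable {p : ℝ} {a : m → Fin d → ℝ} {U V : Matrix (Fin d) (Fin d) ℝ}

/-- The coefficients of the next Lewis iterate. -/
def lcoef (p : ℝ) (U : Matrix (Fin d) (Fin d) ℝ) (a : m → Fin d → ℝ) (i : m) : ℝ :=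
  lev U (a i) ^ (p / 2 - 1)

theorem lcoef_nonneg (hU : U.PosSemidef) (hd : ∀ i, Dominated U (a i)) (i : m) :
    0 ≤ lcoef p U a i := Real.rpow_nonneg (lev_nonneg hU (hd i)) _

theorem lcoef_pos (hU : U.PosSemidef) (hd : ∀ i, Dominated U (a i)) (i : m) (hi : a i ≠ 0) :
    0 < lcoef p U a i := Real.rpow_pos_of_pos (lev_pos hU (hd i) hi) _

/-- The exponent `p/2 - 1` is nonpositive, so a factor `r` between leverages becomes only
`r^(1-p/2)` between coefficients. This is the contraction behind all comparisons below. -/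
theorem lcoef_le {r : ℝ} (hp2 : p ≤ 2) (hr : 0 < r) (hU : U.PosSemidef)
    (hdU : ∀ i, Dominated U (a i)) (h : ∀ i, lev U (a i) ≤ r * lev V (a i)) (i : m)
    (hi : a i ≠ 0) : lcoef p V a i ≤ r ^ (1 - p / 2) * lcoef p U a i := by
  have h1 := lev_pos hU (hdU i) hi
  have h2 : lev U (a i) / r ≤ lev V (a i) := by rw [div_le_iff₀ hr, mul_comm]; exact h i
  refine (Real.rpow_le_rpow_of_nonpos (by positivity) h2 (by linarith)).trans_eq ?_
  rw [Real.div_rpow h1.le hr.le, div_eq_mul_inv, ← Real.rpow_neg hr.le, mul_comm, lcoef]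
  congr 2; ring

/-- If `V ≼ α F(V)` and `F(U) ≼ κ U` for the Lewis map `F`, then the weights with respect to `U` are
at most `α κ` times those with respect to `V`. -/
theorem lev_rpow_le (hp : 1 ≤ p) (hp2 : p ≤ 2) (hU : U.PosSemidef) (hV : V.PosSemidef)
    (hdU : ∀ i, Dominated U (a i)) (hdV : ∀ i, Dominated V (a i)) {α κ : ℝ} (hα : 0 < α)
    (hκ : 0 < κ) (h1 : ∀ x, x ⬝ᵥ V *ᵥ x ≤ α * (x ⬝ᵥ wgram a (lcoef p V a) *ᵥ x))
    (h2 : ∀ x, x ⬝ᵥ wgram a (lcoef p U a) *ᵥ x ≤ κ * (x ⬝ᵥ U *ᵥ x)) (i : m) :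
    lev U (a i) ^ (p / 2) ≤ α * κ * lev V (a i) ^ (p / 2) := by
  classical
  by_cases hi : a i = 0
  · rw [hi]; simp [Real.zero_rpow (show p / 2 ≠ 0 by linarith)]
  set s : Finset m := Finset.univ.filter fun i => a i ≠ 0
  have his : i ∈ s := by simp [s, hi]
  -- With the largest ratio `r` of leverages, `V ≼ α F(V) ≼ α r^(1-p/2) F(U) ≼ α κ r^(1-p/2) U`. At
  -- the maximizing row this gives `r ≤ α κ r^(1-p/2)`, that is, `r^(p/2) ≤ α κ`.
  obtain ⟨j, hj, hmax⟩ := s.exists_max_image (fun i => lev U (a i) / lev V (a i)) ⟨i, his⟩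
  have hj0 : a j ≠ 0 := (Finset.mem_filter.1 hj).2
  set r := lev U (a j) / lev V (a j) with hr
  have hVj := lev_pos hV (hdV j) hj0
  have hr0 : 0 < r := div_pos (lev_pos hU (hdU j) hj0) hVj
  have hall : ∀ i, lev U (a i) ≤ r * lev V (a i) := fun i => by
    by_cases hi : a i = 0
    · simp [hi]
    · rw [← div_le_iff₀ (lev_pos hV (hdV i) hi)]
      exact hmax i (by simp [s, hi])
  have h3 : ∀ x, x ⬝ᵥ V *ᵥ x ≤ (α * (r ^ (1 - p / 2) * κ)) * (x ⬝ᵥ U *ᵥ x) := fun x => by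
    refine (h1 x).trans ?_
    rw [mul_assoc]
    refine mul_le_mul_of_nonneg_left ?_ hα.le
    refine (wgram_le (lcoef_le hp2 hr0 hU hdU hall) x).trans ?_
    rw [mul_assoc]
    exact mul_le_mul_of_nonneg_left (h2 x) (by positivity)
  have h4 := lev_le_mul hV hU (hdV j) (by positivity) h3
  have h5 : r ≤ α * (r ^ (1 - p / 2) * κ) := by rw [hr, div_le_iff₀ hVj]; exact h4
  have h6 : r ^ (p / 2) ≤ α * κ := by
    have : r = r ^ (1 - p / 2) * r ^ (p / 2) := by rw [← Real.rpow_add hr0]; simp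
    nth_rewrite 1 [this] at h5
    have h7 : 0 < r ^ (1 - p / 2) := by positivity
    have : r ^ (1 - p / 2) * r ^ (p / 2) ≤ r ^ (1 - p / 2) * (α * κ) := by linarith
    exact le_of_mul_le_mul_left this h7
  refine (Real.rpow_le_rpow (lev_nonneg hU (hdU i)) (hall i) (by linarith)).trans ?_
  rw [Real.mul_rpow hr0.le (lev_nonneg hV (hdV i))]
  exact mul_le_mul_of_nonneg_right h6 (Real.rpow_nonneg (lev_nonneg hV (hdV i)) _)

/-- `U` is the Lewis quadratic form of the vectors `a_i`. -/
structure IsLewisForm (p : ℝ) (a : m → Fin d → ℝ) (U : Matrix (Fin d) (Fin d) ℝ) : Prop where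
  posSemidef : U.PosSemidef
  dominated : ∀ i, Dominated U (a i)
  eq : U = wgram a (lcoef p U a)

/-- Since `(p/2)(1 - 2/p) = p/2 - 1`, the Lewis equations say that the weighted Gram matrix is a
fixed point of the Lewis map. On zero rows the coefficients may disagree, but there they are
multiplied by zero. -/
theorem IsLewisWeights.exists_form {k : ℕ} {A : Matrix (Fin k) (Fin d) ℝ} {w : Fin k → ℝ}
    (hp : 1 ≤ p) (h : IsLewisWeights p A w) :
    ∃ U, IsLewisForm p (fun i => A i) U ∧ ∀ i, w i = lev U (A i) ^ (p / 2) := by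
  obtain ⟨h0, h1, h2⟩ := h
  rw [wgram_eq_transpose_mul] at h2
  set c : Fin k → ℝ := fun j => w j ^ (1 - 2 / p)
  set U := wgram (fun i => A i) c
  have hc : ∀ i, 0 ≤ c i := fun i => Real.rpow_nonneg (h0 i) _
  have hU : U.PosSemidef := wgram_posSemidef _ hc
  have hd : ∀ i, Dominated U (A i) := dominated_wgram (a := fun i => A i) hc fun i hi => Real.rpow_pos_of_pos (h1 i hi) _
  refine ⟨U, ⟨hU, hd, ?_⟩, h2⟩
  simp only [U, wgram]
  refine Finset.sum_congr rfl fun i _ => ?_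
  by_cases hi : A i = 0
  · simp [hi]
  congr 1
  simp only [c, lcoef]
  have : w i = lev U (A i) ^ (p / 2) := h2 i
  rw [this, ← Real.rpow_mul (lev_nonneg hU (hd i))]
  congr 1
  field_simp

/-- One step of the fixed point iteration for the logarithms of the Lewis weights. -/
def logStep (p : ℝ) (a : m → Fin d → ℝ) (y : m → ℝ) (i : m) : ℝ :=
  p / 2 * Real.log (lev (wgram a fun j => Real.exp (y j * (1 - 2 / p))) (a i))

/-- Logarithms at distance `s` change the form, hence the leverage, by at most `exp (s (2/p - 1))`,
and `(p/2)(2/p - 1) = 1 - p/2 ≤ 1/2` because `p ≥ 1`. -/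
theorem logStep_le (hp : 1 ≤ p) (hp2 : p ≤ 2) (y y' : m → ℝ) (i : m) :
    logStep p a y i ≤ 1 / 2 * dist y y' + logStep p a y' i := by
  -- For a zero row the iterate is constantly `0`, because `Real.log 0 = 0`.
  by_cases hi : a i = 0
  · simp only [logStep, hi, lev_zero, Real.log_zero, mul_zero, add_zero]; positivity
  have hc : ∀ y : m → ℝ, ∀ i, 0 < Real.exp (y i * (1 - 2 / p)) := fun y i => Real.exp_pos _
  have hP : ∀ y : m → ℝ, (wgram a fun j => Real.exp (y j * (1 - 2 / p))).PosSemidef := fun y =>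
    wgram_posSemidef _ fun i => (hc y i).le
  have hD : ∀ y : m → ℝ, ∀ i, Dominated (wgram a fun j => Real.exp (y j * (1 - 2 / p))) (a i) :=
    fun y => dominated_wgram (fun i => (hc y i).le) fun i _ => hc y i
  set s := dist y y'
  have hs : ∀ j, y j - y' j ≤ s := fun j => (le_abs_self _).trans (dist_le_pi_dist y y' j)
  have h1 : lev (wgram a fun j => Real.exp (y j * (1 - 2 / p))) (a i) ≤
      Real.exp (s * (2 / p - 1)) * lev (wgram a fun j => Real.exp (y' j * (1 - 2 / p))) (a i) := by
    refine lev_le_mul (hP y') (hP y) (hD y' i) (Real.exp_pos _).le fun x => wgram_le (fun j _ => ?_) x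
    rw [← Real.exp_add, Real.exp_le_exp]
    have h2 : 0 ≤ 2 / p - 1 := by rw [sub_nonneg, le_div_iff₀ (by linarith)]; linarith
    nlinarith [hs j]
  have h3 := Real.log_le_log (lev_pos (hP y) (hD y i) hi) h1
  rw [Real.log_mul (Real.exp_pos _).ne' (lev_pos (hP y') (hD y' i) hi).ne', Real.log_exp] at h3
  have h4 : s * (1 - p / 2) ≤ 1 / 2 * s := by nlinarith [dist_nonneg (x := y) (y := y')]
  have h5 : p / 2 * (s * (2 / p - 1)) = s * (1 - p / 2) := by field_simp
  simp only [logStep]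
  nlinarith

theorem contracting_logStep (hp : 1 ≤ p) (hp2 : p ≤ 2) (a : m → Fin d → ℝ) :
    ContractingWith (1 / 2) (logStep p a) := by
  refine ⟨by norm_num [← NNReal.coe_lt_coe], LipschitzWith.of_dist_le_mul fun y y' => ?_⟩
  refine (dist_pi_le_iff (by positivity)).2 fun i => ?_
  rw [Real.dist_eq, abs_le]
  have h1 := logStep_le (a := a) hp hp2 y y' i
  have h2 := logStep_le (a := a) hp hp2 y' y i
  rw [dist_comm] at h2
  push_cast
  constructor <;> linarith

theorem exists_isLewisWeights {k : ℕ} (hp : 1 ≤ p) (hp2 : p ≤ 2) (A : Matrix (Fin k) (Fin d) ℝ) :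
    ∃ w, IsLewisWeights p A w := by
  have hy := (contracting_logStep hp hp2 fun i => A i).fixedPoint_isFixedPt
  set y := (contracting_logStep hp hp2 fun i => A i).fixedPoint
  -- The fixed point assigns `exp 0` to zero rows; resetting these weights to `0` does not affect
  -- the Gram matrix.
  refine ⟨fun i => if A i = 0 then 0 else Real.exp (y i), fun i => ?_, fun i hi => ?_, fun i => ?_⟩
  · dsimp only; split_ifs <;> positivity
  · simp only [hi, if_false]; positivity
  · rw [wgram_eq_transpose_mul]
    have hw : (wgram (fun i => A i) fun j => (if A j = 0 then 0 else Real.exp (y j)) ^ (1 - 2 / p)) =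
        wgram (fun i => A i) fun j => Real.exp (y j * (1 - 2 / p)) := by
      refine Finset.sum_congr rfl fun i _ => ?_
      by_cases hi : A i = 0
      · simp [hi]
      · simp only [hi, if_false, ← Real.exp_mul]
    rw [hw]
    by_cases hi : A i = 0
    · simp [hi, Real.zero_rpow (show p / 2 ≠ 0 by linarith)]
    · simp only [hi, if_false]
      have hc : ∀ i, 0 < Real.exp (y i * (1 - 2 / p)) := fun i => Real.exp_pos _
      have h1 := lev_pos (wgram_posSemidef (fun i => A i) fun i => (hc i).le)
        (dominated_wgram (fun i => (hc i).le) (fun i _ => hc i) i) hi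
      have h2 : y i = logStep p (fun i => A i) y i := (congrFun hy i).symm
      conv_lhs => rw [h2, logStep, mul_comm, Real.exp_mul, Real.exp_log h1]
      rfl

theorem isLewisWeights_lewisWeight {k : ℕ} (hp : 1 ≤ p) (hp2 : p ≤ 2)
    (A : Matrix (Fin k) (Fin d) ℝ) : IsLewisWeights p A (lewisWeight p A) := by
  have h := exists_isLewisWeights hp hp2 A
  rw [lewisWeight, dif_pos h]
  exact h.choose_spec

theorem exists_lewisForm {k : ℕ} (hp : 1 ≤ p) (hp2 : p ≤ 2) (A : Matrix (Fin k) (Fin d) ℝ) :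
    ∃ U, IsLewisForm p (fun i => A i) U ∧ ∀ i, lewisWeight p A i = lev U (A i) ^ (p / 2) :=
  (isLewisWeights_lewisWeight hp hp2 A).exists_form hp

/-- The sum of the Lewis weights is the rank, the weights are at most `1`. -/
theorem IsLewisForm.sum_lev_rpow {s : Finset (Fin d)} {B : Matrix s (Fin d) ℝ}
    (h : IsLewisForm p a U) (hp : 1 ≤ p) (hB1 : B * U * Bᵀ = 1) (hB2 : U * Bᵀ * B * U = U) :
    (s.card : ℝ) = ∑ i, lev U (a i) ^ (p / 2) := by
  have h1 : trace (B * U * Bᵀ) = s.card := by rw [hB1]; simp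
  have h2 : trace (B * U * Bᵀ) = ∑ i, lcoef p U a i * ((B *ᵥ a i) ⬝ᵥ (B *ᵥ a i)) := by
    nth_rewrite 1 [h.eq]
    rw [wgram, Matrix.mul_sum, Matrix.sum_mul, trace_sum]
    refine Finset.sum_congr rfl fun i _ => ?_
    rw [Matrix.mul_smul, Matrix.smul_mul, trace_smul, mul_vecMulVec, vecMulVec_mul,
      trace_vecMulVec, vecMul_transpose, smul_eq_mul]
  rw [← h1, h2]
  refine Finset.sum_congr rfl fun i _ => ?_
  rw [dotProduct_normalizer h.posSemidef hB2 (h.dominated i), lcoef]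
  rcases (lev_nonneg h.posSemidef (h.dominated i)).eq_or_lt with h0 | h0
  · rw [← h0, mul_zero, Real.zero_rpow (by linarith)]
  · rw [← Real.rpow_add_one h0.ne']; congr 1; ring

/-- The row's own term in `U` already dominates `a_i a_iᵀ`, up to the factor `lcoef`; hence `lev *
lcoef ≤ 1`. -/
theorem IsLewisForm.lev_rpow_le_one (h : IsLewisForm p a U) (i : m) :
    lev U (a i) ^ (p / 2) ≤ 1 := by
  by_cases hi : a i = 0
  · rw [hi, lev_zero]; exact Real.zero_rpow_le_one _
  have hpos := lev_pos h.posSemidef (h.dominated i) hi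
  have hc := lcoef_pos (p := p) h.posSemidef h.dominated i hi
  have h1 : lev U (a i) ≤ (lcoef p U a i)⁻¹ := by
    refine lev_le h.posSemidef (by positivity) fun x => ?_
    nth_rewrite 2 [h.eq]
    rw [wgram_quad, ← div_eq_inv_mul, le_div_iff₀ hc, mul_comm]
    exact Finset.single_le_sum (f := fun i => lcoef p U a i * (a i ⬝ᵥ x) ^ 2)
      (fun i _ => mul_nonneg (lcoef_nonneg h.posSemidef h.dominated i) (sq_nonneg _))
      (Finset.mem_univ i)
  rwa [← one_div, le_div_iff₀ hc, lcoef, mul_comm, ← Real.rpow_add_one hpos.ne', sub_add_cancel] at h1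

theorem sum_lewisWeight_le {k : ℕ} (hp : 1 ≤ p) (hp2 : p ≤ 2) (A : Matrix (Fin k) (Fin d) ℝ) :
    ∑ i, lewisWeight p A i ≤ d := by
  obtain ⟨U, hU, hw⟩ := exists_lewisForm hp hp2 A
  obtain ⟨s, B, h1, h2, -⟩ := exists_normalizer hU.posSemidef
  simp only [hw]
  rw [← hU.sum_lev_rpow hp h1 h2]
  exact_mod_cast (Finset.card_le_univ s).trans_eq (Fintype.card_fin d)

/-! ### The fixed point iteration -/

/-- `U ≼ F(U) ≼ κ U` for the Lewis map `F`. -/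
structure IsLewisIterate (p : ℝ) (a : m → Fin d → ℝ) (κ : ℝ) (U : Matrix (Fin d) (Fin d) ℝ) :
    Prop where
  posSemidef : U.PosSemidef
  dominated : ∀ i, Dominated U (a i)
  lower : ∀ x, x ⬝ᵥ U *ᵥ x ≤ x ⬝ᵥ wgram a (lcoef p U a) *ᵥ x
  upper : ∀ x, x ⬝ᵥ wgram a (lcoef p U a) *ᵥ x ≤ κ * (x ⬝ᵥ U *ᵥ x)

/-- In the unweighted Gram matrix all leverages are at most `1`, so the next coefficients are at
least `1`. Conversely each new term is at most `lev^(p/2) ≤ 1` times the form, and there are `card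
m` terms. -/
theorem isLewisIterate_one (hp : 1 ≤ p) (hp2 : p ≤ 2) (a : m → Fin d → ℝ) :
    IsLewisIterate p a (Fintype.card m) (wgram a 1) := by
  have hU : (wgram a (1 : m → ℝ)).PosSemidef := wgram_posSemidef _ fun _ => zero_le_one
  have hd : ∀ i, Dominated (wgram a (1 : m → ℝ)) (a i) :=
    dominated_wgram (fun _ => zero_le_one) fun _ _ => one_pos
  refine ⟨hU, hd, fun x => ?_, fun x => ?_⟩
  · have h := wgram_le (a := a) (c := 1) (c' := lcoef p (wgram a 1) a) (k := 1) (fun i hi => ?_) x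
    · simpa using h
    · rw [one_mul]
      have h1 : lev (wgram a 1) (a i) ≤ 1 := lev_le hU zero_le_one fun x => by
        rw [one_mul, wgram_quad]
        simp only [Pi.one_apply, one_mul]
        exact Finset.single_le_sum (f := fun i => (a i ⬝ᵥ x) ^ 2)
          (fun i _ => sq_nonneg _) (Finset.mem_univ i)
      exact Real.one_le_rpow_of_pos_of_le_one_of_nonpos (lev_pos hU (hd i) hi) h1 (by linarith)
  · rw [wgram_quad, ← nsmul_eq_mul, Fintype.card]
    refine Finset.sum_le_card_nsmul _ _ _ fun i _ => ?_
    by_cases hi : a i = 0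
    · simpa [hi] using quad_nonneg hU x
    have hpos := lev_pos hU (hd i) hi
    have h1 : lev (wgram a 1) (a i) ≤ 1 := lev_le hU zero_le_one fun x => by
        rw [one_mul, wgram_quad]
        simp only [Pi.one_apply, one_mul]
        exact Finset.single_le_sum (f := fun i => (a i ⬝ᵥ x) ^ 2)
          (fun i _ => sq_nonneg _) (Finset.mem_univ i)
    calc lcoef p (wgram a 1) a i * (a i ⬝ᵥ x) ^ 2
        ≤ lcoef p (wgram a 1) a i * (lev (wgram a 1) (a i) * (x ⬝ᵥ wgram a 1 *ᵥ x)) :=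
          mul_le_mul_of_nonneg_left (dom_lev hU (hd i) x) (lcoef_nonneg hU hd i)
      _ = lev (wgram a 1) (a i) ^ (p / 2) * (x ⬝ᵥ wgram a 1 *ᵥ x) := by
          rw [← mul_assoc, lcoef, ← Real.rpow_add_one hpos.ne']; congr 2; ring
      _ ≤ _ := mul_le_of_le_one_left (quad_nonneg hU x)
          (Real.rpow_le_one hpos.le h1 (by linarith))

/-- From `U ≼ V ≼ κ U` the leverages decrease by a factor between `1` and `κ`, so the coefficients
increase by a factor between `1` and `κ^(1-p/2) ≤ √κ`. -/
theorem IsLewisIterate.next {κ : ℝ} (h : IsLewisIterate p a κ U) (hp : 1 ≤ p) (hp2 : p ≤ 2)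
    (hκ : 1 ≤ κ) : IsLewisIterate p a (√κ) (wgram a (lcoef p U a)) := by
  set V := wgram a (lcoef p U a)
  have hV : V.PosSemidef := wgram_posSemidef _ (lcoef_nonneg h.posSemidef h.dominated)
  have hd : ∀ i, Dominated V (a i) := dominated_wgram (lcoef_nonneg h.posSemidef h.dominated)
    (lcoef_pos h.posSemidef h.dominated)
  refine ⟨hV, hd, fun x => ?_, fun x => ?_⟩
  · have := wgram_le (lcoef_le (p := p) (V := U) (U := V) (r := 1) hp2 one_pos hV hd fun i =>
      lev_le_mul h.posSemidef hV (h.dominated i) zero_le_one (by simpa using h.lower)) x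
    simpa using this
  · refine (wgram_le (lcoef_le (p := p) (V := V) (U := U) (r := κ) hp2 (by linarith) h.posSemidef
      h.dominated fun i => lev_le_mul hV h.posSemidef (hd i) (by linarith) h.upper) x).trans ?_
    refine mul_le_mul_of_nonneg_right ?_ (quad_nonneg hV x)
    rw [Real.sqrt_eq_rpow]
    exact Real.rpow_le_rpow_of_exponent_le hκ (by linarith)

/-- Two instances of `lev_rpow_le`, with the exact fixed point in either role. -/
theorem IsLewisIterate.bounds {κ : ℝ} (h : IsLewisIterate p a κ U) (hV : IsLewisForm p a V)
    (hp : 1 ≤ p) (hp2 : p ≤ 2) (hκ : 0 < κ) (i : m) :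
    lev V (a i) ^ (p / 2) ≤ lev U (a i) ^ (p / 2) ∧
      lev U (a i) ^ (p / 2) ≤ κ * lev V (a i) ^ (p / 2) := by
  constructor
  · simpa using lev_rpow_le hp hp2 hV.posSemidef h.posSemidef hV.dominated h.dominated one_pos
      one_pos (by simpa using h.lower) (fun x => by rw [← hV.eq, one_mul]) i
  · simpa using lev_rpow_le hp hp2 h.posSemidef hV.posSemidef h.dominated hV.dominated one_pos
      hκ (fun x => by rw [← hV.eq, one_mul]) h.upper i

end Lewis

/-! ### Normalization by a fixed Lewis form -/

section Normalized

open Matrix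

set_option linter.unusedSectionVars false

variable {d : ℕ} {p : ℝ} {U : Matrix (Fin d) (Fin d) ℝ} {s : Finset (Fin d)}
  {B : Matrix s (Fin d) ℝ}

/-- The contribution `(uᵀ U† u)^{p/2-1} (B u) (B u)ᵀ` of the row `u` to the Lewis form, after
normalization. -/
def yrow (p : ℝ) (U : Matrix (Fin d) (Fin d) ℝ) (B : Matrix s (Fin d) ℝ) (u : Fin d → ℝ) :
    Matrix s s ℝ := (lev U u ^ (p / 2 - 1)) • vecMulVec (B *ᵥ u) (B *ᵥ u)

/-- The sum of the contributions of a list of rows. -/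
def ysum (p : ℝ) (U : Matrix (Fin d) (Fin d) ℝ) (B : Matrix s (Fin d) ℝ) (X : Rows d) :
    Matrix s s ℝ := (X.map (yrow p U B)).sum

@[simp] theorem ysum_nil : ysum p U B [] = 0 := rfl

@[simp] theorem ysum_cons (u : Fin d → ℝ) (X : Rows d) :
    ysum p U B (u :: X) = yrow p U B u + ysum p U B X := by simp [ysum]

@[simp] theorem ysum_append (X Y : Rows d) :
    ysum p U B (X ++ Y) = ysum p U B X + ysum p U B Y := by simp [ysum]

theorem yrow_transpose (u : Fin d → ℝ) : (yrow p U B u)ᵀ = yrow p U B u := by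
  rw [yrow, transpose_smul, transpose_vecMulVec]

theorem ysum_transpose (X : Rows d) : (ysum p U B X)ᵀ = ysum p U B X := by
  induction X with
  | nil => simp
  | cons u X ih => rw [ysum_cons, transpose_add, ih, yrow_transpose]

/-- The contribution has degree `2(p/2 - 1) + 2 = p` in the row. So a row that is kept with
probability `q` and rescaled by `q^(-1/p)` has the right expected contribution. -/
theorem yrow_smul (hp : 1 ≤ p) {q : ℝ} (hq : 0 < q) {u : Fin d → ℝ} (hl : 0 ≤ lev U u) :
    yrow p U B ((q ^ (-(1 / p))) • u) = q⁻¹ • yrow p U B u := by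
  rw [yrow, yrow, lev_smul, mulVec_smul, smul_vecMulVec, vecMulVec_smul, smul_smul, smul_smul,
    smul_smul, Real.mul_rpow (by positivity) hl]
  congr 1
  rw [← Real.rpow_natCast, ← Real.rpow_mul hq.le, ← Real.rpow_mul hq.le]
  have : q ^ (-(1 / p) * ((2 : ℕ) : ℝ) * (p / 2 - 1)) * (q ^ (-(1 / p)) * q ^ (-(1 / p))) = q⁻¹ := by
    rw [← Real.rpow_add hq, ← Real.rpow_add hq, ← Real.rpow_neg_one]
    congr 1
    push_cast
    field_simp
    ring
  rw [← this]; ring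

theorem yrow_quad (u : Fin d → ℝ) (y : s → ℝ) :
    y ⬝ᵥ yrow p U B u *ᵥ y = lev U u ^ (p / 2 - 1) * ((B *ᵥ u) ⬝ᵥ y) ^ 2 := by
  rw [yrow, smul_mulVec, vecMulVec_mulVec, dotProduct_smul, smul_eq_mul]
  rw [op_smul_eq_smul, dotProduct_smul, smul_eq_mul, dotProduct_comm y]
  ring

theorem ysum_toMatrix (X : Rows d) : ysum p U B X = ∑ i, yrow p U B (X.toMatrix i) := by
  rw [ysum, ← List.sum_ofFn]
  congr 1
  conv_lhs => rw [← List.ofFn_get X, List.map_ofFn]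
  rfl

/-- `B` normalizes the form `U`. -/
structure Normalizes (U : Matrix (Fin d) (Fin d) ℝ) (B : Matrix s (Fin d) ℝ) : Prop where
  posSemidef : U.PosSemidef
  eq_one : B * U * Bᵀ = 1
  eq_self : U * Bᵀ * B * U = U

/-- In normalized coordinates a row `u` becomes `B u`, and a test vector `x` becomes `B U x`; the
pairing is preserved. -/
theorem Normalizes.dotProduct (h : Normalizes U B) {u : Fin d → ℝ} (hu : Dominated U u)
    (x : Fin d → ℝ) : (B *ᵥ u) ⬝ᵥ (B *ᵥ U *ᵥ x) = u ⬝ᵥ x := by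
  obtain ⟨z, hz, -⟩ := exists_mulVec_eq h.posSemidef hu
  have e : Uᵀ = U := PosSemidef.transpose_eq h.posSemidef
  have e1 : ∀ (M N : Matrix s (Fin d) ℝ), (M *ᵥ z) ⬝ᵥ (N *ᵥ x) = z ⬝ᵥ (Mᵀ * N) *ᵥ x := fun M N => by
    rw [← mulVec_mulVec, dotProduct_mulVec z, vecMul_transpose]
  rw [hz, mulVec_mulVec, mulVec_mulVec, e1, transpose_mul, e, ← Matrix.mul_assoc, h.eq_self,
    dotProduct_mulVec_comm h.posSemidef, dotProduct_comm]

theorem toMatrix_dominated {X : Rows d} (hX : ∀ u ∈ X, Dominated U u) (i : Fin X.length) :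
    Dominated U (X.toMatrix i) := hX _ (List.get_mem X i)

/-- Together with `norm_sq`, comparing the Lewis map of the rows `X` at `U` with `U` becomes
comparing `ysum` with the identity. -/
theorem Normalizes.wgram_quad (h : Normalizes U B) {X : Rows d} (hX : ∀ u ∈ X, Dominated U u)
    (x : Fin d → ℝ) :
    x ⬝ᵥ wgram (fun i => X.toMatrix i) (lcoef p U fun i => X.toMatrix i) *ᵥ x =
      (B *ᵥ U *ᵥ x) ⬝ᵥ ysum p U B X *ᵥ (B *ᵥ U *ᵥ x) := by
  rw [OnlineLewis.wgram_quad, ysum_toMatrix, sum_mulVec, dotProduct_sum]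
  refine Finset.sum_congr rfl fun i _ => ?_
  rw [yrow_quad, h.dotProduct (toMatrix_dominated hX i)]
  rfl

theorem Normalizes.norm_sq (h : Normalizes U B) (x : Fin d → ℝ) :
    (B *ᵥ U *ᵥ x) ⬝ᵥ (B *ᵥ U *ᵥ x) = x ⬝ᵥ U *ᵥ x := by
  rw [h.dotProduct, dotProduct_comm]
  exact ⟨x ⬝ᵥ U *ᵥ x, quad_nonneg h.posSemidef x, fun y => by
    rw [dotProduct_comm, dotProduct_mulVec_comm h.posSemidef]
    exact sq_dotProduct_mulVec_le h.posSemidef x y⟩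

/-- If the normalized sum is at most `κ`, then the candidate weights are at most `κ` times the Lewis
weights. -/
theorem Normalizes.le_lewisWeight (h : Normalizes U B) (hp : 1 ≤ p) (hp2 : p ≤ 2) {X : Rows d}
    (hX : ∀ u ∈ X, Dominated U u) {κ : ℝ} (hκ : 0 < κ)
    (hy : ∀ y, y ⬝ᵥ ysum p U B X *ᵥ y ≤ κ * (y ⬝ᵥ y)) (i : Fin X.length) :
    lev U (X.toMatrix i) ^ (p / 2) ≤ κ * lewisWeight p X.toMatrix i := by
  obtain ⟨V, hV, hw⟩ := exists_lewisForm hp hp2 X.toMatrix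
  have := lev_rpow_le hp hp2 h.posSemidef hV.posSemidef (toMatrix_dominated hX) hV.dominated
    one_pos hκ (fun x => by rw [← hV.eq, one_mul])
    (fun x => by rw [h.wgram_quad hX, ← h.norm_sq]; exact hy _) i
  rw [hw]
  simpa using this

/-- If the normalized sum is at least `κ`, then the candidate weights are at least `κ` times the
Lewis weights. -/
theorem Normalizes.lewisWeight_le (h : Normalizes U B) (hp : 1 ≤ p) (hp2 : p ≤ 2) {X : Rows d}
    (hX : ∀ u ∈ X, Dominated U u) {κ : ℝ} (hκ : 0 < κ)
    (hy : ∀ y, κ * (y ⬝ᵥ y) ≤ y ⬝ᵥ ysum p U B X *ᵥ y) (i : Fin X.length) :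
    κ * lewisWeight p X.toMatrix i ≤ lev U (X.toMatrix i) ^ (p / 2) := by
  obtain ⟨V, hV, hw⟩ := exists_lewisForm hp hp2 X.toMatrix
  have := lev_rpow_le hp hp2 hV.posSemidef h.posSemidef hV.dominated (toMatrix_dominated hX)
    (inv_pos.2 hκ) one_pos (fun x => by
      rw [h.wgram_quad hX, ← h.norm_sq, ← div_eq_inv_mul, le_div_iff₀ hκ, mul_comm]; exact hy _)
    (fun x => by rw [← hV.eq, one_mul]) i
  rw [mul_one] at this
  have h2 := mul_le_mul_of_nonneg_left this hκ.le
  rwa [← mul_assoc, mul_inv_cancel₀ hκ.ne', one_mul, ← hw] at h2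

/-- The normalized form of the Lewis form itself is the identity. -/
theorem Normalizes.sum_yrow_eq_one (h : Normalizes U B) {m : Type*} [Fintype m]
    {a : m → Fin d → ℝ} (hU : IsLewisForm p a U) : ∑ i, yrow p U B (a i) = 1 := by
  rw [← h.eq_one]
  conv_rhs => rw [hU.eq]
  rw [wgram, Matrix.mul_sum, Matrix.sum_mul]
  refine Finset.sum_congr rfl fun i _ => ?_
  rw [Matrix.mul_smul, Matrix.smul_mul, mul_vecMulVec, vecMulVec_mul, vecMul_transpose]
  rfl

end Normalized

/-! ### Expectations -/

section Expect

variable {α β : Type*}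

/-- The expectation of a nonnegative function. -/
def expect (μ : PMF α) (f : α → ℝ≥0∞) : ℝ≥0∞ := ∑' a, μ a * f a

theorem expect_pure (a : α) (f : α → ℝ≥0∞) : expect (PMF.pure a) f = f a := by
  rw [expect, tsum_eq_single a]
  · simp
  · intro b hb; simp [PMF.pure_apply, hb]

theorem expect_bind (μ : PMF α) (g : α → PMF β) (f : β → ℝ≥0∞) :
    expect (μ.bind g) f = expect μ fun a => expect (g a) f := by
  simp only [expect, PMF.bind_apply, ← ENNReal.tsum_mul_right, ← ENNReal.tsum_mul_left]
  rw [ENNReal.tsum_comm]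
  simp only [mul_assoc]

theorem expect_mono {μ : PMF α} {f g : α → ℝ≥0∞} (h : ∀ a ∈ μ.support, f a ≤ g a) :
    expect μ f ≤ expect μ g := by
  refine ENNReal.tsum_le_tsum fun a => ?_
  by_cases ha : μ a = 0
  · simp [ha]
  · gcongr; exact h a ((μ.mem_support_iff a).2 ha)

theorem expect_const (μ : PMF α) (c : ℝ≥0∞) : expect μ (fun _ => c) = c := by
  rw [expect, ENNReal.tsum_mul_right, PMF.tsum_coe, one_mul]

theorem expect_const_mul (μ : PMF α) (c : ℝ≥0∞) (f : α → ℝ≥0∞) :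
    expect μ (fun a => c * f a) = c * expect μ f := by
  rw [expect, expect, ← ENNReal.tsum_mul_left]
  exact tsum_congr fun a => by ring

theorem expect_add (μ : PMF α) (f g : α → ℝ≥0∞) :
    expect μ (fun a => f a + g a) = expect μ f + expect μ g := by
  simp only [expect, mul_add, ENNReal.tsum_add]

theorem toOuterMeasure_bind_eq_expect (μ : PMF α) (g : α → PMF β) (S : Set β) :
    (μ.bind g).toOuterMeasure S = expect μ fun a => (g a).toOuterMeasure S :=
  PMF.toOuterMeasure_bind_apply ..

theorem toOuterMeasure_le_one (μ : PMF α) (S : Set α) : μ.toOuterMeasure S ≤ 1 := by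
  rw [PMF.toOuterMeasure_apply, ← μ.tsum_coe]
  exact ENNReal.tsum_le_tsum fun a => Set.indicator_le_self _ _ _

theorem toOuterMeasure_le_expect (μ : PMF α) {S : Set α} {f : α → ℝ≥0∞} (h : ∀ a ∈ S, 1 ≤ f a) :
    μ.toOuterMeasure S ≤ expect μ f := by
  rw [PMF.toOuterMeasure_apply]
  refine ENNReal.tsum_le_tsum fun a => ?_
  by_cases ha : a ∈ S
  · rw [Set.indicator_of_mem ha]; exact le_mul_of_one_le_right' (h a ha)
  · rw [Set.indicator_of_notMem ha]; exact zero_le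

theorem one_sub_le_toOuterMeasure (μ : PMF α) {S T : Set α} (h : ∀ a ∈ μ.support, a ∉ T → a ∈ S) :
    1 - μ.toOuterMeasure T ≤ μ.toOuterMeasure S := by
  rw [tsub_le_iff_right, ← μ.tsum_coe, PMF.toOuterMeasure_apply, PMF.toOuterMeasure_apply,
    ← ENNReal.tsum_add]
  refine ENNReal.tsum_le_tsum fun a => ?_
  by_cases ha : a ∈ T
  · rw [Set.indicator_of_mem ha]; exact le_add_self
  by_cases h0 : a ∈ μ.support
  · rw [Set.indicator_of_mem (h a h0 ha)]; exact le_self_add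
  · rw [(μ.apply_eq_zero_iff a).2 h0]; exact zero_le

theorem expect_coin (q : ℝ≥0) (hq : q ≤ 1) (f : Bool → ℝ≥0∞) :
    expect (coin q hq) f = q * f true + (1 - q) * f false := by
  rw [expect, tsum_bool, add_comm]
  simp [coin]

end Expect

/-! ### Sampling -/

section Sampling

open Matrix NormedSpace

set_option linter.unusedSectionVars false

variable {d : ℕ} {p : ℝ} {U : Matrix (Fin d) (Fin d) ℝ} {s : Finset (Fin d)}
  {B : Matrix s (Fin d) ℝ}

theorem expect_sampleRows_cons (q : ℝ≥0) (a : Fin d → ℝ) (l : List (ℝ≥0 × (Fin d → ℝ)))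
    (f : Rows d → ℝ≥0∞) :
    expect (sampleRows p ((q, a) :: l)) f =
      (min q 1 : ℝ≥0) * expect (sampleRows p l)
        (fun X => f (((((min q 1 : ℝ≥0) : ℝ) ^ (-(1 / p))) • a) :: X)) +
      (1 - (min q 1 : ℝ≥0)) * expect (sampleRows p l) f := by
  simp only [sampleRows, expect_bind, expect_coin, expect_pure, if_true]
  simp

/-- The two-point condition under which the potential does not increase in expectation. -/
def TwoPoint (α α' r x : ℝ) : Prop :=
  r * Real.exp ((α / r - α') * x) + (1 - r) * Real.exp (-α' * x) ≤ 1

/-- The coins are handled one at a time: sampled rows carry `α`, rows still to be sampled carry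
`α'`, and `D` absorbs the rows already decided, which is why the induction is over all `D`. -/
theorem expect_trace_exp_sampleRows_le (hp : 1 ≤ p) (hB : Normalizes U B) {α α' : ℝ}
    (l : List (ℝ≥0 × (Fin d → ℝ))) (hl : ∀ z ∈ l, Dominated U z.2 ∧ (min z.1 1 = 0 → z.2 = 0) ∧
      TwoPoint α α' (min z.1 1 : ℝ≥0) (lev U z.2 ^ (p / 2)))
    {D : Matrix s s ℝ} (hD : Dᵀ = D) :
    expect (sampleRows p l) (fun X => ENNReal.ofReal (trace (exp (D + α • ysum p U B X)))) ≤
      ENNReal.ofReal (trace (exp (D + α' • ysum p U B (l.map Prod.snd)))) := by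
  induction l generalizing D with
  | nil => simp [sampleRows, expect_pure]
  | cons z l ih =>
    obtain ⟨q, a⟩ := z
    obtain ⟨hdom, h0, h2⟩ := hl (q, a) (by simp)
    replace ih := fun {D : Matrix s s ℝ} => ih (fun z hz => hl z (by simp [hz])) (D := D)
    rw [expect_sampleRows_cons]
    simp only at hdom h0 h2
    set r : ℝ≥0 := min q 1 with hr
    have hr1 : r ≤ 1 := min_le_right _ _
    have hr1' : (r : ℝ) ≤ 1 := by exact_mod_cast hr1
    set x := lev U a
    have hx : 0 ≤ x := lev_nonneg hB.posSemidef hdom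
    set v := B *ᵥ a
    have hvv : v ⬝ᵥ v = x := dotProduct_normalizer hB.posSemidef hB.eq_self hdom
    -- Relative to `D'`, keeping the head row shifts the exponent by `α/r - α'` times its
    -- contribution, and deleting it shifts by `-α'` times. Since `x^(p/2-1) |v|² = x^(p/2)`,
    -- `TwoPoint` is exactly what `convexComb_trace_exp_le` asks for.
    set D' := D + α' • ysum p U B (((q, a) :: l).map Prod.snd) with hD'
    have hD't : D'ᵀ = D' := by rw [hD', transpose_add, transpose_smul, hD, ysum_transpose]
    have hyr : yrow p U B a = (x ^ (p / 2 - 1)) • vecMulVec v v := rfl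
    have hxx : x ^ (p / 2 - 1) * x = x ^ (p / 2) := by
      rcases hx.eq_or_lt with h | h
      · rw [← h, mul_zero, Real.zero_rpow (by linarith)]
      · rw [← Real.rpow_add_one h.ne']; congr 1; ring
    have key := convexComb_trace_exp_le hD't v (r := r) (r' := 1 - r)
      (z := (α / r - α') * x ^ (p / 2 - 1)) (z' := -α' * x ^ (p / 2 - 1)) r.coe_nonneg (by linarith) (by ring)
      (by rw [hvv, mul_assoc, mul_assoc, hxx]; exact h2)
    have e1 : (r : ℝ≥0∞) * expect (sampleRows p l) (fun X => ENNReal.ofReal (trace (exp (D + α •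
        ysum p U B ((((r : ℝ) ^ (-(1 / p))) • a) :: X))))) ≤ ENNReal.ofReal (r *
          trace (exp (D' + ((α / r - α') * x ^ (p / 2 - 1)) • vecMulVec v v))) := by
      by_cases hr0 : r = 0
      · simp [hr0]
      have hrp : 0 < (r : ℝ) := by exact_mod_cast pos_iff_ne_zero.2 hr0
      rw [ENNReal.ofReal_mul r.coe_nonneg, ENNReal.ofReal_coe_nnreal]
      gcongr
      have := ih (D := D + α • (r : ℝ)⁻¹ • yrow p U B a) (by
        rw [transpose_add, transpose_smul, transpose_smul, hD, yrow_transpose])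
      refine (le_of_eq ?_).trans (this.trans (le_of_eq ?_))
      · congr 1; ext X; rw [ysum_cons, yrow_smul hp hrp hx, smul_add, add_assoc]
      · congr 3
        rw [hD', List.map_cons, ysum_cons, hyr]
        simp only [smul_add, smul_smul]
        rw [sub_mul, sub_smul, div_eq_mul_inv α, ← mul_assoc]
        abel
    have e2 : (1 - r : ℝ≥0∞) * expect (sampleRows p l) (fun X => ENNReal.ofReal (trace (exp (D + α •
        ysum p U B X)))) ≤ ENNReal.ofReal ((1 - r) *
          trace (exp (D' + (-α' * x ^ (p / 2 - 1)) • vecMulVec v v))) := by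
      rw [ENNReal.ofReal_mul (by linarith), ENNReal.ofReal_sub _ r.coe_nonneg, ENNReal.ofReal_one,
        ENNReal.ofReal_coe_nnreal]
      gcongr
      refine (ih hD).trans (le_of_eq ?_)
      congr 3
      rw [hD', List.map_cons, ysum_cons, hyr]
      simp only [smul_add, smul_smul, neg_mul, neg_smul]
      abel
    refine (add_le_add e1 e2).trans ?_
    rw [← ENNReal.ofReal_add]
    · exact ENNReal.ofReal_le_ofReal key
    · exact mul_nonneg r.coe_nonneg (trace_exp_nonneg (by
        rw [transpose_add, transpose_smul, transpose_vecMulVec, hD't]))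
    · exact mul_nonneg (by linarith) (trace_exp_nonneg (by
        rw [transpose_add, transpose_smul, transpose_vecMulVec, hD't]))

/-- Each coin contributes `1 + r (e - 1) ≤ 1 + 2 q ≤ exp (2 q)`. -/
theorem expect_exp_length_sampleRows_le (l : List (ℝ≥0 × (Fin d → ℝ))) :
    expect (sampleRows p l) (fun X => ENNReal.ofReal (Real.exp X.length)) ≤
      ENNReal.ofReal (Real.exp (2 * (l.map fun z => (z.1 : ℝ)).sum)) := by
  induction l with
  | nil => simp [sampleRows, expect_pure]
  | cons z l ih =>
    obtain ⟨q, a⟩ := z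
    rw [expect_sampleRows_cons]
    set r : ℝ≥0 := min q 1 with hr
    have hr1 : (r : ℝ) ≤ 1 := by exact_mod_cast min_le_right q 1
    have hrq : (r : ℝ) ≤ q := by exact_mod_cast min_le_left q 1
    set E := expect (sampleRows p l) (fun X => ENNReal.ofReal (Real.exp X.length))
    have e1 : expect (sampleRows p l) (fun X => ENNReal.ofReal (Real.exp
        ((((r : ℝ) ^ (-(1 / p))) • a) :: X).length)) = ENNReal.ofReal (Real.exp 1) * E := by
      rw [← expect_const_mul]
      congr 1; ext X
      rw [← ENNReal.ofReal_mul (Real.exp_pos _).le, ← Real.exp_add, List.length_cons]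
      push_cast; rw [add_comm]
    have e2 : ENNReal.ofReal (r * Real.exp 1 + (1 - r)) ≤ ENNReal.ofReal (Real.exp (2 * q)) := by
      apply ENNReal.ofReal_le_ofReal
      have h1 := Real.exp_one_lt_d9
      have h2 := Real.add_one_le_exp (2 * (q : ℝ))
      nlinarith [r.coe_nonneg]
    rw [e1]
    calc (r : ℝ≥0∞) * (ENNReal.ofReal (Real.exp 1) * E) + (1 - r) * E
        = ENNReal.ofReal (r * Real.exp 1 + (1 - r)) * E := by
          rw [ENNReal.ofReal_add (by positivity) (by linarith), ENNReal.ofReal_mul r.coe_nonneg,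
            ENNReal.ofReal_sub _ r.coe_nonneg, ENNReal.ofReal_one, ENNReal.ofReal_coe_nnreal]
          ring
      _ ≤ ENNReal.ofReal (Real.exp (2 * q)) * ENNReal.ofReal _ := mul_le_mul' e2 ih
      _ = _ := by
          rw [← ENNReal.ofReal_mul (Real.exp_pos _).le, ← Real.exp_add, List.map_cons, List.sum_cons,
            mul_add]

theorem length_le_of_mem_support_sampleRows (l : List (ℝ≥0 × (Fin d → ℝ))) {X : Rows d}
    (hX : X ∈ (sampleRows p l).support) : X.length ≤ l.length := by
  induction l generalizing X with
  | nil => simp [sampleRows] at hX; simp [hX]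
  | cons z l ih =>
    obtain ⟨q, a⟩ := z
    simp only [sampleRows, PMF.mem_support_bind_iff] at hX
    obtain ⟨b, -, Y, hY, hX⟩ := hX
    rw [PMF.mem_support_pure_iff] at hX
    have := ih hY
    subst hX
    split_ifs <;> simp <;> omega

theorem dominated_of_mem_support_sampleRows (l : List (ℝ≥0 × (Fin d → ℝ)))
    (hl : ∀ z ∈ l, Dominated U z.2) {X : Rows d}
    (hX : X ∈ (sampleRows p l).support) : ∀ u ∈ X, Dominated U u := by
  induction l generalizing X with
  | nil => simp [sampleRows] at hX; simp [hX]
  | cons z l ih =>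
    obtain ⟨q, a⟩ := z
    simp only [sampleRows, PMF.mem_support_bind_iff] at hX
    obtain ⟨b, -, Y, hY, hX⟩ := hX
    rw [PMF.mem_support_pure_iff] at hX
    have h1 := ih (fun z hz => hl z (by simp [hz])) hY
    have h2 : Dominated U a := hl (q, a) (by simp)
    subst hX
    split_ifs
    · intro u hu
      rcases List.mem_cons.1 hu with rfl | hu
      · exact h2.smul _
      · exact h1 u hu
    · exact h1

/-- A sure row needs only `α ≤ α'`. Otherwise the jump `y = α x / r` is at most `e/2`, and `exp y ≤
1 + y + y²` raises the mean `α x` by at most the factor `1 + e`, which `α'` has in reserve. -/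
theorem twoPoint_upper {α α' r x e : ℝ} (hr0 : 0 ≤ r) (hr1 : r ≤ 1) (hx : 0 ≤ x) (he0 : 0 ≤ e) (he : e ≤ 1)
    (hα : 0 ≤ α) (hαα : (1 + e) * α ≤ α') (h : r = 1 ∨ α * x ≤ e / 2 * r) (hr : r = 0 → x = 0) :
    TwoPoint α α' r x := by
  rw [TwoPoint]
  rcases hr0.eq_or_lt with h0 | h0
  · rw [hr h0.symm, ← h0]; simp
  set y := α * x / r with hy
  have hy0 : 0 ≤ y := by positivity
  have e1 : (α / r - α') * x = y + -α' * x := by rw [hy]; ring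
  have e2 : r * y = α * x := by rw [hy]; field_simp
  rw [e1, Real.exp_add, ← mul_assoc, ← add_mul]
  rcases h with h | h
  · subst h
    have hαx : α * x ≤ α' * x := by
      exact mul_le_mul_of_nonneg_right (by nlinarith) hx
    simp only [one_mul, sub_self, add_zero]
    rw [← Real.exp_add, Real.exp_le_one_iff]
    linarith
  · have hye : y ≤ e / 2 := by rw [hy, div_le_iff₀ h0]; exact h
    have h1 := Real.abs_exp_sub_one_sub_id_le (x := y) (by rw [abs_of_nonneg hy0]; linarith)
    have h2 := (abs_le.1 h1).2
    have h3 : r * Real.exp y + (1 - r) ≤ Real.exp (α' * x) := by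
      refine le_trans ?_ (Real.add_one_le_exp _)
      have : r * Real.exp y ≤ r * (1 + y + y ^ 2) := mul_le_mul_of_nonneg_left (by linarith) hr0
      have h4 : r * y ^ 2 ≤ α * x * e := by
        rw [sq, ← mul_assoc, e2]
        exact mul_le_mul_of_nonneg_left (by linarith) (by positivity)
      nlinarith [mul_le_mul_of_nonneg_right hαα hx]
    calc _ ≤ Real.exp (α' * x) * Real.exp (-α' * x) := by gcongr
      _ = 1 := by rw [← Real.exp_add]; simp

/-- As for the upper bound, with `exp (-y) ≤ 1 - y + y²`: the second-order term leaves `α x (1 -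
e/2)`, which still covers `α' x` because `(1 + e)(1 - e/2) ≥ 1`. -/
theorem twoPoint_lower {α α' r x e : ℝ} (hr0 : 0 ≤ r) (hr1 : r ≤ 1) (hx : 0 ≤ x) (he0 : 0 ≤ e)
    (he : e ≤ 1) (hα : 0 ≤ α') (hαα : (1 + e) * α' ≤ α) (h : r = 1 ∨ α * x ≤ e / 2 * r)
    (hr : r = 0 → x = 0) : TwoPoint (-α) (-α') r x := by
  rw [TwoPoint]
  rcases hr0.eq_or_lt with h0 | h0
  · rw [hr h0.symm, ← h0]; simp
  have hα0 : α' ≤ α := by nlinarith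
  set y := α * x / r with hy
  have hy0 : 0 ≤ y := div_nonneg (mul_nonneg (by linarith) hx) hr0
  have e1 : (-α / r - -α') * x = -y + - -α' * x := by rw [hy]; ring
  have e2 : r * y = α * x := by rw [hy]; field_simp
  rw [e1, Real.exp_add, ← mul_assoc, ← add_mul, neg_neg]
  rcases h with h | h
  · subst h
    simp only [one_mul, sub_self, add_zero]
    rw [← Real.exp_add, Real.exp_le_one_iff]
    nlinarith
  · have hye : y ≤ e / 2 := by rw [hy, div_le_iff₀ h0]; exact h
    have h1 := Real.abs_exp_sub_one_sub_id_le (x := -y) (by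
      rw [abs_neg, abs_of_nonneg hy0]; linarith)
    have h2 := (abs_le.1 h1).2
    have h3 : r * Real.exp (-y) + (1 - r) ≤ Real.exp (-(α' * x)) := by
      refine le_trans ?_ (Real.add_one_le_exp _)
      have : r * Real.exp (-y) ≤ r * (1 - y + y ^ 2) := mul_le_mul_of_nonneg_left (by linarith) hr0
      have h4 : r * y ^ 2 ≤ α * x * (e / 2) := by
        rw [sq, ← mul_assoc, e2]
        exact mul_le_mul_of_nonneg_left hye (mul_nonneg (by linarith) hx)
      have h5 : α' * x ≤ α * x * (1 - e / 2) := by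
        have h6 := mul_le_mul_of_nonneg_right hαα (show 0 ≤ x * (1 - e / 2) from
          mul_nonneg hx (by linarith))
        have h7 : α' * x ≤ (1 + e) * α' * (x * (1 - e / 2)) := by
          have : 0 ≤ α' * x := mul_nonneg hα hx
          nlinarith [mul_nonneg this (mul_nonneg he0 (sub_nonneg.2 he))]
        linarith
      nlinarith
    calc _ ≤ Real.exp (-(α' * x)) * Real.exp (α' * x) := by gcongr
      _ = 1 := by rw [← Real.exp_add]; simp

end Sampling

/-! ### The blocks -/

section BlocksInvariant

variable {d : ℕ} {p β : ℝ}

/-- The structural invariant of the blocks after `s` rows: blocks of index above `J` are empty, a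
nonempty block of index `i ≥ 1` accounts for `2 ^ i` rows, and the number of rows never grows. -/
structure BlocksInv (J s : ℕ) (B : Blocks d) : Prop where
  empty : ∀ i, J < i → B i = []
  load : (B 0).length + ∑ i ∈ Finset.Icc 1 J, (if B i = [] then 0 else 2 ^ i) ≤ s
  length : (B.concat (J + 1)).length ≤ s

theorem blocksInv_nil (J : ℕ) : BlocksInv J 0 (fun _ => [] : Blocks d) := by
  refine ⟨fun _ _ => rfl, by simp, ?_⟩
  have : ∀ k, Blocks.concat (fun _ => [] : Blocks d) k = [] := fun k => by
    induction k with
    | zero => rfl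
    | succ k ih => simp [Blocks.concat, ih]
  simp [this]

theorem Blocks.push_zero (B : Blocks d) (a : Fin d → ℝ) : B.push a 0 = B 0 ++ [a] := by
  simp [Blocks.push]

theorem Blocks.push_of_ne (B : Blocks d) (a : Fin d → ℝ) {i : ℕ} (hi : i ≠ 0) :
    B.push a i = B i := by
  simp [Blocks.push, hi]

theorem Blocks.concat_push (B : Blocks d) (a : Fin d → ℝ) (k : ℕ) :
    (B.push a).concat (k + 1) = B.concat (k + 1) ++ [a] := by
  induction k with
  | zero => simp [Blocks.concat, Blocks.push_zero]
  | succ k ih => rw [Blocks.concat, ih, Blocks.push_of_ne _ _ (by omega), Blocks.concat.eq_2 B (k + 1),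
      List.append_assoc]

theorem BlocksInv.push {J s : ℕ} {B : Blocks d} (h : BlocksInv J s B) (a : Fin d → ℝ) :
    BlocksInv J (s + 1) (B.push a) := by
  refine ⟨fun i hi => ?_, ?_, ?_⟩
  · rw [Blocks.push_of_ne _ _ (by omega)]; exact h.empty i hi
  · have e : ∑ i ∈ Finset.Icc 1 J, (if B.push a i = [] then 0 else 2 ^ i) =
        ∑ i ∈ Finset.Icc 1 J, (if B i = [] then 0 else 2 ^ i) :=
      Finset.sum_congr rfl fun i hi => by
        rw [Blocks.push_of_ne _ _ (by have := (Finset.mem_Icc.1 hi).1; omega)]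
    rw [e, Blocks.push_zero, List.length_append]
    have := h.load
    simp only [List.length_singleton]
    omega
  · rw [Blocks.concat_push, List.length_append, List.length_singleton]
    have := h.length
    omega

/-- The blocks after the compression with result `X`. -/
def Blocks.merge (B : Blocks d) (X : Rows d) : Blocks d := fun j =>
  if j < B.firstEmpty then [] else if j = B.firstEmpty then X else B j

theorem Blocks.firstEmpty_spec {B : Blocks d} {J : ℕ} (h : ∀ i, J < i → B i = []) :
    B B.firstEmpty = [] ∧ ∀ j < B.firstEmpty, B j ≠ [] :=
  ⟨Nat.sInf_mem (s := {i | B i = []}) ⟨J + 1, h _ (by omega)⟩, fun _ hj => Nat.notMem_of_lt_sInf hj⟩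

/-- If the blocks `1, …, J` were all nonempty, they would account for `2^(J+1) - 2` rows; with two
more rows in block `0` this exceeds `s`. -/
theorem BlocksInv.firstEmpty_le {J s : ℕ} {B : Blocks d} (h : BlocksInv J s B)
    (h2 : 2 ≤ (B 0).length) (hs : s < 2 ^ (J + 1)) : 1 ≤ B.firstEmpty ∧ B.firstEmpty ≤ J := by
  obtain ⟨h3, h4⟩ := Blocks.firstEmpty_spec h.empty
  have h1 : 1 ≤ B.firstEmpty := by
    rw [Nat.one_le_iff_ne_zero]
    intro h0
    rw [h0] at h3
    simp [h3] at h2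
  refine ⟨h1, ?_⟩
  by_contra hc
  push Not at hc
  have h5 : ∑ i ∈ Finset.Icc 1 J, (if B i = [] then 0 else 2 ^ i) = ∑ i ∈ Finset.Icc 1 J, 2 ^ i :=
    Finset.sum_congr rfl fun i hi => by
      rw [if_neg (h4 i (by have := (Finset.mem_Icc.1 hi).2; omega))]
  have h6 : ∀ J : ℕ, ∑ i ∈ Finset.Icc 1 J, 2 ^ i + 2 = 2 ^ (J + 1) := fun J => by
    induction J with
    | zero => simp
    | succ J ih => rw [Finset.sum_Icc_succ_top (by omega), pow_succ 2 (J + 1)]; omega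
  have := h.load
  have := h6 J
  omega

theorem concat_merge_length (B : Blocks d) (X : Rows d)
    (hX : X.length ≤ (B.concat B.firstEmpty).length) (hB : B B.firstEmpty = []) (k : ℕ) :
    ((B.merge X).concat (B.firstEmpty + 1 + k)).length ≤
      (B.concat (B.firstEmpty + 1 + k)).length := by
  induction k with
  | zero =>
    have : ∀ j ≤ B.firstEmpty, (B.merge X).concat j = [] := fun j hj => by
      induction j with
      | zero => rfl
      | succ j ih => rw [Blocks.concat, ih (by omega), Blocks.merge, if_pos (by omega)]; rfl
    rw [Nat.add_zero, Blocks.concat, Blocks.concat, this _ le_rfl, Blocks.merge, hB]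
    simpa using hX
  | succ k ih =>
    rw [← Nat.add_assoc, Blocks.concat, Blocks.concat, List.length_append, List.length_append,
      Blocks.merge, if_neg (by omega), if_neg (by omega)]
    omega

/-- The carry of a binary counter: block `f` gains at most `2^f`, the blocks `1, …, f-1` release
`2^f - 2`, and block `0` releases at least `2`. -/
theorem BlocksInv.merge {J s : ℕ} {B : Blocks d} (h : BlocksInv J s B)
    (h2 : 2 ≤ (B 0).length) (hs : s < 2 ^ (J + 1)) {X : Rows d}
    (hX : X.length ≤ (B.concat B.firstEmpty).length) : BlocksInv J s (B.merge X) := by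
  obtain ⟨h1, hJ⟩ := h.firstEmpty_le h2 hs
  obtain ⟨h3, h4⟩ := Blocks.firstEmpty_spec h.empty
  have hm : ∀ j, B.merge X j = if j < B.firstEmpty then [] else if j = B.firstEmpty then X else B j :=
    fun j => rfl
  have hX' := concat_merge_length B X hX h3 (J - B.firstEmpty)
  generalize B.firstEmpty = f at *
  refine ⟨fun i hi => ?_, ?_, ?_⟩
  · rw [hm, if_neg (by omega), if_neg (by omega)]; exact h.empty i hi
  · have e0 : B.merge X 0 = [] := by rw [hm, if_pos (by omega)]
    rw [e0]
    refine le_trans ?_ h.load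
    have hsplit : ∀ g : ℕ → ℕ, ∑ i ∈ Finset.Icc 1 J, g i =
        ∑ i ∈ Finset.Icc 1 (f - 1), g i + (g f + ∑ i ∈ Finset.Icc (f + 1) J, g i) := fun g => by
      rw [← Finset.Ico_succ_right_eq_Icc, ← Finset.Ico_succ_right_eq_Icc,
        ← Finset.Ico_succ_right_eq_Icc]
      simp only [Nat.succ_eq_succ, Nat.succ_eq_add_one]
      rw [← Finset.sum_eq_sum_Ico_succ_bot (by omega), show f - 1 + 1 = f by omega,
        Finset.sum_Ico_consecutive _ (by omega) (by omega)]
    rw [hsplit, hsplit]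
    have s1 : ∑ i ∈ Finset.Icc 1 (f - 1), (if B.merge X i = [] then 0 else 2 ^ i) = 0 :=
      Finset.sum_eq_zero fun i hi => by
        simp [hm, show i < f by have := Finset.mem_Icc.1 hi; omega]
    have s2 : ∑ i ∈ Finset.Icc (f + 1) J, (if B.merge X i = [] then 0 else 2 ^ i) =
        ∑ i ∈ Finset.Icc (f + 1) J, (if B i = [] then 0 else 2 ^ i) :=
      Finset.sum_congr rfl fun i hi => by
        have := Finset.mem_Icc.1 hi
        have e : B.merge X i = B i := by rw [hm, if_neg (by omega), if_neg (by omega)]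
        rw [e]
    have s3 : ∑ i ∈ Finset.Icc 1 (f - 1), (if B i = [] then 0 else 2 ^ i) =
        ∑ i ∈ Finset.Icc 1 (f - 1), 2 ^ i :=
      Finset.sum_congr rfl fun i hi => by
        rw [if_neg (h4 i (by have := Finset.mem_Icc.1 hi; omega))]
    have s4 : ∀ J : ℕ, ∑ i ∈ Finset.Icc 1 J, 2 ^ i + 2 = 2 ^ (J + 1) := fun J => by
      induction J with
      | zero => simp
      | succ J ih => rw [Finset.sum_Icc_succ_top (by omega), pow_succ 2 (J + 1)]; omega
    have s5 := s4 (f - 1)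
    rw [show f - 1 + 1 = f by omega] at s5
    rw [s1, s2, s3]
    have s6 : (if B.merge X f = [] then 0 else 2 ^ f) ≤ 2 ^ f := by split_ifs <;> simp
    simp only [List.length_nil]
    omega
  · rw [show f + 1 + (J - f) = J + 1 by omega] at hX'
    exact hX'.trans h.length

theorem compress_eq (B : Blocks d) :
    B.compress p β = (lewisSample p β (B.concat B.firstEmpty)).bind fun X =>
      PMF.pure (B.merge X) := rfl

theorem length_le_of_mem_support_lewisSample {M X : Rows d}
    (hX : X ∈ (lewisSample p β M).support) : X.length ≤ M.length := by
  have := length_le_of_mem_support_sampleRows _ hX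
  simpa using this

theorem BlocksInv.compress {J s : ℕ} {B B' : Blocks d} (h : BlocksInv J s B)
    (h2 : 2 ≤ (B 0).length) (hs : s < 2 ^ (J + 1)) (hB' : B' ∈ (B.compress p β).support) :
    BlocksInv J s B' := by
  rw [compress_eq, PMF.mem_support_bind_iff] at hB'
  obtain ⟨X, hX, hB'⟩ := hB'
  rw [PMF.mem_support_pure_iff] at hB'
  subst hB'
  exact h.merge h2 hs (length_le_of_mem_support_lewisSample hX)

/-- The invariant at the beginning of a stage: the structure of the blocks, and the bound for the
length of the first block. -/
structure StageInv (J : ℕ) (Q : ℝ) (s : ℕ) (B : Blocks d) : Prop extends BlocksInv J s B where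
  zero_length : ((B 0).length : ℝ) ≤ max Q d

/-- What is known about a snapshot of the stage with row number `s`. -/
structure SnapshotInv (J : ℕ) (Q : ℝ) (s : ℕ) (a : Fin d → ℝ) (z : Snapshot d) : Prop where
  pre : BlocksInv J (s + 1) z.pre
  post : StageInv J Q (s + 1) z.post
  zero_length : ((z.pre 0).length : ℝ) ≤ max Q d + 1
  getLast : (z.pre.concat (J + 1)).getLast? = some a

theorem StageInv.stage {J s : ℕ} {B : Blocks d} {Q : ℝ} (h : StageInv J Q s B) (hQ : 1 ≤ Q)
    (hs : s + 1 < 2 ^ (J + 1)) {a : Fin d → ℝ} {z : Snapshot d}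
    (hz : z ∈ (stage p β Q s B a).support) : SnapshotInv J Q s a z := by
  have hlast : ((B.push a).concat (J + 1)).getLast? = some a := by
    rw [Blocks.concat_push]; simp
  have hlen : ((B.push a 0).length : ℝ) ≤ max Q d + 1 := by
    rw [Blocks.push_zero, List.length_append, List.length_singleton]
    push_cast
    have := h.zero_length
    linarith
  have hpush := h.toBlocksInv.push a
  rw [OnlineLewis.stage] at hz
  split_ifs at hz with hc
  · rw [PMF.mem_support_bind_iff] at hz
    obtain ⟨B', hB', hz⟩ := hz
    rw [PMF.mem_support_pure_iff] at hz
    subst hz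
    have h2 : 2 ≤ (B.push a 0).length := by
      have : (1 : ℝ) < ((B.push a 0).length : ℝ) := lt_of_le_of_lt hQ hc.2
      exact_mod_cast this
    refine ⟨hpush, ⟨hpush.compress h2 hs hB', ?_⟩, hlen, hlast⟩
    rw [compress_eq, PMF.mem_support_bind_iff] at hB'
    obtain ⟨X, -, hB'⟩ := hB'
    rw [PMF.mem_support_pure_iff] at hB'
    have := (hpush.firstEmpty_le h2 hs).1
    have e : B' 0 = [] := by rw [hB']; exact if_pos (by omega)
    simp [e]
  · rw [PMF.mem_support_pure_iff] at hz
    subst hz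
    refine ⟨hpush, ⟨hpush, ?_⟩, hlen, hlast⟩
    -- Without compression either fewer than `d` rows came before, so that the load bounds block `0`
    -- by `d`, or the block has at most `Q` rows.
    rw [not_and_or, not_le, not_lt] at hc
    rcases hc with hc | hc
    · have h3 : (B.push a 0).length ≤ d := by have := hpush.load; omega
      exact le_max_of_le_right (by exact_mod_cast h3)
    · exact le_max_of_le_left hc

/-- Sure facts: `I` is an invariant of the blocks between stages, and `G` is what it implies for
each snapshot. -/
theorem forall_of_mem_support_runFrom {Q : ℝ} {N : ℕ} {I : ℕ → Blocks d → Prop}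
    {G : ℕ → (Fin d → ℝ) → Snapshot d → Prop}
    (hI : ∀ s B a, s < N → I s B → ∀ z ∈ (stage p β Q s B a).support, I (s + 1) z.post ∧ G s a z)
    {m s : ℕ} {B : Blocks d} {rows : Fin m → Fin d → ℝ} (hB : I s B) (hs : s + m ≤ N)
    {hist : Fin m → Snapshot d} (hh : hist ∈ (runFrom p β Q m s B rows).support) (i : Fin m) :
    G (s + i) (rows i) (hist i) := by
  induction m generalizing s B with
  | zero => exact i.elim0
  | succ m ih =>
    rw [runFrom, PMF.mem_support_bind_iff] at hh
    obtain ⟨z, hz, hh⟩ := hh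
    rw [PMF.mem_support_bind_iff] at hh
    obtain ⟨hist', hh', hh⟩ := hh
    rw [PMF.mem_support_pure_iff] at hh
    subst hh
    obtain ⟨h1, h2⟩ := hI s B (rows 0) (by omega) hB z hz
    refine Fin.cases h2 (fun i => ?_) i
    have := ih h1 (by omega) hh' i
    rw [Fin.val_succ, Fin.cons_succ, show s + (i + 1 : ℕ) = s + 1 + i by omega]
    exact this

theorem snapshotInv_of_mem_support_run {n J : ℕ} {Q : ℝ} (hQ : 1 ≤ Q) (hn : n < 2 ^ (J + 1))
    {A : Matrix (Fin n) (Fin d) ℝ} {hist : Fin n → Snapshot d}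
    (hh : hist ∈ (run p β Q A).support) (i : Fin n) : SnapshotInv J Q i (A i) (hist i) := by
  have := forall_of_mem_support_runFrom (N := n) (I := StageInv J Q) (G := SnapshotInv J Q)
    (fun s B a hs hB z hz => by
      have := hB.stage hQ (by omega) hz
      exact ⟨this.post, this⟩) ⟨blocksInv_nil J, by simp⟩ (by omega) hh i
  simpa using this

theorem toOuterMeasure_bind_pure {α β : Type*} (μ : PMF α) (f : α → β) (S : Set β) :
    (μ.bind fun a => PMF.pure (f a)).toOuterMeasure S = μ.toOuterMeasure (f ⁻¹' S) :=
  PMF.toOuterMeasure_map_apply f μ S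

/-- A union bound over the stages. -/
theorem toOuterMeasure_runFrom_exists_le {Q : ℝ} {N : ℕ} {I : ℕ → Blocks d → Prop} {c : ℝ≥0∞}
    (hI : ∀ s B a, s < N → I s B →
      (stage p β Q s B a).toOuterMeasure {z | ¬ I (s + 1) z.post} ≤ c)
    {m s : ℕ} {B : Blocks d} {rows : Fin m → Fin d → ℝ} (hB : I s B) (hs : s + m ≤ N) :
    (runFrom p β Q m s B rows).toOuterMeasure {hist | ∃ i : Fin m, ¬ I (s + i + 1) (hist i).post} ≤
      m * c := by
  induction m generalizing s B with
  | zero => simp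
  | succ m ih =>
    rw [runFrom, toOuterMeasure_bind_eq_expect]
    have h1 : ∀ z : Snapshot d, ((runFrom p β Q m (s + 1) z.post (Fin.tail rows)).bind fun hist =>
        PMF.pure (Fin.cons z hist : Fin (m + 1) → Snapshot d)).toOuterMeasure
          {hist | ∃ i : Fin (m + 1), ¬ I (s + i + 1) (hist i).post} ≤
        {z | ¬ I (s + 1) z.post}.indicator 1 z + m * c := fun z => by
      by_cases hz : I (s + 1) z.post
      · refine le_add_left (le_trans ?_ (ih hz (by omega) (rows := Fin.tail rows)))
        rw [toOuterMeasure_bind_pure]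
        refine MeasureTheory.OuterMeasure.mono _ ?_
        rintro hist ⟨i, hi⟩
        refine Fin.cases (fun h => absurd hz h) (fun i hi => ⟨i, ?_⟩) i hi
        rwa [Fin.val_succ, Fin.cons_succ, show s + ((i : ℕ) + 1) + 1 = s + 1 + i + 1 by omega] at hi
      · refine le_add_right ((toOuterMeasure_le_one _ _).trans ?_)
        rw [Set.indicator_of_mem (by exact hz)]; rfl
    refine (expect_mono fun z _ => h1 z).trans ?_
    rw [expect_add, expect_const]
    have h2 := hI s B (rows 0) (by omega) hB
    have h3 : expect (stage p β Q s B (rows 0)) (fun z => {z | ¬ I (s + 1) z.post}.indicator 1 z) =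
        (stage p β Q s B (rows 0)).toOuterMeasure {z | ¬ I (s + 1) z.post} := by
      rw [PMF.toOuterMeasure_apply, expect]
      refine tsum_congr fun z => ?_
      by_cases hz : z ∈ {z : Snapshot d | ¬ I (s + 1) z.post}
      · rw [Set.indicator_of_mem hz, Set.indicator_of_mem hz]; simp
      · rw [Set.indicator_of_notMem hz, Set.indicator_of_notMem hz, mul_zero]
    rw [h3]
    push_cast
    rw [add_mul, one_mul, add_comm]
    gcongr

end BlocksInvariant

/-! ### The potential -/

section Potential

open Matrix NormedSpace

set_option linter.unusedSectionVars false

variable {d : ℕ} {p β : ℝ} {U : Matrix (Fin d) (Fin d) ℝ} {s : Finset (Fin d)}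
  {R : Matrix s (Fin d) ℝ}

theorem ysum_quad_nonneg (hU : U.PosSemidef) {X : Rows d} (hX : ∀ u ∈ X, Dominated U u)
    (y : s → ℝ) : 0 ≤ y ⬝ᵥ ysum p U R X *ᵥ y := by
  induction X with
  | nil => simp
  | cons u X ih =>
    rw [ysum_cons, add_mulVec, dotProduct_add, yrow_quad]
    exact add_nonneg (mul_nonneg (Real.rpow_nonneg (lev_nonneg hU (hX u (by simp))) _) (sq_nonneg _))
      (ih fun u hu => hX u (by simp [hu]))

/-- Monotonicity of the trace exponential, row by row, as the deterministic case `r = 1` of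
`convexComb_trace_exp_le`. -/
theorem trace_exp_add_smul_ysum_mono (hU : U.PosSemidef) {X : Rows d}
    (hX : ∀ u ∈ X, Dominated U u) {D : Matrix s s ℝ} (hD : Dᵀ = D) {α α' : ℝ} (h : α ≤ α') :
    trace (exp (D + α • ysum p U R X)) ≤ trace (exp (D + α' • ysum p U R X)) := by
  induction X generalizing D with
  | nil => simp
  | cons u X ih =>
    have h1 := ih (fun u hu => hX u (by simp [hu])) (D := D + α • yrow p U R u)
      (by rw [transpose_add, transpose_smul, hD, yrow_transpose])
    have h2 := convexComb_trace_exp_le (D := D + α' • ysum p U R (u :: X))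
      (by rw [transpose_add, transpose_smul, hD, ysum_transpose]) (R *ᵥ u) (r := 1) (r' := 0)
      (z := (α - α') * lev U u ^ (p / 2 - 1)) (z' := 0) zero_le_one le_rfl (by ring) (by
        rw [one_mul, zero_mul, add_zero, Real.exp_le_one_iff, mul_assoc]
        refine mul_nonpos_of_nonpos_of_nonneg (by linarith) (mul_nonneg
          (Real.rpow_nonneg (lev_nonneg hU (hX u (by simp))) _) ?_)
        exact Finset.sum_nonneg fun _ _ => mul_self_nonneg _)
    rw [one_mul, zero_mul, add_zero] at h2
    have e1 : D + α • ysum p U R (u :: X) = D + α • yrow p U R u + α • ysum p U R X := by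
      rw [ysum_cons, smul_add, add_assoc]
    have e2 : D + α' • ysum p U R (u :: X) + ((α - α') * lev U u ^ (p / 2 - 1)) •
        vecMulVec (R *ᵥ u) (R *ᵥ u) = D + α • yrow p U R u + α' • ysum p U R X := by
      rw [ysum_cons, mul_smul, ← yrow, sub_smul, smul_add]
      abel
    rw [e2] at h2
    rw [e1]
    exact h1.trans h2

/-- The exponent of the potential. -/
def blockExponent (p : ℝ) (U : Matrix (Fin d) (Fin d) ℝ) (R : Matrix s (Fin d) ℝ) (γ : ℕ → ℝ)
    (J : ℕ) (B : Blocks d) (fut : Rows d) : Matrix s s ℝ :=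
  ∑ j ∈ Finset.range (J + 1), γ j • ysum p U R (B j) + γ 0 • ysum p U R fut

/-- The potential of the blocks `B` and the future rows `fut`. -/
def blockPot (p : ℝ) (U : Matrix (Fin d) (Fin d) ℝ) (R : Matrix s (Fin d) ℝ) (γ : ℕ → ℝ)
    (J : ℕ) (B : Blocks d) (fut : Rows d) : ℝ≥0∞ :=
  ENNReal.ofReal (trace (exp (blockExponent p U R γ J B fut)))

theorem blockExponent_transpose (γ : ℕ → ℝ) (J : ℕ) (B : Blocks d) (fut : Rows d) :
    (blockExponent p U R γ J B fut)ᵀ = blockExponent p U R γ J B fut := by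
  simp [blockExponent, transpose_sum, ysum_transpose]

/-- Future rows carry the coefficient of block `0`, so the arrival of a row is invisible to the
potential. -/
theorem blockPot_push (γ : ℕ → ℝ) (J : ℕ) (B : Blocks d) (a : Fin d → ℝ) (fut : Rows d) :
    blockPot p U R γ J (B.push a) fut = blockPot p U R γ J B (a :: fut) := by
  rw [blockPot, blockPot]
  congr 3
  rw [blockExponent, blockExponent, Finset.sum_range_succ', Finset.sum_range_succ',
    Blocks.push_zero, ysum_append, ysum_cons, ysum_cons, ysum_nil]
  have : ∀ j, B.push a (j + 1) = B (j + 1) := fun j => Blocks.push_of_ne _ _ (by omega)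
  simp only [this, smul_add, add_zero]
  abel

theorem ysum_concat (B : Blocks d) (k : ℕ) :
    ysum p U R (B.concat k) = ∑ j ∈ Finset.range k, ysum p U R (B j) := by
  induction k with
  | zero => rfl
  | succ k ih => rw [Blocks.concat, ysum_append, ih, Finset.sum_range_succ, add_comm]

theorem mem_concat {B : Blocks d} {k : ℕ} {u : Fin d → ℝ} (h : u ∈ B.concat k) :
    ∃ j < k, u ∈ B j := by
  induction k with
  | zero => simp [Blocks.concat] at h
  | succ k ih =>
    rw [Blocks.concat, List.mem_append] at h
    rcases h with h | h
    · exact ⟨k, by omega, h⟩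
    · obtain ⟨j, hj, hu⟩ := ih h
      exact ⟨j, by omega, hu⟩

/-- `γ J` is the smallest coefficient in use, so the exponent dominates `γ J` times the total sum.
The sign of `γ` is irrelevant here, which lets the same lemma serve both bounds. -/
theorem mul_quad_le_of_blockPot_le (hU : U.PosSemidef) {γ : ℕ → ℝ} (hγ : Antitone γ) {J : ℕ}
    {B : Blocks d} (hB : ∀ j, ∀ u ∈ B j, Dominated U u) {fut : Rows d}
    (hfut : ∀ u ∈ fut, Dominated U u) {t : ℝ}
    (h : blockPot p U R γ J B fut ≤ ENNReal.ofReal (Real.exp t)) (y : s → ℝ) :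
    γ J * (y ⬝ᵥ ysum p U R (B.concat (J + 1) ++ fut) *ᵥ y) ≤ t * (y ⬝ᵥ y) := by
  rw [blockPot, ENNReal.ofReal_le_ofReal_iff (Real.exp_pos _).le] at h
  refine le_trans ?_ (dotProduct_mulVec_le_of_trace_exp_le (blockExponent_transpose ..) h y)
  rw [blockExponent, ysum_append, ysum_concat]
  simp only [add_mulVec, dotProduct_add, sum_mulVec, dotProduct_sum, smul_mulVec, dotProduct_smul,
    smul_eq_mul, mul_add, Finset.mul_sum]
  refine add_le_add (Finset.sum_le_sum fun j hj => ?_) ?_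
  · exact mul_le_mul_of_nonneg_right (hγ (by have := Finset.mem_range.1 hj; omega))
      (ysum_quad_nonneg hU (hB j) y)
  · exact mul_le_mul_of_nonneg_right (hγ (Nat.zero_le _)) (ysum_quad_nonneg hU hfut y)

/-- Before a merge, the different coefficients of the merged blocks are lowered to a common value.
-/
theorem trace_exp_add_smul_concat_le (hU : U.PosSemidef) {γ : ℕ → ℝ} {B : Blocks d}
    (hB : ∀ j, ∀ u ∈ B j, Dominated U u) {D : Matrix s s ℝ} (hD : Dᵀ = D) {α : ℝ} (k : ℕ)
    (hα : ∀ j < k, α ≤ γ j) :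
    trace (exp (D + α • ysum p U R (B.concat k))) ≤
      trace (exp (D + ∑ j ∈ Finset.range k, γ j • ysum p U R (B j))) := by
  induction k generalizing D with
  | zero => simp [Blocks.concat]
  | succ k ih =>
    have h1 := ih (D := D + α • ysum p U R (B k))
      (by rw [transpose_add, transpose_smul, hD, ysum_transpose]) fun j hj => hα j (by omega)
    have h2 := trace_exp_add_smul_ysum_mono (p := p) (R := R) hU (hB k)
      (D := D + ∑ j ∈ Finset.range k, γ j • ysum p U R (B j))
      (by simp [transpose_sum, ysum_transpose, hD]) (hα k (by omega))
    rw [Blocks.concat, ysum_append, smul_add, ← add_assoc, Finset.sum_range_succ, ← add_assoc]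
    refine h1.trans (le_trans (le_of_eq ?_) h2)
    congr 2
    abel

theorem merge_exponent {B : Blocks d} {J : ℕ} (hf : B.firstEmpty ≤ J) (γ : ℕ → ℝ) (fut X : Rows d) :
    blockExponent p U R γ J (B.merge X) fut =
      (∑ j ∈ Finset.Ico (B.firstEmpty + 1) (J + 1), γ j • ysum p U R (B j) + γ 0 • ysum p U R fut) +
        γ B.firstEmpty • ysum p U R X := by
  have hm : ∀ j, B.merge X j = if j < B.firstEmpty then [] else if j = B.firstEmpty then X else B j :=
    fun j => rfl
  generalize B.firstEmpty = f at *
  rw [blockExponent, Finset.range_eq_Ico, ← Finset.sum_Ico_consecutive _ (Nat.zero_le f) (by omega),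
    Finset.sum_eq_sum_Ico_succ_bot (by omega : f < J + 1)]
  have e1 : ∑ j ∈ Finset.Ico 0 f, γ j • ysum p U R (B.merge X j) = 0 :=
    Finset.sum_eq_zero fun j hj => by
      rw [hm, if_pos (Finset.mem_Ico.1 hj).2, ysum_nil, smul_zero]
  have e2 : ∑ j ∈ Finset.Ico (f + 1) (J + 1), γ j • ysum p U R (B.merge X j) =
      ∑ j ∈ Finset.Ico (f + 1) (J + 1), γ j • ysum p U R (B j) :=
    Finset.sum_congr rfl fun j hj => by
      have := Finset.mem_Ico.1 hj
      rw [hm, if_neg (by omega), if_neg (by omega)]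
  rw [e1, e2, hm, if_neg (by omega), if_pos rfl, zero_add]
  abel

/-- The merged blocks are lowered to `γ (f-1)`, where `f` is the first empty index, and the sampling
passes from there to `γ f`. The algorithm samples by the Lewis weights of `M`, while the analysis
needs the weights with respect to `U`; `hgood` bounds the latter by twice the former. -/
theorem expect_compress_le (hp : 1 ≤ p) (hp2 : p ≤ 2) (hR : Normalizes U R) (hβ : 0 < β)
    {γ : ℕ → ℝ} (hγ : Antitone γ) {J : ℕ}
    (h2 : ∀ x w : ℝ, 0 ≤ x → x ≤ 2 * w → ∀ i, 1 ≤ i → i ≤ J →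
      TwoPoint (γ i) (γ (i - 1)) (min (β * w) 1) x)
    {B : Blocks d} (hf1 : 1 ≤ B.firstEmpty) (hfJ : B.firstEmpty ≤ J) (hfe : B B.firstEmpty = [])
    (hB : ∀ j, ∀ u ∈ B j, Dominated U u)
    (hgood : ∀ y, y ⬝ᵥ ysum p U R (B.concat (J + 1)) *ᵥ y ≤ 2 * (y ⬝ᵥ y)) (fut : Rows d) :
    expect (B.compress p β) (fun B' => blockPot p U R γ J B' fut) ≤ blockPot p U R γ J B fut := by
  set D := ∑ j ∈ Finset.Ico (B.firstEmpty + 1) (J + 1), γ j • ysum p U R (B j) +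
    γ 0 • ysum p U R fut with hD
  have hDt : Dᵀ = D := by simp [hD, transpose_sum, ysum_transpose]
  have hMd : ∀ u ∈ B.concat B.firstEmpty, Dominated U u := fun u hu => by
    obtain ⟨j, -, hj⟩ := mem_concat hu
    exact hB j u hj
  -- `M` consists of part of the current rows, and the other rows contribute nonnegatively.
  have hM2 : ∀ y, y ⬝ᵥ ysum p U R (B.concat B.firstEmpty) *ᵥ y ≤ 2 * (y ⬝ᵥ y) := fun y => by
    refine le_trans ?_ (hgood y)
    rw [ysum_concat, ysum_concat, ← Finset.sum_range_add_sum_Ico _ (show B.firstEmpty ≤ J + 1 by omega),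
      add_mulVec, dotProduct_add, sum_mulVec (s := Finset.Ico _ _), dotProduct_sum]
    exact le_add_of_nonneg_right (Finset.sum_nonneg fun j _ => ysum_quad_nonneg hR.posSemidef (hB j) y)
  simp only [compress_eq, expect_bind, expect_pure, blockPot, merge_exponent hfJ, ← hD]
  set M := B.concat B.firstEmpty with hM
  have hw := isLewisWeights_lewisWeight hp hp2 M.toMatrix
  have hmap : (List.ofFn fun i : Fin M.length =>
      ((β * lewisWeight p M.toMatrix i).toNNReal, M.get i)).map Prod.snd = M := by
    rw [List.map_ofFn]
    exact List.ofFn_get M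
  have key := expect_trace_exp_sampleRows_le (p := p) hp hR (α := γ B.firstEmpty)
    (α' := γ (B.firstEmpty - 1)) (List.ofFn fun i : Fin M.length =>
      ((β * lewisWeight p M.toMatrix i).toNNReal, M.get i)) (by
      intro z hz
      obtain ⟨i, rfl⟩ := List.mem_ofFn.1 hz
      have hdi : Dominated U (M.get i) := hMd _ (List.get_mem M i)
      have hwi := hw.1 i
      refine ⟨hdi, fun h0 => ?_, ?_⟩
      · by_contra hne
        have h1 : 0 < lewisWeight p M.toMatrix i := hw.2.1 i hne
        have h3 : 0 < min (β * lewisWeight p M.toMatrix i).toNNReal 1 :=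
          lt_min (Real.toNNReal_pos.2 (mul_pos hβ h1)) one_pos
        exact h3.ne' h0
      · have := h2 (lev U (M.get i) ^ (p / 2)) (lewisWeight p M.toMatrix i)
          (Real.rpow_nonneg (lev_nonneg hR.posSemidef hdi) _)
          (hR.le_lewisWeight hp hp2 hMd two_pos hM2 i) _ hf1 hfJ
        rw [NNReal.coe_min, Real.coe_toNNReal _ (mul_nonneg hβ.le hwi), NNReal.coe_one]
        exact this) hDt
  refine key.trans (ENNReal.ofReal_le_ofReal ?_)
  rw [hmap]
  refine (trace_exp_add_smul_concat_le (γ := γ) hR.posSemidef hB hDt B.firstEmpty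
    fun j hj => hγ (by omega)).trans (le_of_eq ?_)
  congr 2
  rw [blockExponent, hD, Finset.range_eq_Ico, Finset.range_eq_Ico,
    ← Finset.sum_Ico_consecutive _ (Nat.zero_le B.firstEmpty) (show B.firstEmpty ≤ J + 1 by omega),
    Finset.sum_eq_sum_Ico_succ_bot (show B.firstEmpty < J + 1 by omega), hfe, ysum_nil, smul_zero,
    zero_add]
  abel

/-! ### The failure probability of one stage -/

/-- A maximal inequality for a conditional supermartingale. The drift condition may fail where `1 ≤
Ψ`, because there the claimed bound exceeds any probability. The future is cut off after row `τ`, to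
which the target form belongs. -/
theorem toOuterMeasure_runFrom_bad_le {Q : ℝ} {N : ℕ} {Ψ : Blocks d → Rows d → ℝ≥0∞}
    {I : ℕ → Blocks d → Prop} {bad : Blocks d → Prop} {Dm : (Fin d → ℝ) → Prop}
    (h1 : ∀ s B a fut, s < N → I s B → Dm a → (∀ u ∈ fut, Dm u) →
      expect (stage p β Q s B a) (fun z => Ψ z.post fut) ≤ Ψ B (a :: fut) ∨ 1 ≤ Ψ B (a :: fut))
    (hI : ∀ s B a, s < N → I s B → Dm a → ∀ z ∈ (stage p β Q s B a).support,
      z.pre = B.push a ∧ I (s + 1) z.post)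
    (hbad : ∀ s B a, I s B → Dm a → bad (B.push a) → 1 ≤ Ψ B [a])
    {m t : ℕ} {B : Blocks d} {rows : Fin m → Fin d → ℝ} (hB : I t B) (ht : t + m ≤ N) (τ : Fin m)
    (hrows : ∀ i ≤ τ, Dm (rows i)) :
    (runFrom p β Q m t B rows).toOuterMeasure {hist | bad (hist τ).pre} ≤
      Ψ B ((List.ofFn rows).take (τ + 1)) := by
  induction m generalizing t B with
  | zero => exact τ.elim0
  | succ m ih =>
    have h0 : Dm (rows 0) := hrows 0 (Fin.zero_le _)
    rw [runFrom, toOuterMeasure_bind_eq_expect]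
    simp only [toOuterMeasure_bind_pure]
    induction τ using Fin.cases with
    | zero =>
      simp only [Set.preimage_ofPred_eq, Fin.cons_zero]
      have e : (List.ofFn rows).take ((0 : Fin (m + 1)) + 1 : ℕ) = [rows 0] := by simp [List.ofFn_succ]
      rw [e]
      by_cases hb : bad (B.push (rows 0))
      · refine le_trans ?_ (hbad t B _ hB h0 hb)
        exact (expect_mono fun z _ => toOuterMeasure_le_one _ _).trans (expect_const _ _).le
      · refine le_trans (expect_mono (g := fun _ => 0) fun z hz => ?_) (by rw [expect_const]; exact zero_le)
        have : {hist : Fin m → Snapshot d | bad z.pre} = ∅ := by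
          rw [(hI t B _ (by omega) hB h0 z hz).1]; simp [hb]
        rw [this]; simp
    | succ τ =>
      simp only [Set.preimage_ofPred_eq, Fin.cons_succ]
      have e : (List.ofFn rows).take ((τ.succ : ℕ) + 1) =
          rows 0 :: (List.ofFn (Fin.tail rows)).take (τ + 1) := by
        rw [List.ofFn_succ, Fin.val_succ, List.take_succ_cons]; rfl
      rw [e]
      have hfut : ∀ u ∈ (List.ofFn (Fin.tail rows)).take (τ + 1), Dm u := fun u hu => by
        obtain ⟨i, hi, rfl⟩ := List.mem_take_iff_getElem.1 hu
        rw [List.getElem_ofFn]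
        refine hrows _ ?_
        rw [Fin.le_def]
        simp at hi ⊢
        omega
      rcases h1 t B (rows 0) _ (by omega) hB h0 hfut with h | h
      · refine le_trans (expect_mono fun z hz => ?_) h
        exact ih (hI t B _ (by omega) hB h0 z hz).2 (by omega) τ fun i hi =>
          hrows i.succ (by simpa using hi)
      · exact ((expect_mono fun z _ => toOuterMeasure_le_one _ _).trans (expect_const _ _).le).trans h

end Potential

/-! ### The estimates are accurate -/

section Accuracy

open Matrix NormedSpace

variable {n d : ℕ} {p β Q : ℝ} {U : Matrix (Fin d) (Fin d) ℝ} {s : Finset (Fin d)}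
  {R : Matrix s (Fin d) ℝ}

/-- If the row is not kept for sure, then `α x ≤ (e β / 4)(2 w)`, which is `e/2` times its
probability `β w`. -/
theorem sample_prob_cases {w x β α e : ℝ} (hβ : 0 < β) (hαe : α ≤ e * β / 4)
    (he : 0 ≤ e) (hx : 0 ≤ x) (hxw : x ≤ 2 * w) :
    0 ≤ min (β * w) 1 ∧ (min (β * w) 1 = 1 ∨ α * x ≤ e / 2 * min (β * w) 1) ∧
      (min (β * w) 1 = 0 → x = 0) := by
  have hw : 0 ≤ w := by linarith
  have hβw : 0 ≤ β * w := by positivity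
  rcases le_total 1 (β * w) with h | h
  · rw [min_eq_right h]
    exact ⟨zero_le_one, Or.inl rfl, fun h => absurd h one_ne_zero⟩
  · rw [min_eq_left h]
    refine ⟨hβw, Or.inr ?_, fun h0 => ?_⟩
    · calc α * x ≤ (e * β / 4) * (2 * w) := by gcongr
        _ = _ := by ring
    · have : w = 0 := (mul_eq_zero.1 h0).resolve_left hβ.ne'
      linarith

/-- The coefficients of the blocks in the potential for the upper bound. -/
def upperCoef (θ e : ℝ) (j : ℕ) : ℝ := θ * ((1 + e) ^ j)⁻¹

/-- The coefficients of the blocks in the potential for the lower bound. -/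
def lowerCoef (θ e : ℝ) (j : ℕ) : ℝ := -(θ * (1 + e) ^ j)

theorem antitone_upperCoef {θ e : ℝ} (hθ : 0 ≤ θ) (he : 0 ≤ e) : Antitone (upperCoef θ e) := by
  intro i j hij
  rw [upperCoef, upperCoef]
  gcongr
  linarith

theorem antitone_lowerCoef {θ e : ℝ} (hθ : 0 ≤ θ) (he : 0 ≤ e) : Antitone (lowerCoef θ e) := by
  intro i j hij
  rw [lowerCoef, lowerCoef]
  gcongr
  linarith

/-- Consecutive coefficients differ by exactly the factor `1 + e` that a round of sampling consumes.
-/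
theorem twoPoint_upperCoef {θ e : ℝ} {J : ℕ} (hθ : 0 ≤ θ) (he0 : 0 ≤ e) (he : e ≤ 1) (hβ : 0 < β)
    (h : θ * (1 + e) ^ J ≤ e * β / 4) (x w : ℝ) (hx : 0 ≤ x) (hxw : x ≤ 2 * w) (i : ℕ) (hi : 1 ≤ i) :
    TwoPoint (upperCoef θ e i) (upperCoef θ e (i - 1)) (min (β * w) 1) x := by
  have h0 : upperCoef θ e i ≤ e * β / 4 := by
    refine le_trans ?_ h
    rw [upperCoef]
    gcongr
    exact (inv_le_one_of_one_le₀ (one_le_pow₀ (by linarith))).trans (one_le_pow₀ (by linarith))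
  have h1 : 0 ≤ upperCoef θ e i := by rw [upperCoef]; positivity
  obtain ⟨h2, h3, h4⟩ := sample_prob_cases hβ h0 he0 hx hxw
  refine twoPoint_upper h2 (min_le_right _ _) hx he0 he h1 (le_of_eq ?_) h3 h4
  obtain ⟨k, rfl⟩ : ∃ k, i = k + 1 := ⟨i - 1, by omega⟩
  rw [upperCoef, upperCoef, Nat.add_sub_cancel, pow_succ]
  field_simp

theorem twoPoint_lowerCoef {θ e : ℝ} {J : ℕ} (hθ : 0 ≤ θ) (he0 : 0 ≤ e) (he : e ≤ 1) (hβ : 0 < β)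
    (h : θ * (1 + e) ^ J ≤ e * β / 4) (x w : ℝ) (hx : 0 ≤ x) (hxw : x ≤ 2 * w) (i : ℕ) (hi : 1 ≤ i)
    (hiJ : i ≤ J) :
    TwoPoint (lowerCoef θ e i) (lowerCoef θ e (i - 1)) (min (β * w) 1) x := by
  have h0 : θ * (1 + e) ^ i ≤ e * β / 4 := by
    refine le_trans ?_ h
    gcongr
    linarith
  have h1 : 0 ≤ θ * (1 + e) ^ i := by positivity
  obtain ⟨h2, h3, h4⟩ := sample_prob_cases hβ h0 he0 hx hxw
  refine twoPoint_lower h2 (min_le_right _ _) hx he0 he (by positivity) (le_of_eq ?_) h3 h4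
  obtain ⟨k, rfl⟩ : ∃ k, i = k + 1 := ⟨i - 1, by omega⟩
  rw [Nat.add_sub_cancel, pow_succ]
  ring

/-- The normalized sum of the current rows is between `κ'` and `κ`. -/
def Balanced (p : ℝ) (U : Matrix (Fin d) (Fin d) ℝ) (R : Matrix s (Fin d) ℝ) (κ κ' : ℝ)
    (X : Rows d) : Prop :=
  ∀ y, y ⬝ᵥ ysum p U R X *ᵥ y ≤ κ * (y ⬝ᵥ y) ∧ κ' * (y ⬝ᵥ y) ≤ y ⬝ᵥ ysum p U R X *ᵥ y

/-- The invariant for a fixed target: structure of the blocks, and domination by the Lewis form. -/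
structure TargetInv (J : ℕ) (Q : ℝ) (U : Matrix (Fin d) (Fin d) ℝ) (s : ℕ) (B : Blocks d) : Prop
    extends StageInv J Q s B where
  dominated : ∀ j, ∀ u ∈ B j, Dominated U u

theorem dominated_push {B : Blocks d} (hB : ∀ j, ∀ u ∈ B j, Dominated U u) {a : Fin d → ℝ}
    (ha : Dominated U a) : ∀ j, ∀ u ∈ B.push a j, Dominated U u := by
  intro j u hu
  by_cases hj : j = 0
  · subst hj
    rw [Blocks.push_zero, List.mem_append, List.mem_singleton] at hu
    rcases hu with hu | rfl
    · exact hB 0 u hu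
    · exact ha
  · rw [Blocks.push_of_ne _ _ hj] at hu
    exact hB j u hu

theorem dominated_compress {B B' : Blocks d} (hB : ∀ j, ∀ u ∈ B j, Dominated U u)
    (hB' : B' ∈ (B.compress p β).support) : ∀ j, ∀ u ∈ B' j, Dominated U u := by
  rw [compress_eq, PMF.mem_support_bind_iff] at hB'
  obtain ⟨X, hX, hB'⟩ := hB'
  rw [PMF.mem_support_pure_iff] at hB'
  subst hB'
  intro j u hu
  rw [Blocks.merge] at hu
  split_ifs at hu
  · simp at hu
  · refine dominated_of_mem_support_sampleRows _ (fun z hz => ?_) hX u hu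
    obtain ⟨i, rfl⟩ := List.mem_ofFn.1 hz
    obtain ⟨k, -, hk⟩ := mem_concat (List.get_mem (B.concat B.firstEmpty) i)
    exact hB k _ hk
  · exact hB j u hu

theorem TargetInv.stage {J t : ℕ} {B : Blocks d} (h : TargetInv J Q U t B) (hQ : 1 ≤ Q)
    (ht : t + 1 < 2 ^ (J + 1)) {a : Fin d → ℝ} (ha : Dominated U a) {z : Snapshot d}
    (hz : z ∈ (stage p β Q t B a).support) : z.pre = B.push a ∧ TargetInv J Q U (t + 1) z.post := by
  have h1 := (h.toStageInv.stage hQ ht hz).post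
  have h2 := dominated_push h.dominated ha
  rw [OnlineLewis.stage] at hz
  split_ifs at hz with hc
  · rw [PMF.mem_support_bind_iff] at hz
    obtain ⟨B', hB', hz⟩ := hz
    rw [PMF.mem_support_pure_iff] at hz
    subst hz
    exact ⟨rfl, h1, dominated_compress h2 hB'⟩
  · rw [PMF.mem_support_pure_iff] at hz
    subst hz
    exact ⟨rfl, h1, h2⟩

theorem ofReal_mul_blockPot_lt {γ : ℕ → ℝ} {J : ℕ} {B : Blocks d} {fut : Rows d} {t : ℝ}
    (h : ENNReal.ofReal (Real.exp (-t)) * blockPot p U R γ J B fut < 1) :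
    blockPot p U R γ J B fut ≤ ENNReal.ofReal (Real.exp t) := by
  rw [blockPot, ← ENNReal.ofReal_mul (Real.exp_pos _).le, ← ENNReal.ofReal_one] at h
  have h1 := (ENNReal.ofReal_lt_ofReal_iff one_pos).1 h
  rw [blockPot]
  apply ENNReal.ofReal_le_ofReal
  have h2 := mul_lt_mul_of_pos_left h1 (Real.exp_pos t)
  rw [← mul_assoc, ← Real.exp_add, add_neg_cancel, Real.exp_zero, one_mul, mul_one] at h2
  exact h2.le

/-- The total potential, normalized such that it is at least `1` if the rows are not balanced. -/
def totalPot (p : ℝ) (U : Matrix (Fin d) (Fin d) ℝ) (R : Matrix s (Fin d) ℝ) (θ e κ κ' : ℝ) (J : ℕ)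
    (B : Blocks d) (fut : Rows d) : ℝ≥0∞ :=
  ENNReal.ofReal (Real.exp (-(upperCoef θ e J * κ))) * blockPot p U R (upperCoef θ e) J B fut +
    ENNReal.ofReal (Real.exp (-(lowerCoef θ e J * κ'))) * blockPot p U R (lowerCoef θ e) J B fut

theorem totalPot_push {θ e κ κ' : ℝ} {J : ℕ} (B : Blocks d) (a : Fin d → ℝ) (fut : Rows d) :
    totalPot p U R θ e κ κ' J (B.push a) fut = totalPot p U R θ e κ κ' J B (a :: fut) := by
  simp only [totalPot, blockPot_push]

/-- Each summand below `1` gives a spectral bound with `t = γ J * κ` or `γ J * κ'`. Dividing by `γ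
J` keeps the inequality for the upper coefficients and reverses it for the negative lower ones. -/
theorem balanced_of_totalPot_lt {θ e κ κ' : ℝ} {J : ℕ} (hU : U.PosSemidef) (hθ : 0 < θ)
    (he : 0 ≤ e) {B : Blocks d} {fut : Rows d} (hB : ∀ j, ∀ u ∈ B j, Dominated U u)
    (hfut : ∀ u ∈ fut, Dominated U u) (h : totalPot p U R θ e κ κ' J B fut < 1) :
    Balanced p U R κ κ' (B.concat (J + 1) ++ fut) := by
  intro y
  have h1 := ofReal_mul_blockPot_lt (lt_of_le_of_lt le_self_add h)
  have h2 := ofReal_mul_blockPot_lt (lt_of_le_of_lt le_add_self h)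
  have h3 := mul_quad_le_of_blockPot_le hU (antitone_upperCoef hθ.le he) hB hfut h1 y
  have h4 := mul_quad_le_of_blockPot_le hU (antitone_lowerCoef hθ.le he) hB hfut h2 y
  have h5 : 0 < upperCoef θ e J := by rw [upperCoef]; positivity
  have h6 : 0 < θ * (1 + e) ^ J := by positivity
  constructor
  · rw [mul_assoc] at h3; exact le_of_mul_le_mul_left h3 h5
  · rw [lowerCoef, mul_assoc, neg_mul, neg_mul, neg_le_neg_iff] at h4
    exact le_of_mul_le_mul_left h4 h6

/-- A potential below `1` certifies that current and future rows together stay below `κ ≤ 2`; this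
is the condition under which sampling does not increase the potential. -/
theorem expect_stage_totalPot_le {θ e κ κ' : ℝ} {J : ℕ} (hp : 1 ≤ p) (hp2 : p ≤ 2)
    (hR : Normalizes U R) (hβ : 0 < β) (hQ : 1 ≤ Q) (hθ : 0 < θ) (he0 : 0 ≤ e) (he : e ≤ 1)
    (hκ : κ ≤ 2) (h : θ * (1 + e) ^ J ≤ e * β / 4) {t : ℕ} (ht : t + 1 < 2 ^ (J + 1))
    {B : Blocks d} (hB : TargetInv J Q U t B) {a : Fin d → ℝ} (ha : Dominated U a) {fut : Rows d}
    (hfut : ∀ u ∈ fut, Dominated U u) :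
    expect (stage p β Q t B a) (fun z => totalPot p U R θ e κ κ' J z.post fut) ≤
      totalPot p U R θ e κ κ' J B (a :: fut) ∨ 1 ≤ totalPot p U R θ e κ κ' J B (a :: fut) := by
  rw [or_iff_not_imp_right, not_le, ← totalPot_push]
  intro hlt
  have hd := dominated_push hB.dominated ha
  have hbal := balanced_of_totalPot_lt hR.posSemidef hθ he0 hd hfut hlt
  rw [stage]
  split_ifs with hc
  · have h2 : 2 ≤ (B.push a 0).length := by
      have : (1 : ℝ) < ((B.push a 0).length : ℝ) := lt_of_le_of_lt hQ hc.2
      exact_mod_cast this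
    have hinv := hB.toBlocksInv.push a
    obtain ⟨hf1, hfJ⟩ := hinv.firstEmpty_le h2 ht
    have hfe := (Blocks.firstEmpty_spec hinv.empty).1
    have hgood : ∀ y, y ⬝ᵥ ysum p U R ((B.push a).concat (J + 1)) *ᵥ y ≤ 2 * (y ⬝ᵥ y) := fun y => by
      have h1 := (hbal y).1
      rw [ysum_append, add_mulVec, dotProduct_add] at h1
      have h2 := ysum_quad_nonneg (p := p) (R := R) hR.posSemidef hfut y
      have h3 : 0 ≤ y ⬝ᵥ y := Finset.sum_nonneg fun _ _ => mul_self_nonneg _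
      nlinarith
    simp only [expect_bind, expect_pure, totalPot, expect_add, expect_const_mul]
    gcongr
    · exact expect_compress_le hp hp2 hR hβ (antitone_upperCoef hθ.le he0)
        (fun x w hx hxw i hi hiJ => twoPoint_upperCoef hθ.le he0 he hβ h x w hx hxw i hi)
        hf1 hfJ hfe hd hgood fut
    · exact expect_compress_le hp hp2 hR hβ (antitone_lowerCoef hθ.le he0)
        (fun x w hx hxw i hi hiJ => twoPoint_lowerCoef hθ.le he0 he hβ h x w hx hxw i hi hiJ)
        hf1 hfJ hfe hd hgood fut
  · rw [expect_pure]

/-- The rows up to and including row `t`. -/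
def rowsUpTo (A : Matrix (Fin n) (Fin d) ℝ) (t : Fin n) : Matrix (Fin (t.val + 1)) (Fin d) ℝ :=
  A.submatrix (Fin.castLE t.isLt : Fin (t.val + 1) → Fin n) id

theorem ysum_take_eq_one (hR : Normalizes U R) {A : Matrix (Fin n) (Fin d) ℝ} {t : Fin n}
    (hU : IsLewisForm p (fun i => rowsUpTo A t i) U) :
    ysum p U R ((List.ofFn fun i => A i).take (t + 1)) = 1 := by
  have e : (List.ofFn fun i => A i).take (t + 1) = List.ofFn fun i => rowsUpTo A t i := by
    apply List.ext_getElem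
    · simp
    · intro i h1 h2
      simp only [List.getElem_take, List.getElem_ofFn]
      rfl
  rw [e, ysum, List.map_ofFn, List.sum_ofFn, ← hR.sum_yrow_eq_one hU]
  rfl

/-- The weights are at most `1` and sum to the rank. So the dimension factor in the failure
probability is at most `n`, whatever `d` is. -/
theorem card_le_of_isLewisForm (hp : 1 ≤ p) (hR : Normalizes U R) {m : ℕ} {a : Fin m → Fin d → ℝ}
    (hU : IsLewisForm p a U) : (s.card : ℝ) ≤ m := by
  rw [hU.sum_lev_rpow hp hR.eq_one hR.eq_self]
  refine (Finset.sum_le_sum fun i _ => hU.lev_rpow_le_one i).trans ?_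
  simp

/-- The initial potential: all rows lie in the future, and their contributions add up to the
identity. -/
theorem blockPot_nil {γ : ℕ → ℝ} {J : ℕ} {X : Rows d} (hX : ysum p U R X = 1) :
    blockPot p U R γ J (fun _ => []) X = ENNReal.ofReal (s.card * Real.exp (γ 0)) := by
  rw [blockPot, blockExponent, hX]
  simp only [ysum_nil, smul_zero, Finset.sum_const_zero, zero_add]
  rw [trace_exp_smul_one]
  simp

/-- The failure probability for the estimate of a fixed row. -/
theorem toOuterMeasure_run_not_balanced_le {θ e κ κ' : ℝ} {J : ℕ} (hp : 1 ≤ p) (hp2 : p ≤ 2)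
    (hR : Normalizes U R) (hβ : 0 < β) (hQ : 1 ≤ Q) (hθ : 0 < θ) (he0 : 0 ≤ e) (he : e ≤ 1)
    (hκ : κ ≤ 2) (h : θ * (1 + e) ^ J ≤ e * β / 4) (hn : n < 2 ^ (J + 1))
    {A : Matrix (Fin n) (Fin d) ℝ} {t : Fin n} (hU : IsLewisForm p (fun i => rowsUpTo A t i) U) :
    (run p β Q A).toOuterMeasure {hist |
      ¬ (Balanced p U R κ κ' ((hist t).pre.concat (J + 1)) ∧
        ∀ j, ∀ u ∈ (hist t).pre j, Dominated U u)} ≤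
      ENNReal.ofReal (n * (Real.exp (θ - upperCoef θ e J * κ) +
        Real.exp (-θ - lowerCoef θ e J * κ'))) := by
  have key := toOuterMeasure_runFrom_bad_le (p := p) (β := β) (Q := Q) (N := n)
    (Ψ := totalPot p U R θ e κ κ' J) (I := TargetInv J Q U)
    (bad := fun B => ¬ (Balanced p U R κ κ' (B.concat (J + 1)) ∧ ∀ j, ∀ u ∈ B j, Dominated U u)) (Dm := Dominated U)
    (fun s B a fut hs hB ha hfut =>
      expect_stage_totalPot_le hp hp2 hR hβ hQ hθ he0 he hκ h (by omega) hB ha hfut)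
    (fun s B a hs hB ha z hz => hB.stage hQ (by omega) ha hz)
    (fun s B a hB ha hbad => by
      by_contra hlt
      rw [not_le, ← totalPot_push] at hlt
      have := balanced_of_totalPot_lt hR.posSemidef hθ he0 (dominated_push hB.dominated ha)
        (by simp) hlt
      rw [List.append_nil] at this
      exact hbad ⟨this, dominated_push hB.dominated ha⟩)
    (m := n) (t := 0) (B := fun _ => []) (rows := fun i => A i)
    ⟨⟨blocksInv_nil J, by simp⟩, by simp⟩ (by omega) t
    (fun i hi => hU.dominated ⟨i, by have := Fin.le_def.1 hi; omega⟩)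
  refine key.trans ?_
  rw [totalPot, blockPot_nil (ysum_take_eq_one hR hU), blockPot_nil (ysum_take_eq_one hR hU),
    ← ENNReal.ofReal_mul (Real.exp_pos _).le, ← ENNReal.ofReal_mul (Real.exp_pos _).le,
    ← ENNReal.ofReal_add (by positivity) (by positivity)]
  apply ENNReal.ofReal_le_ofReal
  have hc : (s.card : ℝ) ≤ n :=
    (card_le_of_isLewisForm hp hR hU).trans (by exact_mod_cast t.isLt)
  have e1 : upperCoef θ e 0 = θ := by simp [upperCoef]
  have e2 : lowerCoef θ e 0 = -θ := by simp [lowerCoef]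
  rw [e1, e2, sub_eq_add_neg θ, sub_eq_add_neg (-θ), Real.exp_add, Real.exp_add]
  have h1 := Real.exp_pos (-(upperCoef θ e J * κ))
  have h2 := Real.exp_pos (-(lowerCoef θ e J * κ'))
  have h3 := Real.exp_pos θ
  have h4 := Real.exp_pos (-θ)
  calc _ = s.card * (Real.exp θ * Real.exp (-(upperCoef θ e J * κ)) +
      Real.exp (-θ) * Real.exp (-(lowerCoef θ e J * κ'))) := by ring
    _ ≤ _ := by gcongr

theorem onlineLewisWeight_eq (A : Matrix (Fin n) (Fin d) ℝ) (t : Fin n) :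
    onlineLewisWeight p A t = lewisWeight p (rowsUpTo A t) (Fin.last t.val) := rfl

theorem lastLewisWeight_eq {X : Rows d} {a : Fin d → ℝ} (h : X.getLast? = some a) :
    ∃ i : Fin X.length, X.toMatrix i = a ∧ lastLewisWeight p X = lewisWeight p X.toMatrix i := by
  have h0 : 0 < X.length := by
    rw [List.length_pos_iff]; rintro rfl; simp at h
  refine ⟨⟨X.length - 1, Nat.sub_lt h0 Nat.one_pos⟩, ?_, by rw [lastLewisWeight, dif_pos h0]⟩
  rw [List.getLast?_eq_getElem?, List.getElem?_eq_some_iff] at h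
  obtain ⟨_, h⟩ := h
  exact h

/-- If the current rows are balanced, then the estimate is accurate. -/
theorem estimate_bounds {κ κ' : ℝ} (hp : 1 ≤ p) (hp2 : p ≤ 2) (hR : Normalizes U R) (hκ : 0 < κ)
    (hκ' : 0 < κ') {A : Matrix (Fin n) (Fin d) ℝ} {t : Fin n} {X : Rows d}
    (hw : lewisWeight p (rowsUpTo A t) (Fin.last t.val) = lev U (A t) ^ (p / 2))
    (hX : ∀ u ∈ X, Dominated U u) (hlast : X.getLast? = some (A t)) (h : Balanced p U R κ κ' X) :
    onlineLewisWeight p A t ≤ κ * lastLewisWeight p X ∧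
      κ' * lastLewisWeight p X ≤ onlineLewisWeight p A t := by
  obtain ⟨i, hi, hl⟩ := lastLewisWeight_eq (p := p) hlast
  rw [onlineLewisWeight_eq, hw, hl, ← hi]
  exact ⟨hR.le_lewisWeight hp hp2 hX hκ (fun y => (h y).1) i,
    hR.lewisWeight_le hp hp2 hX hκ' (fun y => (h y).2) i⟩

end Accuracy

/-! ### The length of the blocks -/

section BlockLength

variable {n d : ℕ} {p β Q : ℝ}

/-- An exponential Markov inequality; the probabilities sum to at most `β d` because the Lewis
weights sum to at most `d`, for every `M`. -/
theorem toOuterMeasure_lewisSample_length_le (hp : 1 ≤ p) (hp2 : p ≤ 2) (hβ : 0 ≤ β) (M : Rows d)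
    (L : ℝ) : (lewisSample p β M).toOuterMeasure {X | L < X.length} ≤
      ENNReal.ofReal (Real.exp (2 * (β * d) - L)) := by
  refine (toOuterMeasure_le_expect (f := fun X => ENNReal.ofReal (Real.exp (-L)) *
    ENNReal.ofReal (Real.exp X.length)) _ fun X hX => ?_).trans ?_
  · rw [← ENNReal.ofReal_mul (Real.exp_pos _).le, ← Real.exp_add, ← ENNReal.ofReal_one]
    apply ENNReal.ofReal_le_ofReal
    apply Real.one_le_exp
    have : L < X.length := hX
    linarith
  · rw [expect_const_mul]
    have h1 := expect_exp_length_sampleRows_le (p := p) (d := d)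
      (List.ofFn fun i : Fin M.length => ((β * lewisWeight p M.toMatrix i).toNNReal, M.get i))
    rw [lewisSample]
    refine (mul_le_mul_right h1 _).trans ?_
    rw [← ENNReal.ofReal_mul (Real.exp_pos _).le, ← Real.exp_add]
    apply ENNReal.ofReal_le_ofReal
    rw [Real.exp_le_exp, List.map_ofFn, List.sum_ofFn]
    have h2 : ∑ i, lewisWeight p M.toMatrix i ≤ d := sum_lewisWeight_le hp hp2 _
    have h3 : ∑ i : Fin M.length, ((β * lewisWeight p M.toMatrix i).toNNReal : ℝ) ≤ β * d := by
      refine le_trans (le_of_eq ?_) (mul_le_mul_of_nonneg_left h2 hβ)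
      rw [Finset.mul_sum]
      refine Finset.sum_congr rfl fun i _ => Real.coe_toNNReal _ (mul_nonneg hβ ?_)
      exact (isLewisWeights_lewisWeight hp hp2 M.toMatrix).1 i
    simp only [Function.comp_def]
    linarith

theorem toOuterMeasure_stage_length_le (hp : 1 ≤ p) (hp2 : p ≤ 2) (hβ : 0 ≤ β) (L : ℝ) (t : ℕ)
    {B : Blocks d} (hB : ∀ i, 1 ≤ i → ((B i).length : ℝ) ≤ L) (a : Fin d → ℝ) :
    (stage p β Q t B a).toOuterMeasure
      {z | ¬ ∀ i, 1 ≤ i → ((z.post i).length : ℝ) ≤ L} ≤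
      ENNReal.ofReal (Real.exp (2 * (β * d) - L)) := by
  have hpush : ∀ i, 1 ≤ i → ((B.push a i).length : ℝ) ≤ L := fun i hi => by
    rw [Blocks.push_of_ne _ _ (by omega)]; exact hB i hi
  rw [stage]
  split_ifs with hc
  · rw [toOuterMeasure_bind_pure, compress_eq, toOuterMeasure_bind_pure]
    refine le_trans (MeasureTheory.OuterMeasure.mono _ ?_)
      (toOuterMeasure_lewisSample_length_le hp hp2 hβ ((B.push a).concat (B.push a).firstEmpty) L)
    intro X hX
    by_contra hle
    refine hX fun i hi => ?_
    have hle' : (X.length : ℝ) ≤ L := not_lt.1 hle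
    simp only [Blocks.merge]
    split_ifs
    · exact le_trans (by simp) hle'
    · exact hle'
    · exact hpush i hi
  · rw [PMF.toOuterMeasure_pure_apply, if_neg (by simpa using hpush)]
    exact zero_le

theorem toOuterMeasure_run_length_le (hp : 1 ≤ p) (hp2 : p ≤ 2) (hβ : 0 ≤ β) {L : ℝ} (hL : 0 ≤ L)
    (A : Matrix (Fin n) (Fin d) ℝ) :
    (run p β Q A).toOuterMeasure
      {hist | ∃ t : Fin n, ¬ ∀ i, 1 ≤ i → (((hist t).post i).length : ℝ) ≤ L} ≤
      n * ENNReal.ofReal (Real.exp (2 * (β * d) - L)) :=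
  toOuterMeasure_runFrom_exists_le (N := n)
    (I := fun _ B => ∀ i, 1 ≤ i → ((B i).length : ℝ) ≤ L)
    (fun _ _ a _ hB => toOuterMeasure_stage_length_le hp hp2 hβ L _ hB a)
    (fun _ _ => by simpa using hL) (by omega)

theorem concat_length_le {B : Blocks d} {L L' : ℝ} (h0 : ((B 0).length : ℝ) ≤ L')
    (hB : ∀ i, 1 ≤ i → ((B i).length : ℝ) ≤ L) (k : ℕ) :
    ((B.concat (k + 1)).length : ℝ) ≤ L' + k * L := by
  induction k with
  | zero => simpa [Blocks.concat] using h0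
  | succ k ih =>
    rw [Blocks.concat, List.length_append]
    push_cast
    have := hB (k + 1) (by omega)
    linarith

/-- The blocks of index at least `1` before the compression are those after the previous stage. -/
theorem pre_length_le_of_mem_support_run {L : ℝ} (hL : 0 ≤ L) {A : Matrix (Fin n) (Fin d) ℝ}
    {hist : Fin n → Snapshot d} (hh : hist ∈ (run p β Q A).support)
    (h : ∀ t i, 1 ≤ i → (((hist t).post i).length : ℝ) ≤ L) (t : Fin n) (i : ℕ) (hi : 1 ≤ i) :
    (((hist t).pre i).length : ℝ) ≤ L := by
  have key : ∀ (m s : ℕ) (B : Blocks d) (rows : Fin m → Fin d → ℝ) (hist : Fin m → Snapshot d),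
      (∀ i, 1 ≤ i → ((B i).length : ℝ) ≤ L) → hist ∈ (runFrom p β Q m s B rows).support →
      (∀ t i, 1 ≤ i → (((hist t).post i).length : ℝ) ≤ L) →
      ∀ t i, 1 ≤ i → (((hist t).pre i).length : ℝ) ≤ L := by
    intro m
    induction m with
    | zero => intro _ _ _ _ _ _ _ t; exact t.elim0
    | succ m ih =>
      intro s B rows hist hB hh hpost t i hi
      rw [runFrom, PMF.mem_support_bind_iff] at hh
      obtain ⟨z, hz, hh⟩ := hh
      rw [PMF.mem_support_bind_iff] at hh
      obtain ⟨hist', hh', hh⟩ := hh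
      rw [PMF.mem_support_pure_iff] at hh
      subst hh
      have hz' : z.pre = B.push (rows 0) := by
        rw [stage] at hz
        split_ifs at hz
        · rw [PMF.mem_support_bind_iff] at hz
          obtain ⟨B', -, hz⟩ := hz
          rw [PMF.mem_support_pure_iff] at hz
          rw [hz]
        · rw [PMF.mem_support_pure_iff] at hz
          rw [hz]
      induction t using Fin.cases with
      | zero =>
        rw [Fin.cons_zero, hz', Blocks.push_of_ne _ _ (by omega)]
        exact hB i hi
      | succ t =>
        rw [Fin.cons_succ]
        exact ih (s + 1) z.post _ hist' (hpost 0) hh' (fun t i hi => by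
          have := hpost t.succ i hi; rwa [Fin.cons_succ] at this) t i hi
  exact key n 0 _ _ hist (fun _ _ => by simpa using hL) hh h t i hi

end BlockLength

/-! ### The streaming guarantees -/

section Stream

variable {n d : ℕ} {p β Q η δ : ℝ}

/-- What is shown for a snapshot of stage `t`, except for the computation of the estimate. -/
structure StageGood (p η : ℝ) (A : Matrix (Fin n) (Fin d) ℝ) (t : Fin n) (L : ℝ)
    (z : Snapshot d) : Prop where
  lower : (1 - η) * onlineLewisWeight p A t ≤ z.estimate p n
  upper : z.estimate p n ≤ (1 + η) * onlineLewisWeight p A t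
  empty : ∀ i, topIndex n < i → z.pre i = [] ∧ z.post i = []
  pos : 0 < (z.current n).length
  length_le : (z.current n).length ≤ n
  pre_length : ((z.current n).length : ℝ) ≤ L
  post_length : ((z.post.concat (topIndex n + 1)).length : ℝ) ≤ L

theorem topIndex_le (hn : 2 ≤ n) : (topIndex n : ℝ) ≤ 2 * Real.log n := by
  have h1 : 2 ^ topIndex n ≤ n := Nat.pow_log_le_self 2 (by omega)
  have h2 : ((2 : ℝ) ^ topIndex n) ≤ n := by exact_mod_cast h1
  have h3 := Real.log_le_log (by positivity) h2
  rw [Real.log_pow] at h3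
  have := Real.log_two_gt_d9
  nlinarith [Nat.cast_nonneg (α := ℝ) (topIndex n)]

theorem half_le_log (hn : 2 ≤ n) : 1 / 2 ≤ Real.log n := by
  have h1 := Real.log_two_gt_d9
  have h2 : Real.log 2 ≤ Real.log n := Real.log_le_log (by norm_num) (by exact_mod_cast hn)
  linarith

theorem log_le_log_div (hn : 2 ≤ n) (hδ : 0 < δ) (hδ1 : δ < 1) : Real.log n ≤ Real.log (n / δ) := by
  have : (0 : ℝ) < n := by positivity
  exact Real.log_le_log this (by rw [le_div_iff₀ hδ]; nlinarith)

/-- The exponents of the potentials for the chosen parameters. -/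
theorem exponent_bounds {θ e : ℝ} {J : ℕ} (hθ : 0 ≤ θ) (he : 0 ≤ e) (hη : 0 < η) (hη1 : η < 1)
    (heJ : e * J ≤ η / 8) : (1 + e) ^ J ≤ 2 ∧
      θ - upperCoef θ e J * (1 + η / 2) ≤ -(θ * η / 4) ∧
      -θ - lowerCoef θ e J * (1 - η / 2) ≤ -(θ * η / 4) := by
  have h1 : (1 + e) ^ J ≤ Real.exp (η / 8) := by
    calc (1 + e) ^ J ≤ Real.exp e ^ J := by
          gcongr
          rw [add_comm]; exact Real.add_one_le_exp e
      _ = Real.exp (e * J) := by rw [← Real.exp_nat_mul, mul_comm]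
      _ ≤ _ := Real.exp_le_exp.2 heJ
  have h2 : Real.exp (η / 8) * (1 - η / 8) ≤ 1 := by
    have := Real.add_one_le_exp (-(η / 8))
    calc Real.exp (η / 8) * (1 - η / 8) ≤ Real.exp (η / 8) * Real.exp (-(η / 8)) := by
          gcongr; linarith
      _ = 1 := by rw [← Real.exp_add]; simp
  have hpow : 0 < (1 + e) ^ J := by positivity
  -- All levels together cost a factor of at most `1/(1 - η/8) ≤ 1 + η/4`. Of the allowed deviation
  -- `η/2` this leaves a margin `η/4`, which becomes the exponent `θ η / 4`.
  have h3 : (1 + e) ^ J * (1 - η / 8) ≤ 1 := by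
    refine le_trans ?_ h2
    exact mul_le_mul_of_nonneg_right h1 (by linarith)
  have h4 : 1 - η / 8 ≤ ((1 + e) ^ J)⁻¹ := by
    rw [← one_div, le_div_iff₀ hpow]; linarith
  have h5 : (1 + e) ^ J ≤ 1 + η / 4 := by nlinarith
  refine ⟨by linarith, ?_, ?_⟩
  · rw [upperCoef]
    have h6 : 1 + η / 4 ≤ ((1 + e) ^ J)⁻¹ * (1 + η / 2) := by nlinarith
    nlinarith [mul_le_mul_of_nonneg_left h6 hθ]
  · rw [lowerCoef]
    have h6 : (1 + e) ^ J * (1 - η / 2) ≤ 1 - η / 4 := by nlinarith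
    nlinarith [mul_le_mul_of_nonneg_left h6 hθ]

/-- The four extra powers of `n` absorb the union bound, as `3 n² ≤ n⁴` for `n ≥ 2`. -/
theorem exp_neg_mul_log_le {c : ℕ} (hn : 2 ≤ n) (hδ : 0 < δ) (hδ1 : δ < 1) :
    3 * (n : ℝ) ^ 2 * Real.exp (-((c + 4 : ℕ) * Real.log (n / δ))) ≤ δ / (n : ℝ) ^ c := by
  have hn0 : (2 : ℝ) ≤ n := by exact_mod_cast hn
  have hn1 : (0 : ℝ) < n := by linarith
  have e1 : Real.exp (-((c + 4 : ℕ) * Real.log (n / δ))) = δ ^ (c + 4) / (n : ℝ) ^ (c + 4) := by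
    rw [Real.exp_neg, Real.exp_nat_mul, Real.exp_log (by positivity), div_pow, inv_div]
  rw [e1]
  have h1 : δ ^ (c + 4) ≤ δ := by
    calc δ ^ (c + 4) = δ ^ (c + 3) * δ := pow_succ _ _
      _ ≤ 1 * δ := by gcongr; exact pow_le_one₀ hδ.le hδ1.le
      _ = δ := one_mul _
  rw [← mul_div_assoc, div_le_div_iff₀ (by positivity) (by positivity), pow_add (n : ℝ) c 4]
  have h2 : 3 * (n : ℝ) ^ 2 ≤ (n : ℝ) ^ 4 := by nlinarith [sq_nonneg ((n : ℝ) ^ 2 - 4), sq_nonneg (n : ℝ)]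
  calc 3 * (n : ℝ) ^ 2 * δ ^ (c + 4) * n ^ c ≤ (n : ℝ) ^ 4 * δ * n ^ c := by gcongr
    _ = _ := by ring

theorem stageGood_of_balanced (hp : 1 ≤ p) (hp2 : p ≤ 2) (hη : 0 < η) (hη1 : η < 1) (hQ : 1 ≤ Q)
    (hn : n < 2 ^ (topIndex n + 1)) {A : Matrix (Fin n) (Fin d) ℝ} {ℓ : ℝ} (hℓ : 0 ≤ ℓ)
    {hist : Fin n → Snapshot d} (hh : hist ∈ (run p β Q A).support)
    (hpost : ∀ t i, 1 ≤ i → (((hist t).post i).length : ℝ) ≤ ℓ) (t : Fin n)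
    {U : Matrix (Fin d) (Fin d) ℝ}
    {r : Finset (Fin d)} {R : Matrix r (Fin d) ℝ} (hR : Normalizes U R)
    (hw : lewisWeight p (rowsUpTo A t) (Fin.last t.val) = lev U (A t) ^ (p / 2))
    (hbal : Balanced p U R (1 + η / 2) (1 - η / 2) ((hist t).pre.concat (topIndex n + 1)))
    (hdom : ∀ j, ∀ u ∈ (hist t).pre j, Dominated U u) :
    StageGood p η A t (max Q d + 1 + topIndex n * ℓ) (hist t) := by
  have hpre := pre_length_le_of_mem_support_run hℓ hh hpost
  have hsnap := snapshotInv_of_mem_support_run hQ hn hh t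
  obtain ⟨hest1, hest2⟩ := estimate_bounds hp hp2 hR (by linarith) (by linarith) hw
    (fun u hu => by obtain ⟨j, -, hj⟩ := mem_concat hu; exact hdom j u hj) hsnap.getLast hbal
  have hw0 : 0 ≤ onlineLewisWeight p A t := (isLewisWeights_lewisWeight hp hp2 (rowsUpTo A t)).1 _
  generalize hE : lastLewisWeight p ((hist t).pre.concat (topIndex n + 1)) = E at hest1 hest2
  have hE' : (hist t).estimate p n = E := hE
  generalize hW : onlineLewisWeight p A t = W at hw0 hest1 hest2
  -- The estimate is nonnegative because a positive multiple of it is at least the true weight.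
  have hest0 : 0 ≤ E := by
    by_contra hneg
    push Not at hneg
    nlinarith
  refine ⟨?_, ?_, fun i hi => ⟨hsnap.pre.empty i hi, hsnap.post.empty i hi⟩, ?_, ?_, ?_, ?_⟩
  -- Uses `(1 - η)(1 + η/2) ≤ 1`; the other side below uses `(1 + η)(1 - η/2) ≥ 1`, valid for `η ≤
  -- 1`.
  · rw [hE', hW]
    nlinarith [mul_nonneg hη.le hest0, mul_nonneg (mul_nonneg hη.le hη.le) hest0]
  · rw [hE', hW]
    have h1 : (1 + η) * ((1 - η / 2) * E) ≤ (1 + η) * W := by gcongr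
    have h2 : 1 ≤ (1 + η) * (1 - η / 2) := by nlinarith
    nlinarith
  · change 0 < ((hist t).pre.concat (topIndex n + 1)).length
    rw [List.length_pos_iff]
    intro h0
    have := hsnap.getLast
    rw [h0] at this
    simp at this
  · have := hsnap.pre.length
    have := t.isLt
    change ((hist t).pre.concat (topIndex n + 1)).length ≤ n
    omega
  · exact concat_length_le hsnap.zero_length (hpre t) _
  · refine concat_length_le ?_ (hpost t) _
    have := hsnap.post.zero_length
    linarith

-- The choice of the parameters, followed by a union bound over two kinds of failure: unbalanced
-- rows for some target `t`, and an overlong block at some stage.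
set_option maxHeartbeats 800000 in
theorem stream_guarantee (c : ℕ) (hn : 2 ≤ n) (hd : 1 ≤ d) (hp : 1 ≤ p) (hp2 : p ≤ 2) (hη : 0 < η)
    (hη1 : η < 1) (hδ : 0 < δ) (hδ1 : δ < 1)
    (hβ : 1024 * (c + 4) * (η⁻¹ ^ 2 * Real.log (n / δ) * Real.log n ^ 2) ≤ β)
    (hQ : 8 * (η⁻¹ ^ 2 * d * Real.log n ^ 3) ≤ Q) (A : Matrix (Fin n) (Fin d) ℝ) :
    ENNReal.ofReal (1 - δ / (n : ℝ) ^ c) ≤ (run p β Q A).toOuterMeasure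
      {hist | ∀ t : Fin n, StageGood p η A t
        (max Q d + 1 + topIndex n * (2 * (β * d) + (c + 4 : ℕ) * Real.log (n / δ))) (hist t)} := by
  set J := topIndex n with hJ
  set l := Real.log n with hl
  set Λ := Real.log (n / δ) with hΛ
  have hl2 : 1 / 2 ≤ l := half_le_log hn
  have hlΛ : l ≤ Λ := log_le_log_div hn hδ hδ1
  have hJl : (J : ℝ) ≤ 2 * l := topIndex_le hn
  have hnJ : n < 2 ^ (J + 1) := Nat.lt_pow_succ_log_self one_lt_two n
  have hinv : 1 ≤ η⁻¹ ^ 2 := one_le_pow₀ ((one_le_inv₀ hη).2 hη1.le)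
  have hd1 : (1 : ℝ) ≤ d := by exact_mod_cast hd
  -- With `Q ≥ 1`, block `0` has at least two rows whenever it is compressed, as the counter
  -- argument requires. The constant `8` compensates `(log n)³ ≥ 1/8`.
  have hQ1 : 1 ≤ Q := by
    refine le_trans ?_ hQ
    have h1 : (1 / 2 : ℝ) ^ 3 ≤ l ^ 3 := by gcongr
    have h2 : 1 * 1 * (1 / 2 : ℝ) ^ 3 ≤ η⁻¹ ^ 2 * d * l ^ 3 := by gcongr
    linarith
  have hl0 : 0 < l := by linarith
  have hΛ0 : 0 < Λ := by linarith
  have hβ0 : 0 < β := lt_of_lt_of_le (by positivity) hβ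
  -- There are at most `2 l` levels, so the accumulated exponent `e J` is at most `η/8`.
  set e := η / (16 * l) with he
  have he0 : 0 ≤ e := by positivity
  have he1 : e ≤ 1 := by rw [he, div_le_one (by positivity)]; linarith
  have heJ : e * J ≤ η / 8 := by
    calc e * J ≤ e * (2 * l) := by gcongr
      _ = η / 8 := by rw [he]; field_simp; norm_num
  -- Since `(1 + e)^J ≤ 2`, this satisfies the requirement `θ (1 + e)^J ≤ e β / 4` of the sampling
  -- step.
  set θ := e * β / 8 with hθ
  have hθ0 : 0 < θ := by positivity
  obtain ⟨hx1, hx2, hx3⟩ := exponent_bounds hθ0.le he0 hη hη1 heJ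
  have hθe : θ * (1 + e) ^ J ≤ e * β / 4 := by
    calc θ * (1 + e) ^ J ≤ θ * 2 := by gcongr
      _ = _ := by rw [hθ]; ring
  -- Here `θ η / 4 = β η² / (512 l)`; the lower bound for `β` makes it at least `2 (c + 4) Λ l`, and
  -- `2 l ≥ 1`.
  have hθη : ((c + 4 : ℕ) : ℝ) * Λ ≤ θ * η / 4 := by
    have h1 : θ * η / 4 = β * η ^ 2 / (512 * l) := by rw [hθ, he]; field_simp; norm_num
    rw [h1, le_div_iff₀ (by positivity)]
    have h2 : 1024 * (c + 4) * (η⁻¹ ^ 2 * Λ * l ^ 2) * η ^ 2 ≤ β * η ^ 2 := by gcongr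
    have h3 : 1024 * (c + 4) * (η⁻¹ ^ 2 * Λ * l ^ 2) * η ^ 2 = 1024 * (c + 4) * (Λ * l ^ 2) := by
      field_simp
    rw [h3] at h2
    refine le_trans ?_ h2
    push_cast
    have h4 : (c + 4) * Λ * l * 1 ≤ (c + 4) * Λ * l * (2 * l) := by gcongr; linarith
    nlinarith
  set ℓ := 2 * (β * d) + (c + 4 : ℕ) * Λ with hℓ
  have hℓ0 : 0 ≤ ℓ := by positivity
  have hform : ∀ t : Fin n, ∃ U, IsLewisForm p (fun i => rowsUpTo A t i) U ∧
      lewisWeight p (rowsUpTo A t) (Fin.last t.val) = lev U (A t) ^ (p / 2) := fun t => by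
    obtain ⟨U, hU, hw⟩ := exists_lewisForm hp hp2 (rowsUpTo A t)
    exact ⟨U, hU, hw _⟩
  choose U hU hw using hform
  choose s R hR1 hR2 hR3 using fun t => exists_normalizer (hU t).posSemidef
  have hR : ∀ t, Normalizes (U t) (R t) := fun t => ⟨(hU t).posSemidef, hR1 t, hR2 t⟩
  set bad : Fin n → Set (Fin n → Snapshot d) := fun t => {hist |
      ¬ (Balanced p (U t) (R t) (1 + η / 2) (1 - η / 2) ((hist t).pre.concat (J + 1)) ∧
        ∀ j, ∀ u ∈ (hist t).pre j, Dominated (U t) u)} with hbad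
  set long : Set (Fin n → Snapshot d) :=
    {hist | ∃ t : Fin n, ¬ ∀ i, 1 ≤ i → (((hist t).post i).length : ℝ) ≤ ℓ} with hlong
  set q := Real.exp (-((c + 4 : ℕ) * Λ)) with hq
  have hb : ∀ t, (run p β Q A).toOuterMeasure (bad t) ≤ ENNReal.ofReal (n * (2 * q)) := fun t => by
    refine (toOuterMeasure_run_not_balanced_le hp hp2 (hR t) hβ0 hQ1 hθ0 he0 he1 (by linarith) hθe
      hnJ (hU t)).trans (ENNReal.ofReal_le_ofReal ?_)
    rw [two_mul q]
    gcongr <;> rw [hq, Real.exp_le_exp] <;> linarith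
  have hlg : (run p β Q A).toOuterMeasure long ≤ ENNReal.ofReal (n * q) := by
    refine (toOuterMeasure_run_length_le hp hp2 hβ0.le hℓ0 A).trans (le_of_eq ?_)
    rw [ENNReal.ofReal_mul (Nat.cast_nonneg n), ENNReal.ofReal_natCast, hq, hℓ]
    congr 3
    ring
  -- The `n` targets fail with probability at most `2 n q` each, the lengths with at most `n q`;
  -- altogether at most `3 n² q`.
  have htot : (run p β Q A).toOuterMeasure ((⋃ t, bad t) ∪ long) ≤
      ENNReal.ofReal (δ / (n : ℝ) ^ c) := by
    refine (MeasureTheory.measure_union_le _ _).trans ?_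
    refine (add_le_add (MeasureTheory.measure_iUnion_fintype_le _ _) hlg).trans ?_
    refine (add_le_add_left (Finset.sum_le_sum fun t _ => hb t) _).trans ?_
    rw [Finset.sum_const, Finset.card_univ, Fintype.card_fin, nsmul_eq_mul, ← ENNReal.ofReal_natCast,
      ← ENNReal.ofReal_mul (by positivity), ← ENNReal.ofReal_add (by positivity) (by positivity)]
    apply ENNReal.ofReal_le_ofReal
    refine le_trans ?_ (exp_neg_mul_log_le hn hδ hδ1)
    have h1 : (1 : ℝ) ≤ n := by exact_mod_cast (by omega : 1 ≤ n)
    have h2 : 0 < q := Real.exp_pos _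
    have h3 : (n : ℝ) * q ≤ n * n * q := by nlinarith [mul_pos (by linarith : (0 : ℝ) < n) h2]
    calc _ ≤ 2 * (n : ℝ) * n * q + n * n * q := by linarith
      _ = _ := by ring
  rw [ENNReal.ofReal_sub _ (by positivity), ENNReal.ofReal_one]
  refine (tsub_le_tsub_left htot 1).trans (one_sub_le_toOuterMeasure _ fun hist hh hgood t => ?_)
  rw [Set.mem_union, not_or, Set.mem_iUnion, not_exists] at hgood
  obtain ⟨hbal, hdom⟩ := not_not.1 (hgood.1 t)
  refine stageGood_of_balanced hp hp2 hη hη1 hQ1 hnJ hℓ0 hh ?_ t (hR t) (hw t) hbal hdom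
  by_contra hc
  push Not at hc
  obtain ⟨t, i, hi, hlt⟩ := hc
  exact hgood.2 ⟨t, fun h => absurd (h i hi) (not_le.2 hlt)⟩

end Stream

/-! ### Structured programs

Registers below `30` are variables, and the registers `30`, `31`, `32` hold addresses. Register `1`
holds `d`, register `17` holds `1` and register `18` holds `2`. The cells from `2` on are viewed as
rows of length `d`. -/

section Framework

variable {d N : ℕ} {p η : ℝ}

/-- The machine state `s` has the register values `ρ`, the cells `0`, `1` hold `p` and `η`, and the
rows from cell `2` on are those of `V`. -/
structure Sim (d : ℕ) (p η : ℝ) (ρ : ℕ → ℕ) (V : ℕ → ℕ → ℝ) (s : MachineState) : Prop where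
  reg : ∀ x < 30, s.reg x = ρ x
  zero : s.mem 0 = p
  one : s.mem 1 = η
  cell : ∀ R j, j < d → s.mem (2 + (R * d + j)) = V R j

theorem Sim.congr {ρ : ℕ → ℕ} {V V' : ℕ → ℕ → ℝ} {s : MachineState} (h : Sim d p η ρ V s)
    (hV : ∀ R j, j < d → V R j = V' R j) : Sim d p η ρ V' s :=
  ⟨h.reg, h.zero, h.one, fun R j hj => (h.cell R j hj).trans (hV R j hj)⟩

/-- The memory size for `N` rows. -/
def memSize (N d : ℕ) : ℕ := N * d + N + 12

/-- From the registers `ρ` and rows `V`, the program `P` leads, within `T` steps, to the registers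
`ρ` and rows that satisfy `Q`. -/
def Does (N d : ℕ) (p η : ℝ) (P : Program) (T : ℕ) (ρ : ℕ → ℕ) (V : ℕ → ℕ → ℝ)
    (Q : (ℕ → ℕ → ℝ) → Prop) : Prop :=
  ∀ s, Sim d p η ρ V s → ∃ T' s' V', T' ≤ T ∧ Exec (memSize N d) P s T' s' ∧ Sim d p η ρ V' s' ∧ Q V'

theorem Does.mono {P : Program} {T T' : ℕ} {ρ : ℕ → ℕ} {V : ℕ → ℕ → ℝ} {Q Q' : (ℕ → ℕ → ℝ) → Prop}
    (h : Does N d p η P T ρ V Q) (hT : T ≤ T') (hQ : ∀ V', Q V' → Q' V') :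
    Does N d p η P T' ρ V Q' := fun s hs => by
  obtain ⟨T₁, s', V', h1, h2, h3, h4⟩ := h s hs
  exact ⟨T₁, s', V', h1.trans hT, h2, h3, hQ V' h4⟩

theorem Does.seq {P P' : Program} {T T' : ℕ} {ρ : ℕ → ℕ} {V : ℕ → ℕ → ℝ}
    {Q Q' : (ℕ → ℕ → ℝ) → Prop} (h : Does N d p η P T ρ V Q)
    (h' : ∀ V', Q V' → Does N d p η P' T' ρ V' Q') : Does N d p η (.seq P P') (T + T') ρ V Q' :=
  fun s hs => by
  obtain ⟨T₁, s₁, V₁, h1, h2, h3, h4⟩ := h s hs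
  obtain ⟨T₂, s₂, V₂, h5, h6, h7, h8⟩ := h' V₁ h4 s₁ h3
  exact ⟨T₁ + T₂, s₂, V₂, by omega, .seq h2 h6, h7, h8⟩

/-- A straight-line program. -/
def block : List Instr → Program
  | [] => .skip
  | i :: l => .seq (.instr i) (block l)

/-- A memory cell: the row is the sum of the registers `base` and `var`, the column is in `col`. -/
structure Cell where
  base : ℕ
  var : ℕ
  col : ℕ

def Cell.row (c : Cell) (ρ : ℕ → ℕ) : ℕ := ρ c.base + ρ c.var

structure Cell.Ok (N d : ℕ) (ρ : ℕ → ℕ) (c : Cell) : Prop where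
  base : c.base < 30
  var : c.var < 30
  col : c.col < 30
  row_lt : c.row ρ < N
  col_lt : ρ c.col < d

/-- The fixed registers. -/
structure Std (d : ℕ) (ρ : ℕ → ℕ) : Prop where
  dim : ρ 1 = d
  one : ρ 17 = 1
  two : ρ 18 = 2

/-- The address of a cell is computed into register `x`. -/
def addr (x : ℕ) (c : Cell) : Program :=
  block [.plus x c.base c.var, .times x x 1, .plus x x c.col, .plus x x 18]

theorem address_lt {R j : ℕ} (hR : R < N) (hj : j < d) : 2 + (R * d + j) < N * d + 2 := by
  have : (R + 1) * d ≤ N * d := Nat.mul_le_mul_right _ hR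
  rw [add_mul] at this
  omega

theorem exec_addr {ρ : ℕ → ℕ} {s : MachineState} (hs : ∀ x < 30, s.reg x = ρ x) (hρ : Std d ρ)
    {c : Cell} (hc : c.Ok N d ρ) {x : ℕ} (hx : 30 ≤ x) :
    Exec (memSize N d) (addr x c) s 4 (s.setReg x (2 + (c.row ρ * d + ρ c.col))) := by
  have hb := hc.base
  have hv := hc.var
  have hk := hc.col
  have hlt := address_lt hc.row_lt hc.col_lt
  have hr := hc.row_lt
  rw [Cell.row] at *
  have e : s.setReg x (2 + ((ρ c.base + ρ c.var) * d + ρ c.col)) =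
      Instr.effect (Instr.effect (Instr.effect (Instr.effect s (.plus x c.base c.var)) (.times x x 1))
        (.plus x x c.col)) (.plus x x 18) := by
    have h1 : c.col ≠ x := by omega
    have h2 : (1 : ℕ) ≠ x := by omega
    have h3 : (18 : ℕ) ≠ x := by omega
    simp [Instr.effect, MachineState.setReg, Function.update_of_ne, h1, h2, h3, hs _ hb, hs _ hv,
      hs _ hk, hs 1 (by norm_num), hs 18 (by norm_num), hρ.dim, hρ.two, add_comm]
  rw [e]
  have h1 : c.col ≠ x := by omega
  have h2 : (1 : ℕ) ≠ x := by omega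
  have h3 : (18 : ℕ) ≠ x := by omega
  refine .seq (.instr _ _ ?_) (.seq (T' := 2) (.instr _ _ ?_) (.seq (T' := 1) (.instr _ _ ?_)
    (.seq (T' := 0) (.instr _ _ ?_) (.skip _))))
  · simp only [Instr.Legal, memSize, hs _ hb, hs _ hv]
    omega
  all_goals
    simp [Instr.Legal, memSize, Instr.effect, MachineState.setReg, Function.update_of_ne, h1, h2, h3,
      hs _ hb, hs _ hv, hs _ hk, hs 1 (by norm_num), hs 18 (by norm_num), hρ.dim, hρ.two]
    omega

theorem Sim.setReg {ρ : ℕ → ℕ} {V : ℕ → ℕ → ℝ} {s : MachineState} (h : Sim d p η ρ V s) {x : ℕ}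
    (hx : 30 ≤ x) (v : ℕ) : Sim d p η ρ V (s.setReg x v) :=
  ⟨fun y hy => by
    simp only [MachineState.setReg]
    rw [Function.update_of_ne (by omega)]; exact h.reg y hy,
    h.zero, h.one, h.cell⟩

theorem Sim.setVar {ρ : ℕ → ℕ} {V : ℕ → ℕ → ℝ} {s : MachineState} (h : Sim d p η ρ V s) (x v : ℕ) :
    Sim d p η (Function.update ρ x v) V (s.setReg x v) :=
  ⟨fun y hy => by
    rw [MachineState.setReg]
    by_cases hyx : y = x
    · subst hyx; simp
    · simp [Function.update_of_ne hyx, h.reg y hy],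
    h.zero, h.one, h.cell⟩

/-- Uniqueness of division with remainder: different cells have different addresses. -/
theorem address_inj {R R' j j' : ℕ} (hj : j < d) (hj' : j' < d) (h : R * d + j = R' * d + j') :
    R = R' ∧ j = j' := by
  have e : R = R' := by
    rcases lt_trichotomy R R' with hlt | he | hlt
    · have := Nat.mul_le_mul_right d (Nat.succ_le_of_lt hlt)
      rw [Nat.succ_mul] at this
      omega
    · exact he
    · have := Nat.mul_le_mul_right d (Nat.succ_le_of_lt hlt)
      rw [Nat.succ_mul] at this
      omega
  subst e
  exact ⟨rfl, by omega⟩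

/-- The rows `V` with one entry changed. -/
def setCell (V : ℕ → ℕ → ℝ) (R j : ℕ) (v : ℝ) : ℕ → ℕ → ℝ :=
  Function.update V R (Function.update (V R) j v)

theorem Sim.setMem {ρ : ℕ → ℕ} {V : ℕ → ℕ → ℝ} {s : MachineState} (h : Sim d p η ρ V s) {x R j : ℕ}
    (hx : s.reg x = 2 + (R * d + j)) (hj : j < d) (v : ℝ) :
    Sim d p η ρ (setCell V R j v) (s.setMem x v) := by
  refine ⟨h.reg, ?_, ?_, fun R' j' hj' => ?_⟩
  · simp only [MachineState.setMem, hx]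
    rw [Function.update_of_ne (by omega)]; exact h.zero
  · simp only [MachineState.setMem, hx]
    rw [Function.update_of_ne (by omega)]; exact h.one
  · simp only [MachineState.setMem, hx]
    by_cases hR : R' = R ∧ j' = j
    · obtain ⟨rfl, rfl⟩ := hR
      simp [setCell]
    · rw [Function.update_of_ne, h.cell R' j' hj', setCell]
      · by_cases hR' : R' = R
        · subst hR'
          have : j' ≠ j := fun h => hR ⟨rfl, h⟩
          simp [this]
        · simp [hR']
      · intro he
        exact hR (address_inj hj' hj (by omega))

/-- A binary operation of the machine with its meaning. -/
structure IsOp (o : ℕ → ℕ → ℕ → Instr) (f : ℝ → ℝ → ℝ) (D : ℝ → ℝ → Prop) : Prop where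
  effect : ∀ s x y z, (o x y z).effect s = s.setMem x (f (s.read y) (s.read z))
  legal : ∀ S s x y z, s.reg x < S → s.reg y < S → s.reg z < S → D (s.read y) (s.read z) →
    (o x y z).Legal S s

theorem isOp_plus : IsOp .rplus (· + ·) fun _ _ => True :=
  ⟨fun _ _ _ _ => rfl, fun _ _ _ _ _ h1 h2 h3 _ => ⟨h1, h2, h3⟩⟩

theorem isOp_minus : IsOp .rminus (· - ·) fun _ _ => True :=
  ⟨fun _ _ _ _ => rfl, fun _ _ _ _ _ h1 h2 h3 _ => ⟨h1, h2, h3⟩⟩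

theorem isOp_times : IsOp .rtimes (· * ·) fun _ _ => True :=
  ⟨fun _ _ _ _ => rfl, fun _ _ _ _ _ h1 h2 h3 _ => ⟨h1, h2, h3⟩⟩

theorem isOp_div : IsOp .rdiv (· / ·) fun _ b => b ≠ 0 :=
  ⟨fun _ _ _ _ => rfl, fun _ _ _ _ _ h1 h2 h3 h4 => ⟨h1, h2, h3, h4⟩⟩

theorem isOp_pow : IsOp .rpow (fun a b => a ^ b) fun a _ => 0 < a :=
  ⟨fun _ _ _ _ => rfl, fun _ _ _ _ _ h1 h2 h3 h4 => ⟨h1, h2, h3, h4⟩⟩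

theorem Sim.read {ρ : ℕ → ℕ} {V : ℕ → ℕ → ℝ} {s : MachineState} (h : Sim d p η ρ V s) {x R j : ℕ}
    (hx : s.reg x = 2 + (R * d + j)) (hj : j < d) : s.read x = V R j := by
  rw [MachineState.read, hx, h.cell R j hj]

/-- `⟦a⟧ := ⟦b⟧ o ⟦c⟧` -/
def cellOp (o : ℕ → ℕ → ℕ → Instr) (a b c : Cell) : Program :=
  .seq (addr 30 a) (.seq (addr 31 b) (.seq (addr 32 c) (.instr (o 30 31 32))))

theorem Does.cellOp {o : ℕ → ℕ → ℕ → Instr} {f : ℝ → ℝ → ℝ} {D : ℝ → ℝ → Prop} (ho : IsOp o f D)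
    {ρ : ℕ → ℕ} (hρ : Std d ρ) {V : ℕ → ℕ → ℝ} {a b c : Cell} (ha : a.Ok N d ρ) (hb : b.Ok N d ρ)
    (hc : c.Ok N d ρ) (hD : D (V (b.row ρ) (ρ b.col)) (V (c.row ρ) (ρ c.col))) :
    Does N d p η (cellOp o a b c) 13 ρ V fun V' =>
      V' = setCell V (a.row ρ) (ρ a.col) (f (V (b.row ρ) (ρ b.col)) (V (c.row ρ) (ρ c.col))) := by
  intro s hs
  set s₁ := s.setReg 30 (2 + (a.row ρ * d + ρ a.col)) with h1
  set s₂ := s₁.setReg 31 (2 + (b.row ρ * d + ρ b.col)) with h2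
  set s₃ := s₂.setReg 32 (2 + (c.row ρ * d + ρ c.col)) with h3
  have hs1 : Sim d p η ρ V s₁ := hs.setReg (by norm_num) _
  have hs2 : Sim d p η ρ V s₂ := hs1.setReg (by norm_num) _
  have hs3 : Sim d p η ρ V s₃ := hs2.setReg (by norm_num) _
  have r1 : s₃.reg 30 = 2 + (a.row ρ * d + ρ a.col) := by simp [h3, h2, h1, MachineState.setReg]
  have r2 : s₃.reg 31 = 2 + (b.row ρ * d + ρ b.col) := by simp [h3, h2, MachineState.setReg]
  have r3 : s₃.reg 32 = 2 + (c.row ρ * d + ρ c.col) := by simp [h3, MachineState.setReg]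
  have l1 := address_lt ha.row_lt ha.col_lt
  have l2 := address_lt hb.row_lt hb.col_lt
  have l3 := address_lt hc.row_lt hc.col_lt
  have e2 := hs3.read r2 hb.col_lt
  have e3 := hs3.read r3 hc.col_lt
  refine ⟨4 + (4 + (4 + 1)), _, _, by norm_num, .seq (exec_addr hs.reg hρ ha (by norm_num))
    (.seq (exec_addr hs1.reg hρ hb (by norm_num)) (.seq (exec_addr hs2.reg hρ hc (by norm_num))
      (.instr _ _ ?_))), ?_, rfl⟩
  · refine ho.legal _ _ _ _ _ ?_ ?_ ?_ ?_
    · rw [r1, memSize]; omega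
    · rw [r2, memSize]; omega
    · rw [r3, memSize]; omega
    · rw [e2, e3]; exact hD
  · rw [ho.effect, e2, e3]
    exact hs3.setMem r1 ha.col_lt _

/-- `⟦a⟧ := y` for a register `y` -/
def castOp (a : Cell) (y : ℕ) : Program := .seq (addr 30 a) (.instr (.rcast 30 y))

theorem Does.castOp {ρ : ℕ → ℕ} (hρ : Std d ρ) {V : ℕ → ℕ → ℝ} {a : Cell} (ha : a.Ok N d ρ) {y : ℕ}
    (hy : y < 30) : Does N d p η (castOp a y) 5 ρ V fun V' =>
      V' = setCell V (a.row ρ) (ρ a.col) (ρ y) := by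
  intro s hs
  set s₁ := s.setReg 30 (2 + (a.row ρ * d + ρ a.col)) with h1
  have hs1 : Sim d p η ρ V s₁ := hs.setReg (by norm_num) _
  have r1 : s₁.reg 30 = 2 + (a.row ρ * d + ρ a.col) := by simp [h1, MachineState.setReg]
  have l1 := address_lt ha.row_lt ha.col_lt
  refine ⟨4 + 1, _, _, by norm_num, .seq (exec_addr hs.reg hρ ha (by norm_num))
    (.instr _ _ ?_), ?_, rfl⟩
  · simp only [Instr.Legal]
    rw [r1, memSize]; omega
  · rw [← hs1.reg y hy]
    exact hs1.setMem r1 ha.col_lt _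

/-- `⟦a⟧ := ⟦y⟧` for a register `y`; the cell `z` holds `0`. -/
def loadOp (a z : Cell) (y : ℕ) : Program :=
  .seq (addr 30 a) (.seq (addr 31 z) (.instr (.rplus 30 y 31)))

/-- The cells of `p` and `η` lie outside the rows, so they are addressed by a register with value
`0` or `1`. A copy is an addition of `0`. -/
theorem Does.loadOp {ρ : ℕ → ℕ} (hρ : Std d ρ) {V : ℕ → ℕ → ℝ} {a z : Cell} (ha : a.Ok N d ρ)
    (hz : z.Ok N d ρ) (hz0 : V (z.row ρ) (ρ z.col) = 0) {y : ℕ} (hy : y < 30) (hy1 : ρ y < 2) :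
    Does N d p η (loadOp a z y) 9 ρ V fun V' =>
      V' = setCell V (a.row ρ) (ρ a.col) (if ρ y = 0 then p else η) := by
  intro s hs
  set s₁ := s.setReg 30 (2 + (a.row ρ * d + ρ a.col)) with h1
  set s₂ := s₁.setReg 31 (2 + (z.row ρ * d + ρ z.col)) with h2
  have hs1 : Sim d p η ρ V s₁ := hs.setReg (by norm_num) _
  have hs2 : Sim d p η ρ V s₂ := hs1.setReg (by norm_num) _
  have r1 : s₂.reg 30 = 2 + (a.row ρ * d + ρ a.col) := by simp [h1, h2, MachineState.setReg]
  have r2 : s₂.reg 31 = 2 + (z.row ρ * d + ρ z.col) := by simp [h2, MachineState.setReg]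
  have l1 := address_lt ha.row_lt ha.col_lt
  have l2 := address_lt hz.row_lt hz.col_lt
  have e2 := hs2.read r2 hz.col_lt
  have ey : s₂.read y = if ρ y = 0 then p else η := by
    rw [MachineState.read, hs2.reg y hy]
    split_ifs with h
    · rw [h, hs2.zero]
    · rw [(by omega : ρ y = 1), hs2.one]
  refine ⟨4 + (4 + 1), _, _, by norm_num, .seq (exec_addr hs.reg hρ ha (by norm_num))
    (.seq (exec_addr hs1.reg hρ hz (by norm_num)) (.instr _ _ ?_)), ?_, rfl⟩
  · simp only [Instr.Legal]
    rw [r1, r2, hs2.reg y hy, memSize]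
    refine ⟨?_, ?_, ?_⟩ <;> omega
  · have : (Instr.rplus 30 y 31).effect s₂ =
        s₂.setMem 30 (if ρ y = 0 then p else η) := by
      rw [← add_zero (if ρ y = 0 then p else η), ← ey, ← hz0, ← e2]; rfl
    rw [this]
    exact hs2.setMem r1 ha.col_lt _

/-- `for v < b do P`, for registers `v`, `b`; afterwards `v` is `0`. -/
def forLoop (v b : ℕ) (P : Program) : Program :=
  .seq (.while (.lt v b) (.seq P (.instr (.plus v v 17)))) (.instr (.const v 0))

/-- The counter is reset at the end, so a loop leaves the registers `ρ` unchanged and is again of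
the form `Does`; this is what makes loops nest. -/
theorem Does.forLoop {v b : ℕ} {P : Program} {T : ℕ} {ρ : ℕ → ℕ} {V : ℕ → ℕ → ℝ} (hρ : Std d ρ)
    (hv : v < 30) (hb : b < 30) (hv17 : v ≠ 17) (hvb : v ≠ b) (hρv : ρ v = 0) (hbS : ρ b ≤ N)
    (I : ℕ → (ℕ → ℕ → ℝ) → Prop)
    (hP : ∀ k < ρ b, ∀ V, I k V → Does N d p η P T (Function.update ρ v k) V (I (k + 1)))
    (h0 : I 0 V) : Does N d p η (forLoop v b P) (ρ b * (T + 2) + 2) ρ V (I (ρ b)) := by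
  have key : ∀ (j : ℕ) (k : ℕ) (s : MachineState) (V : ℕ → ℕ → ℝ), k + j = ρ b →
      Sim d p η (Function.update ρ v k) V s → I k V →
      ∃ T' s' V', T' ≤ j * (T + 2) + 1 ∧
        Exec (memSize N d) (.while (.lt v b) (.seq P (.instr (.plus v v 17)))) s T' s' ∧
        Sim d p η (Function.update ρ v (ρ b)) V' s' ∧ I (ρ b) V' := by
    intro j
    induction j with
    | zero =>
      intro k s V hk hs hI
      obtain rfl : k = ρ b := by omega
      refine ⟨1, s, V, by omega, .whileFalse trivial ?_, hs, hI⟩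
      simp only [Test.Holds]
      rw [hs.reg v hv, hs.reg b hb, Function.update_self, Function.update_of_ne hvb.symm]
      exact lt_irrefl _
    | succ j ih =>
      intro k s V hk hs hI
      obtain ⟨T₁, s₁, V₁, h1, h2, h3, h4⟩ := hP k (by omega) V hI s hs
      have e : Instr.effect s₁ (.plus v v 17) = s₁.setReg v (k + 1) := by
        simp only [Instr.effect]
        rw [h3.reg v hv, h3.reg 17 (by norm_num), Function.update_self,
          Function.update_of_ne hv17.symm, hρ.one]
      have hs2 : Sim d p η (Function.update ρ v (k + 1)) V₁ (s₁.setReg v (k + 1)) := by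
        have := h3.setVar v (k + 1)
        rwa [Function.update_idem] at this
      obtain ⟨T₂, s₂, V₂, h5, h6, h7, h8⟩ := ih (k + 1) _ V₁ (by omega) hs2 h4
      refine ⟨(T₁ + 1) + T₂ + 1, s₂, V₂, ?_, .whileTrue trivial ?_ (.seq h2 (.instr _ _ ?_)) ?_, h7,
        h8⟩
      · rw [Nat.succ_mul]; omega
      · simp only [Test.Holds]
        rw [hs.reg v hv, hs.reg b hb, Function.update_self, Function.update_of_ne hvb.symm]
        omega
      · simp only [Instr.Legal]
        rw [h3.reg v hv, h3.reg 17 (by norm_num), Function.update_self,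
          Function.update_of_ne hv17.symm, hρ.one, memSize]
        omega
      · rw [e]; exact h6
  intro s hs
  obtain ⟨T', s', V', h1, h2, h3, h4⟩ := key (ρ b) 0 s V (by omega)
    (by rwa [← hρv, Function.update_eq_self]) h0
  refine ⟨T' + 1, _, V', by omega, .seq h2 (.instr _ _ ?_), ?_, h4⟩
  · simp [Instr.Legal, memSize]
  · have := h3.setVar v 0
    rw [Function.update_idem] at this
    nth_rewrite 1 [← hρv] at this
    rwa [Function.update_eq_self] at this

/-- `P` is executed if `⟦c⟧` is positive; the cell `z` holds `0`. -/
def ifPos (z c : Cell) (P : Program) : Program :=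
  .seq (addr 30 z) (.seq (addr 31 c) (.ite (.rlt 30 31) P .skip))

theorem Does.ifPos {P : Program} {T : ℕ} {ρ : ℕ → ℕ} {V : ℕ → ℕ → ℝ} {Q : (ℕ → ℕ → ℝ) → Prop}
    (hρ : Std d ρ) {z c : Cell} (hz : z.Ok N d ρ) (hc : c.Ok N d ρ)
    (hz0 : V (z.row ρ) (ρ z.col) = 0)
    (hpos : 0 < V (c.row ρ) (ρ c.col) → Does N d p η P T ρ V Q)
    (hneg : V (c.row ρ) (ρ c.col) ≤ 0 → Q V) : Does N d p η (ifPos z c P) (T + 9) ρ V Q := by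
  intro s hs
  set s₁ := s.setReg 30 (2 + (z.row ρ * d + ρ z.col)) with h1
  set s₂ := s₁.setReg 31 (2 + (c.row ρ * d + ρ c.col)) with h2
  have hs1 : Sim d p η ρ V s₁ := hs.setReg (by norm_num) _
  have hs2 : Sim d p η ρ V s₂ := hs1.setReg (by norm_num) _
  have r1 : s₂.reg 30 = 2 + (z.row ρ * d + ρ z.col) := by simp [h1, h2, MachineState.setReg]
  have r2 : s₂.reg 31 = 2 + (c.row ρ * d + ρ c.col) := by simp [h2, MachineState.setReg]
  have l1 := address_lt hz.row_lt hz.col_lt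
  have l2 := address_lt hc.row_lt hc.col_lt
  have e1 := hs2.read r1 hz.col_lt
  have e2 := hs2.read r2 hc.col_lt
  have hl : Test.Legal (memSize N d) s₂ (.rlt 30 31) := by
    simp only [Test.Legal]
    rw [r1, r2, memSize]
    exact ⟨by omega, by omega⟩
  have hiff : Test.Holds s₂ (.rlt 30 31) ↔ 0 < V (c.row ρ) (ρ c.col) := by
    simp only [Test.Holds]
    rw [e1, e2, hz0]
  by_cases h : 0 < V (c.row ρ) (ρ c.col)
  · obtain ⟨T', s', V', h3, h4, h5, h6⟩ := hpos h s₂ hs2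
    exact ⟨4 + (4 + (T' + 1)), s', V', by omega, .seq (exec_addr hs.reg hρ hz (by norm_num))
      (.seq (exec_addr hs1.reg hρ hc (by norm_num)) (.iteTrue hl (hiff.2 h) h4)), h5, h6⟩
  · exact ⟨4 + (4 + (0 + 1)), s₂, V, by omega, .seq (exec_addr hs.reg hρ hz (by norm_num))
      (.seq (exec_addr hs1.reg hρ hc (by norm_num)) (.iteFalse hl (fun hh => h (hiff.1 hh))
        (.skip _))), hs2, hneg (not_lt.1 h)⟩

/-- A loop that runs while `⟦x⟧ < ⟦y⟧`, for registers `x`, `y`. -/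
theorem Does.while {x y : ℕ} {P : Program} {T M : ℕ} {ρ : ℕ → ℕ} {V : ℕ → ℕ → ℝ} (hx : x < 30)
    (hy : y < 30) {R R' : ℕ} (hd : 0 < d) (hR : R < N) (hR' : R' < N) (hxR : ρ x = 2 + (R * d + 0))
    (hyR : ρ y = 2 + (R' * d + 0)) (I : ℕ → (ℕ → ℕ → ℝ) → Prop)
    (hP : ∀ k V, I k V → V R 0 < V R' 0 → k < M ∧ Does N d p η P T ρ V (I (k + 1))) (h0 : I 0 V) :
    Does N d p η (.while (.rlt x y) P) (M * (T + 1) + 1) ρ V fun V' =>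
      (∃ k, I k V') ∧ ¬ V' R 0 < V' R' 0 := by
  -- `j` is fuel. When it is exhausted, `k ≥ M`, and the hypothesis `k < M` for active rounds shows
  -- that the test fails.
  have key : ∀ (j k : ℕ) (s : MachineState) (V : ℕ → ℕ → ℝ), M ≤ k + j → Sim d p η ρ V s → I k V →
      ∃ T' s' V', T' ≤ j * (T + 1) + 1 ∧ Exec (memSize N d) (.while (.rlt x y) P) s T' s' ∧
        Sim d p η ρ V' s' ∧ (∃ k, I k V') ∧ ¬ V' R 0 < V' R' 0 := by
    intro j
    induction j with
    | zero =>
      intro k s V hk hs hI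
      have l1 := address_lt hR hd
      have l2 := address_lt hR' hd
      have hl : Test.Legal (memSize N d) s (.rlt x y) := by
        simp only [Test.Legal]
        rw [hs.reg x hx, hs.reg y hy, memSize]
        exact ⟨by omega, by omega⟩
      have hn : ¬ V R 0 < V R' 0 := fun h => by have := (hP k V hI h).1; omega
      refine ⟨1, s, V, by omega, .whileFalse hl ?_, hs, ⟨k, hI⟩, hn⟩
      simp only [Test.Holds]
      rwa [hs.read ((hs.reg x hx).trans hxR) hd, hs.read ((hs.reg y hy).trans hyR) hd]
    | succ j ih =>
      intro k s V hk hs hI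
      have l1 := address_lt hR hd
      have l2 := address_lt hR' hd
      have hl : Test.Legal (memSize N d) s (.rlt x y) := by
        simp only [Test.Legal]
        rw [hs.reg x hx, hs.reg y hy, memSize]
        exact ⟨by omega, by omega⟩
      have hiff : Test.Holds s (.rlt x y) ↔ V R 0 < V R' 0 := by
        simp only [Test.Holds]
        rw [hs.read ((hs.reg x hx).trans hxR) hd, hs.read ((hs.reg y hy).trans hyR) hd]
      by_cases h : V R 0 < V R' 0
      · obtain ⟨T₁, s₁, V₁, h1, h2, h3, h4⟩ := (hP k V hI h).2 s hs
        obtain ⟨T₂, s₂, V₂, h5, h6, h7, h8⟩ := ih (k + 1) s₁ V₁ (by omega) h3 h4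
        exact ⟨T₁ + T₂ + 1, s₂, V₂, by rw [Nat.succ_mul]; omega,
          .whileTrue hl (hiff.2 h) h2 h6, h7, h8⟩
      · exact ⟨1, s, V, by omega, .whileFalse hl (fun hh => h (hiff.1 hh)), hs, ⟨k, hI⟩, h⟩
  intro s hs
  exact key M 0 s V (by omega) hs h0

/-- `⟦a_j⟧ := ⟦b_j⟧ o ⟦c_j⟧` for all columns `j`, register `13`. -/
def rowOp (o : ℕ → ℕ → ℕ → Instr) (a b c : Cell) : Program := forLoop 13 1 (cellOp o a b c)

/-- The column of a cell when register `13` is `j`. -/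
def Cell.colAt (c : Cell) (ρ : ℕ → ℕ) (j : ℕ) : ℕ := if c.col = 13 then j else ρ c.col

/-- The row of a cell does not depend on register `13`, and all columns are legal. -/
structure Cell.RowOk (N d : ℕ) (ρ : ℕ → ℕ) (c : Cell) : Prop where
  base : c.base < 30 ∧ c.base ≠ 13
  var : c.var < 30 ∧ c.var ≠ 13
  col : c.col < 30
  row_lt : c.row ρ < N
  col_lt : c.col ≠ 13 → ρ c.col < d

theorem Cell.RowOk.row_update {ρ : ℕ → ℕ} {c : Cell} (h : c.RowOk N d ρ) (j : ℕ) :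
    c.row (Function.update ρ 13 j) = c.row ρ := by
  rw [Cell.row, Function.update_of_ne h.base.2, Function.update_of_ne h.var.2, Cell.row]

theorem Cell.RowOk.col_update {ρ : ℕ → ℕ} {c : Cell} (j : ℕ) :
    Function.update ρ 13 j c.col = c.colAt ρ j := by
  rw [Cell.colAt]
  split_ifs with hc
  · rw [hc, Function.update_self]
  · rw [Function.update_of_ne hc]

theorem Cell.RowOk.ok {ρ : ℕ → ℕ} {c : Cell} (h : c.RowOk N d ρ) {j : ℕ} (hj : j < d) :
    c.Ok N d (Function.update ρ 13 j) := by
  refine ⟨h.base.1, h.var.1, h.col, ?_, ?_⟩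
  · rw [h.row_update]; exact h.row_lt
  · rw [Cell.RowOk.col_update, Cell.colAt]
    split_ifs with hc
    · exact hj
    · exact h.col_lt hc

/-- An operand in the row being overwritten is allowed only in the running column, which is read
before it is changed; `hab` and `hac` express this. -/
theorem Does.rowOp {o : ℕ → ℕ → ℕ → Instr} {f : ℝ → ℝ → ℝ} {D : ℝ → ℝ → Prop} (ho : IsOp o f D)
    {ρ : ℕ → ℕ} (hρ : Std d ρ) (h13 : ρ 13 = 0) (hdN : d ≤ N) {V : ℕ → ℕ → ℝ} {a b c : Cell}
    {Q : (ℕ → ℕ → ℝ) → Prop} (ha : a.RowOk N d ρ) (hb : b.RowOk N d ρ) (hc : c.RowOk N d ρ)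
    (ha13 : a.col = 13) (hab : a.row ρ ≠ b.row ρ ∨ b.col = 13) (hac : a.row ρ ≠ c.row ρ ∨ c.col = 13)
    (hD : ∀ j < d, D (V (b.row ρ) (b.colAt ρ j)) (V (c.row ρ) (c.colAt ρ j)))
    (hQ : Q (Function.update V (a.row ρ) fun j =>
      f (V (b.row ρ) (b.colAt ρ j)) (V (c.row ρ) (c.colAt ρ j)))) :
    Does N d p η (rowOp o a b c) (15 * d + 2) ρ V Q := by
  set g : ℕ → ℝ := fun j => f (V (b.row ρ) (b.colAt ρ j)) (V (c.row ρ) (c.colAt ρ j)) with hg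
  set F : ℕ → ℕ → ℕ → ℝ := fun k =>
    Function.update V (a.row ρ) fun j => if j < k then g j else V (a.row ρ) j with hF
  have hread : ∀ k (x : Cell), (a.row ρ ≠ x.row ρ ∨ x.col = 13) →
      F k (x.row ρ) (x.colAt ρ k) = V (x.row ρ) (x.colAt ρ k) := by
    intro k x hx
    by_cases he : x.row ρ = a.row ρ
    · have h13 : x.col = 13 := hx.resolve_left fun h => h he.symm
      simp [hF, he, Cell.colAt, h13]
    · simp [hF, Function.update_of_ne he]
  have hloop := Does.forLoop (N := N) (p := p) (η := η) (v := 13) (b := 1) (T := 13)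
    (P := OnlineLewis.cellOp o a b c) (V := V) hρ (by norm_num)
    (by norm_num) (by norm_num) (by norm_num) h13 (by rw [hρ.dim]; exact hdN)
    (fun k V' => V' = F k) (fun k hk V' hV' => by
      subst hV'
      rw [hρ.dim] at hk
      have hρ' : Std d (Function.update ρ 13 k) := ⟨by simpa using hρ.dim, by simpa using hρ.one,
        by simpa using hρ.two⟩
      refine (Does.cellOp ho hρ' (ha.ok hk) (hb.ok hk) (hc.ok hk) ?_).mono le_rfl fun V' hV' => ?_
      · rw [hb.row_update, hc.row_update, Cell.RowOk.col_update, Cell.RowOk.col_update,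
          hread k b hab, hread k c hac]
        exact hD k hk
      · rw [hV', ha.row_update, hb.row_update, hc.row_update, Cell.RowOk.col_update,
          Cell.RowOk.col_update, Cell.RowOk.col_update, hread k b hab, hread k c hac]
        have : a.colAt ρ k = k := by simp [Cell.colAt, ha13]
        rw [this]
        change setCell (F k) (a.row ρ) k (g k) = F (k + 1)
        rw [setCell, hF]
        simp only [Function.update_self, Function.update_idem]
        congr 1
        ext j
        by_cases hjk : j = k
        · subst hjk; simp
        · rw [Function.update_of_ne hjk]
          have : j < k ↔ j < k + 1 := by omega
          simp [this]) (by simp [hF])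
  intro s hs
  obtain ⟨T', s', V', h1, h2, h3, h4⟩ := hloop s hs
  rw [hρ.dim] at h4 h1
  subst h4
  -- `Sim` ignores the columns from `d` on, so the result may be described as an update of the full
  -- row.
  refine ⟨T', s', _, by omega, h2, h3.congr fun R j hj => ?_, hQ⟩
  by_cases he : R = a.row ρ
  · subst he; simp [hF, hj, hg]
  · simp [hF, Function.update_of_ne he]

end Framework

/-! ### The program

For `m` rows, the rows of memory are used as follows: the input, `m` work copies of it, `d` rows of
a form `U`, `m + d` rows for leverages, `m` rows for the coefficients of `U`, and ten scratch rows. -/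

/-- The registers. -/
def env (m d k r j : ℕ) : ℕ → ℕ
  | 0 => m
  | 1 => d
  | 2 => m + d
  | 5 => m
  | 6 => 2 * m
  | 7 => 2 * m + d
  | 8 => 3 * m + 2 * d
  | 9 => 4 * m + 2 * d
  | 10 => m - 1
  | 11 => k
  | 12 => r
  | 13 => j
  -- The addresses of the threshold and (next line) of the error bound, which the main loop
  -- compares.
  | 14 => 2 + ((4 * m + 2 * d + 6) * d + 0)
  | 15 => 2 + ((4 * m + 2 * d + 5) * d + 0)
  | 17 => 1
  | 18 => 2
  | 19 => 3
  | 20 => 4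
  | 21 => 5
  | 22 => 6
  | 23 => 7
  | 24 => 8
  | 25 => 9
  -- In particular register `16` is `0`; it serves as the column `0` and as a vanishing base.
  | _ => 0

theorem update_env_eleven (m d k k' r j : ℕ) :
    Function.update (env m d k r j) 11 k' = env m d k' r j := by
  funext x
  by_cases hx : x = 11
  · subst hx; rw [Function.update_self]; rfl
  · rw [Function.update_of_ne hx]
    unfold env
    split <;> first | rfl | exact absurd rfl hx

theorem update_env_twelve (m d k r r' j : ℕ) :
    Function.update (env m d k r j) 12 r' = env m d k r' j := by
  funext x
  by_cases hx : x = 12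
  · subst hx; rw [Function.update_self]; rfl
  · rw [Function.update_of_ne hx]
    unfold env
    split <;> first | rfl | exact absurd rfl hx

theorem std_env (m d k r j : ℕ) : Std d (env m d k r j) := ⟨rfl, rfl, rfl⟩

/-- The number of rows of memory. -/
def rowCount (m d : ℕ) : ℕ := 4 * m + 2 * d + 10

section Phases

variable {m d k r : ℕ} {p η : ℝ} {V : ℕ → ℕ → ℝ}

/-- The registers of a cell in a row operation. -/
abbrev Cell.Regs (c : Cell) : Prop :=
  (c.base < 30 ∧ c.base ≠ 13) ∧ (c.var < 30 ∧ c.var ≠ 13) ∧ c.col < 30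

/-- The version of `Does.rowOp` for the register contents `env`, with explicit row numbers so that
the side conditions become decidable or linear. -/
theorem doesRow {o : ℕ → ℕ → ℕ → Instr} {f : ℝ → ℝ → ℝ} {D : ℝ → ℝ → Prop} (ho : IsOp o f D)
    {a b c : Cell} {Ra Rb Rc : ℕ} {jb jc : ℕ → ℕ}
    (hregs : a.Regs ∧ b.Regs ∧ c.Regs ∧ a.col = 13)
    (ha : a.row (env m d k r 0) = Ra) (hb : b.row (env m d k r 0) = Rb)
    (hc : c.row (env m d k r 0) = Rc)
    (hN : Ra < rowCount m d ∧ Rb < rowCount m d ∧ Rc < rowCount m d)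
    (hjb : ∀ j, b.colAt (env m d k r 0) j = jb j) (hjc : ∀ j, c.colAt (env m d k r 0) j = jc j)
    (hjd : ∀ j < d, jb j < d ∧ jc j < d) (hd : 0 < d)
    (hab : Ra ≠ Rb ∨ b.col = 13) (hac : Ra ≠ Rc ∨ c.col = 13)
    (hD : ∀ j < d, D (V Rb (jb j)) (V Rc (jc j))) :
    Does (rowCount m d) d p η (rowOp o a b c) (15 * d + 2) (env m d k r 0) V fun V' =>
      V' = Function.update V Ra fun j => f (V Rb (jb j)) (V Rc (jc j)) := by
  subst ha hb hc
  obtain ⟨hra, hrb, hrc, hcol⟩ := hregs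
  have e : ∀ (x : Cell), x.col ≠ 13 → ∀ j, x.colAt (env m d k r 0) j = env m d k r 0 x.col :=
    fun x hx j => if_neg hx
  refine Does.rowOp ho (std_env m d k r 0) rfl (by rw [rowCount]; omega)
    ⟨hra.1, hra.2.1, hra.2.2, hN.1, fun h => absurd hcol h⟩
    ⟨hrb.1, hrb.2.1, hrb.2.2, hN.2.1, fun h => ?_⟩ ⟨hrc.1, hrc.2.1, hrc.2.2, hN.2.2, fun h => ?_⟩
    hcol hab hac ?_ ?_
  · rw [← e b h 0, hjb]; exact (hjd 0 hd).1
  · rw [← e c h 0, hjc]; exact (hjd 0 hd).2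
  · simpa only [hjb, hjc] using hD
  · simp only [hjb, hjc]

/-- A loop over register `11`. -/
theorem doesOuter {b : ℕ} {P : Program} {T M : ℕ} (hb : b < 30 ∧ b ≠ 11)
    (hM : env m d 0 0 0 b = M) (hMN : M ≤ rowCount m d) (I : ℕ → (ℕ → ℕ → ℝ) → Prop)
    (hP : ∀ k < M, ∀ V, I k V → Does (rowCount m d) d p η P T (env m d k 0 0) V (I (k + 1)))
    (h0 : I 0 V) :
    Does (rowCount m d) d p η (forLoop 11 b P) (M * (T + 2) + 2) (env m d 0 0 0) V (I M) := by
  subst hM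
  refine Does.forLoop (std_env m d 0 0 0) (by norm_num) hb.1 (by norm_num) hb.2.symm rfl hMN I ?_ h0
  intro k hk V hV
  rw [update_env_eleven]
  exact hP k hk V hV

/-- A loop over register `12`. -/
theorem doesInner {b : ℕ} {P : Program} {T M : ℕ} (hb : b < 30 ∧ b ≠ 12)
    (hM : env m d k 0 0 b = M) (hMN : M ≤ rowCount m d) (I : ℕ → (ℕ → ℕ → ℝ) → Prop)
    (hP : ∀ r < M, ∀ V, I r V → Does (rowCount m d) d p η P T (env m d k r 0) V (I (r + 1)))
    (h0 : I 0 V) :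
    Does (rowCount m d) d p η (forLoop 12 b P) (M * (T + 2) + 2) (env m d k 0 0) V (I M) := by
  subst hM
  refine Does.forLoop (std_env m d k 0 0) (by norm_num) hb.1 (by norm_num) hb.2.symm rfl hMN I ?_ h0
  intro r hr V hV
  rw [update_env_twelve]
  exact hP r hr V hV

theorem doesIfPos {P : Program} {T : ℕ} {Q : (ℕ → ℕ → ℝ) → Prop} {c : Cell} {R j : ℕ} (hd : 0 < d)
    (hregs : c.base < 30 ∧ c.var < 30 ∧ c.col < 30) (hR : c.row (env m d k r 0) = R)
    (hj : env m d k r 0 c.col = j) (hRN : R < rowCount m d) (hjd : j < d)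
    (hz : V (4 * m + 2 * d + 1) 0 = 0)
    (hpos : 0 < V R j → Does (rowCount m d) d p η P T (env m d k r 0) V Q)
    (hneg : V R j ≤ 0 → Q V) :
    Does (rowCount m d) d p η (ifPos ⟨9, 17, 16⟩ c P) (T + 9) (env m d k r 0) V Q := by
  subst hR hj
  refine Does.ifPos (std_env m d k r 0) ⟨by norm_num, by norm_num, by norm_num, ?_, hd⟩
    ⟨hregs.1, hregs.2.1, hregs.2.2, hRN, hjd⟩ hz hpos hneg
  change 4 * m + 2 * d + 1 < _
  rw [rowCount]; omega

/-- The input is copied. -/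
def copyRows : Program := forLoop 12 0 (rowOp .rplus ⟨5, 12, 13⟩ ⟨16, 12, 13⟩ ⟨9, 17, 16⟩)

/-- Elimination destroys the rows it works on, and the input is needed again in the next iteration.
-/
theorem does_copyRows (hd : 0 < d) (hz : V (4 * m + 2 * d + 1) 0 = 0) :
    Does (rowCount m d) d p η copyRows (m * (15 * d + 4) + 2) (env m d 0 0 0) V fun V' =>
      (∀ r < m, V' (m + r) = V r) ∧ ∀ R, R < m ∨ 2 * m ≤ R → V' R = V R := by
  refine (doesInner (T := 15 * d + 2) (M := m) (by decide) rfl (by rw [rowCount]; omega)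
    (fun r V' => (∀ i < r, V' (m + i) = V i) ∧ ∀ R, R < m ∨ m + r ≤ R → V' R = V R)
    (fun r hr V₁ hV₁ => ?_) ⟨fun i hi => by omega, fun _ _ => rfl⟩).mono le_rfl
    fun V' hV' => ⟨hV'.1, fun R hR => hV'.2 R (by omega)⟩
  refine (doesRow (Ra := m + r) (Rb := r) (Rc := 4 * m + 2 * d + 1) (jb := id) (jc := fun _ => 0)
    isOp_plus (by decide) rfl (by exact zero_add r) rfl (by rw [rowCount]; omega) (fun _ => rfl) (fun _ => rfl)
    (fun j hj => ⟨hj, hd⟩) hd (by omega) (by omega) fun _ _ => trivial).mono le_rfl fun V' hV' => ?_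
  have e1 : V₁ (4 * m + 2 * d + 1) 0 = 0 := by rw [hV₁.2 _ (by omega), hz]
  have e2 : V₁ r = V r := hV₁.2 r (by omega)
  have e3 : V' = Function.update V₁ (m + r) (V r) := by simpa [e1, e2] using hV'
  rw [e3]
  refine ⟨fun i hi => ?_, fun R hR => ?_⟩
  · by_cases h : i = r
    · subst h; rw [Function.update_self]
    · rw [Function.update_of_ne (by omega)]; exact hV₁.1 i (by omega)
  · rw [Function.update_of_ne (by omega)]; exact hV₁.2 R (by omega)

/-- Rows are set to zero: those of `U` if `b = 6`, `c = 1`, and the leverages if `b = 7`, `c = 0`. -/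
def clearRows (b c : ℕ) : Program := forLoop 12 c (rowOp .rplus ⟨b, 12, 13⟩ ⟨9, 17, 16⟩ ⟨9, 17, 16⟩)

theorem does_clearRows {b c B M : ℕ} (hbc : (b < 30 ∧ b ≠ 13) ∧ c < 30 ∧ c ≠ 12)
    (hB : ∀ r, env m d 0 r 0 b = B) (hM : env m d 0 0 0 c = M) (hBM : B + M ≤ 4 * m + 2 * d)
    (hd : 0 < d) (hz : V (4 * m + 2 * d + 1) 0 = 0) :
    Does (rowCount m d) d p η (clearRows b c) (M * (15 * d + 4) + 2) (env m d 0 0 0) V fun V' =>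
      (∀ r < M, V' (B + r) = 0) ∧ ∀ R, R < B ∨ B + M ≤ R → V' R = V R := by
  refine doesInner (T := 15 * d + 2) (M := M) hbc.2 hM (by rw [rowCount]; omega)
    (fun r V' => (∀ i < r, V' (B + i) = 0) ∧ ∀ R, R < B ∨ B + r ≤ R → V' R = V R)
    (fun r hr V₁ hV₁ => ?_) ⟨fun i hi => by omega, fun _ _ => rfl⟩
  refine (doesRow (Ra := B + r) (Rb := 4 * m + 2 * d + 1) (Rc := 4 * m + 2 * d + 1)
    (jb := fun _ => 0) (jc := fun _ => 0)
    isOp_plus ⟨⟨hbc.1, (by decide : 12 < 30 ∧ 12 ≠ 13), (by decide : 13 < 30)⟩, by decide, by decide, rfl⟩ (by rw [Cell.row, hB]; rfl) rfl rfl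
    (by rw [rowCount]; omega) (fun _ => rfl) (fun _ => rfl)
    (fun j hj => ⟨hd, hd⟩) hd (by omega) (by omega) fun _ _ => trivial).mono le_rfl fun V' hV' => ?_
  have e1 : V₁ (4 * m + 2 * d + 1) 0 = 0 := by rw [hV₁.2 _ (by omega), hz]
  have e3 : V' = Function.update V₁ (B + r) 0 := by
    rw [hV']; congr 1; funext j; simp [e1]
  rw [e3]
  refine ⟨fun i hi => ?_, fun R hR => ?_⟩
  · by_cases h : i = r
    · subst h; rw [Function.update_self]
    · rw [Function.update_of_ne (by omega)]; exact hV₁.1 i (by omega)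
  · rw [Function.update_of_ne (by omega)]; exact hV₁.2 R (by omega)

/-- The form `U` is computed from its coefficients. -/
def accumulate : Program :=
  forLoop 11 0 (.seq (rowOp .rtimes ⟨9, 23, 13⟩ ⟨8, 11, 16⟩ ⟨16, 11, 13⟩)
    (forLoop 12 1 (.seq (rowOp .rtimes ⟨9, 24, 13⟩ ⟨9, 23, 12⟩ ⟨16, 11, 13⟩)
      (rowOp .rplus ⟨6, 12, 13⟩ ⟨6, 12, 13⟩ ⟨9, 24, 13⟩))))

/-- For row `k`, the scratch row `7` holds `c_k a_k`, and the scratch row `8` holds the part of `c_k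
a_k a_kᵀ` that belongs to row `r` of the form. -/
theorem does_accumulate (hd : 0 < d) :
    Does (rowCount m d) d p η accumulate
      (m * ((15 * d + 2) + (d * (((15 * d + 2) + (15 * d + 2)) + 2) + 2) + 2) + 2) (env m d 0 0 0) V
      fun V' => (∀ r < d, V' (2 * m + r) = fun j => V (2 * m + r) j +
          ∑ i ∈ Finset.range m, V (3 * m + 2 * d + i) 0 * V i r * V i j) ∧
        ∀ R, R < 2 * m ∨ 2 * m + d ≤ R ∧ R ≠ 4 * m + 2 * d + 7 ∧ R ≠ 4 * m + 2 * d + 8 →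
          V' R = V R := by
  refine doesOuter (M := m) (by decide) rfl (by rw [rowCount]; omega)
    (fun k V' => (∀ r < d, V' (2 * m + r) = fun j => V (2 * m + r) j +
        ∑ i ∈ Finset.range k, V (3 * m + 2 * d + i) 0 * V i r * V i j) ∧
      ∀ R, R < 2 * m ∨ 2 * m + d ≤ R ∧ R ≠ 4 * m + 2 * d + 7 ∧ R ≠ 4 * m + 2 * d + 8 →
        V' R = V R) (fun k hk V₁ hV₁ => ?_) ⟨fun i hi => by simp, fun _ _ => rfl⟩
  have a1 : V₁ k = V k := hV₁.2 k (by omega)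
  have a2 : V₁ (3 * m + 2 * d + k) = V (3 * m + 2 * d + k) := hV₁.2 _ (by omega)
  refine Does.seq (doesRow (Ra := 4 * m + 2 * d + 7) (Rb := 3 * m + 2 * d + k) (Rc := k)
    (jb := fun _ => 0) (jc := id) isOp_times (by decide) rfl rfl (zero_add k)
    (by rw [rowCount]; omega) (fun _ => rfl) (fun _ => rfl) (fun j hj => ⟨hd, hj⟩) hd (by omega)
    (by omega) fun _ _ => trivial) fun V₂ hV₂ => ?_
  rw [a1, a2] at hV₂
  have b0 : ∀ R, R ≠ 4 * m + 2 * d + 7 → V₂ R = V₁ R := fun R hR => by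
    rw [hV₂, Function.update_of_ne hR]
  have b7 : V₂ (4 * m + 2 * d + 7) = fun j => V (3 * m + 2 * d + k) 0 * V k j := by
    rw [hV₂, Function.update_self]; rfl
  refine (doesInner (M := d) (by decide) rfl (by rw [rowCount]; omega)
    (fun r V' => (∀ i < r, V' (2 * m + i) = fun j => V₂ (2 * m + i) j +
        V (3 * m + 2 * d + k) 0 * V k i * V k j) ∧
      ∀ R, R < 2 * m ∨ 2 * m + r ≤ R ∧ R ≠ 4 * m + 2 * d + 8 → V' R = V₂ R)
    (fun r hr V₃ hV₃ => ?_) ⟨fun i hi => by omega, fun _ _ => rfl⟩).mono le_rfl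
    fun V' hV' => ⟨fun r hr => ?_, fun R hR => ?_⟩
  · have c7 : V₃ (4 * m + 2 * d + 7) = fun j => V (3 * m + 2 * d + k) 0 * V k j := by
      rw [hV₃.2 _ (by omega), b7]
    have ck : V₃ k = V k := by rw [hV₃.2 _ (by omega), b0 _ (by omega), a1]
    refine Does.seq (doesRow (Ra := 4 * m + 2 * d + 8) (Rb := 4 * m + 2 * d + 7) (Rc := k)
      (jb := fun _ => r) (jc := id) isOp_times (by decide) rfl rfl (zero_add k)
      (by rw [rowCount]; omega) (fun _ => rfl) (fun _ => rfl) (fun j hj => ⟨hr, hj⟩) hd (by omega)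
      (by omega) fun _ _ => trivial) fun V₄ hV₄ => ?_
    rw [c7, ck] at hV₄
    have d0 : ∀ R, R ≠ 4 * m + 2 * d + 8 → V₄ R = V₃ R := fun R hR => by
      rw [hV₄, Function.update_of_ne hR]
    have d8 : V₄ (4 * m + 2 * d + 8) = fun j => V (3 * m + 2 * d + k) 0 * V k r * V k j := by
      rw [hV₄, Function.update_self]; rfl
    refine (doesRow (Ra := 2 * m + r) (Rb := 2 * m + r) (Rc := 4 * m + 2 * d + 8)
      (jb := id) (jc := id) isOp_plus (by decide) rfl rfl rfl
      (by rw [rowCount]; omega) (fun _ => rfl) (fun _ => rfl) (fun j hj => ⟨hj, hj⟩) hd (.inr rfl)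
      (by omega) fun _ _ => trivial).mono le_rfl fun V₅ hV₅ => ?_
    rw [d0 _ (by omega), hV₃.2 (2 * m + r) (by omega), d8] at hV₅
    rw [hV₅]
    refine ⟨fun i hi => ?_, fun R hR => ?_⟩
    · by_cases h : i = r
      · subst h; rw [Function.update_self]; rfl
      · rw [Function.update_of_ne (by omega), d0 _ (by omega)]; exact hV₃.1 i (by omega)
    · rw [Function.update_of_ne (by omega), d0 _ (by omega)]; exact hV₃.2 R (by omega)
  · rw [hV'.1 r hr, b0 _ (by omega), hV₁.1 r hr]
    funext j
    rw [Finset.sum_range_succ]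
    ring
  · rw [hV'.2 R (by omega), b0 _ (by omega), hV₁.2 R hR]

/-- A multiple of the pivot row is subtracted from a row, and its leverage is updated. -/
def eliminateRow : Program :=
  .seq (rowOp .rdiv ⟨9, 23, 13⟩ ⟨5, 12, 11⟩ ⟨9, 16, 11⟩)
    (.seq (rowOp .rtimes ⟨9, 24, 13⟩ ⟨9, 23, 16⟩ ⟨5, 12, 11⟩)
      (.seq (rowOp .rplus ⟨7, 12, 13⟩ ⟨7, 12, 13⟩ ⟨9, 24, 16⟩)
        (.seq (rowOp .rtimes ⟨9, 24, 13⟩ ⟨9, 23, 16⟩ ⟨9, 16, 13⟩)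
          (rowOp .rminus ⟨5, 12, 13⟩ ⟨5, 12, 13⟩ ⟨9, 24, 13⟩))))

/-- The leverage is updated before the subtraction, since its increment needs the entry in column
`k` that the subtraction cancels. -/
theorem does_eliminateRow (hk : k < d) (hr : r < m + d) (hpiv : V (4 * m + 2 * d) k ≠ 0) :
    Does (rowCount m d) d p η eliminateRow (5 * (15 * d + 2)) (env m d k r 0) V fun V' =>
      (V' (m + r) = fun j => V (m + r) j -
        V (m + r) k / V (4 * m + 2 * d) k * V (4 * m + 2 * d) j) ∧
      (V' (2 * m + d + r) = fun j => V (2 * m + d + r) j +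
        V (m + r) k / V (4 * m + 2 * d) k * V (m + r) k) ∧
      ∀ R, R ≠ m + r → R ≠ 2 * m + d + r → R ≠ 4 * m + 2 * d + 7 → R ≠ 4 * m + 2 * d + 8 →
        V' R = V R := by
  have hd : 0 < d := by omega
  refine (Does.seq (doesRow (Ra := 4 * m + 2 * d + 7) (Rb := m + r) (Rc := 4 * m + 2 * d)
    (jb := fun _ => k) (jc := fun _ => k) isOp_div (by decide) rfl rfl rfl
    (by rw [rowCount]; omega) (fun _ => rfl) (fun _ => rfl) (fun j hj => ⟨hk, hk⟩) hd (by omega)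
    (by omega) fun _ _ => hpiv) fun V₁ hV₁ => ?_).mono
    (by omega : (15 * d + 2) + ((15 * d + 2) + ((15 * d + 2) + ((15 * d + 2) + (15 * d + 2)))) ≤ _)
    fun _ h => h
  have b0 : ∀ R, R ≠ 4 * m + 2 * d + 7 → V₁ R = V R := fun R hR => by
    rw [hV₁, Function.update_of_ne hR]
  have b7 : V₁ (4 * m + 2 * d + 7) = fun _ => V (m + r) k / V (4 * m + 2 * d) k := by
    rw [hV₁, Function.update_self]
  refine Does.seq (doesRow (Ra := 4 * m + 2 * d + 8) (Rb := 4 * m + 2 * d + 7) (Rc := m + r)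
    (jb := fun _ => 0) (jc := fun _ => k) isOp_times (by decide) rfl rfl rfl
    (by rw [rowCount]; omega) (fun _ => rfl) (fun _ => rfl) (fun j hj => ⟨hd, hk⟩) hd (by omega)
    (by omega) fun _ _ => trivial) fun V₂ hV₂ => ?_
  rw [b7, b0 (m + r) (by omega)] at hV₂
  have c0 : ∀ R, R ≠ 4 * m + 2 * d + 8 → V₂ R = V₁ R := fun R hR => by
    rw [hV₂, Function.update_of_ne hR]
  have c8 : V₂ (4 * m + 2 * d + 8) = fun _ => V (m + r) k / V (4 * m + 2 * d) k * V (m + r) k := by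
    rw [hV₂, Function.update_self]
  refine Does.seq (doesRow (Ra := 2 * m + d + r) (Rb := 2 * m + d + r) (Rc := 4 * m + 2 * d + 8)
    (jb := id) (jc := fun _ => 0) isOp_plus (by decide) rfl rfl rfl
    (by rw [rowCount]; omega) (fun _ => rfl) (fun _ => rfl) (fun j hj => ⟨hj, hd⟩) hd (.inr rfl)
    (by omega) fun _ _ => trivial) fun V₃ hV₃ => ?_
  rw [c8, c0 (2 * m + d + r) (by omega), b0 (2 * m + d + r) (by omega)] at hV₃
  have d0 : ∀ R, R ≠ 2 * m + d + r → V₃ R = V₂ R := fun R hR => by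
    rw [hV₃, Function.update_of_ne hR]
  have d1 : V₃ (2 * m + d + r) = fun j => V (2 * m + d + r) j +
      V (m + r) k / V (4 * m + 2 * d) k * V (m + r) k := by
    rw [hV₃, Function.update_self]; rfl
  refine Does.seq (doesRow (Ra := 4 * m + 2 * d + 8) (Rb := 4 * m + 2 * d + 7) (Rc := 4 * m + 2 * d)
    (jb := fun _ => 0) (jc := id) isOp_times (by decide) rfl rfl rfl
    (by rw [rowCount]; omega) (fun _ => rfl) (fun _ => rfl) (fun j hj => ⟨hd, hj⟩) hd (by omega)
    (by omega) fun _ _ => trivial) fun V₄ hV₄ => ?_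
  rw [d0 (4 * m + 2 * d + 7) (by omega), c0 (4 * m + 2 * d + 7) (by omega), b7,
    d0 (4 * m + 2 * d) (by omega), c0 (4 * m + 2 * d) (by omega),
    b0 (4 * m + 2 * d) (by omega)] at hV₄
  have e0 : ∀ R, R ≠ 4 * m + 2 * d + 8 → V₄ R = V₃ R := fun R hR => by
    rw [hV₄, Function.update_of_ne hR]
  have e8 : V₄ (4 * m + 2 * d + 8) = fun j => V (m + r) k / V (4 * m + 2 * d) k *
      V (4 * m + 2 * d) j := by
    rw [hV₄, Function.update_self]; rfl
  refine (doesRow (Ra := m + r) (Rb := m + r) (Rc := 4 * m + 2 * d + 8)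
    (jb := id) (jc := id) isOp_minus (by decide) rfl rfl rfl
    (by rw [rowCount]; omega) (fun _ => rfl) (fun _ => rfl) (fun j hj => ⟨hj, hj⟩) hd (.inr rfl)
    (by omega) fun _ _ => trivial).mono le_rfl fun V₅ hV₅ => ?_
  rw [e8, e0 (m + r) (by omega), d0 (m + r) (by omega), c0 (m + r) (by omega),
    b0 (m + r) (by omega)] at hV₅
  rw [hV₅]
  refine ⟨?_, ?_, fun R h1 h2 h3 h4 => ?_⟩
  · rw [Function.update_self]; rfl
  · rw [Function.update_of_ne (by omega), e0 _ (by omega), d1]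
  · rw [Function.update_of_ne h1, e0 _ h4, d0 _ h2, c0 _ h4, b0 _ h3]

/-- The leverages, by symmetric elimination. -/
def eliminate : Program :=
  forLoop 11 1 (ifPos ⟨9, 17, 16⟩ ⟨6, 11, 11⟩
    (.seq (rowOp .rplus ⟨9, 16, 13⟩ ⟨6, 11, 13⟩ ⟨9, 17, 16⟩) (forLoop 12 2 eliminateRow)))

/-- The time of one elimination step. -/
def pivotTime (m d : ℕ) : ℕ := (15 * d + 2) + ((m + d) * (5 * (15 * d + 2) + 2) + 2)

/-- The work copies and the form are adjacent, so one loop over `m + d` rows treats both; this also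
explains the `d` superfluous rows for leverages. The loop clears the pivot row itself, hence the
scratch copy of it. -/
theorem does_pivot (hk : k < d) (hz : V (4 * m + 2 * d + 1) 0 = 0) (hpiv : 0 < V (2 * m + k) k) :
    Does (rowCount m d) d p η
      (.seq (rowOp .rplus ⟨9, 16, 13⟩ ⟨6, 11, 13⟩ ⟨9, 17, 16⟩) (forLoop 12 2 eliminateRow))
      (pivotTime m d) (env m d k 0 0) V fun V' =>
      (∀ r < m + d, V' (m + r) = fun j => V (m + r) j -
        V (m + r) k / V (2 * m + k) k * V (2 * m + k) j) ∧
      (∀ r < m + d, V' (2 * m + d + r) = fun j => V (2 * m + d + r) j +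
        V (m + r) k / V (2 * m + k) k * V (m + r) k) ∧
      ∀ R, R < m ∨ 3 * m + 2 * d ≤ R ∧ R ≠ 4 * m + 2 * d ∧ R ≠ 4 * m + 2 * d + 7 ∧
        R ≠ 4 * m + 2 * d + 8 → V' R = V R := by
  have hd : 0 < d := by omega
  refine Does.seq (doesRow (Ra := 4 * m + 2 * d) (Rb := 2 * m + k) (Rc := 4 * m + 2 * d + 1)
    (jb := id) (jc := fun _ => 0) isOp_plus (by decide) rfl rfl rfl
    (by rw [rowCount]; omega) (fun _ => rfl) (fun _ => rfl) (fun j hj => ⟨hj, hd⟩) hd (by omega)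
    (by omega) fun _ _ => trivial) fun V₁ hV₁ => ?_
  have b0 : ∀ R, R ≠ 4 * m + 2 * d → V₁ R = V R := fun R hR => by
    rw [hV₁, Function.update_of_ne hR]
  have b1 : V₁ (4 * m + 2 * d) = V (2 * m + k) := by
    rw [hV₁, Function.update_self]; funext j; simp [hz]
  refine (doesInner (M := m + d) (by decide) rfl (by rw [rowCount]; omega)
    (fun r V' => (∀ i < r, V' (m + i) = fun j => V (m + i) j -
        V (m + i) k / V (2 * m + k) k * V (2 * m + k) j) ∧
      (∀ i < r, V' (2 * m + d + i) = fun j => V (2 * m + d + i) j +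
        V (m + i) k / V (2 * m + k) k * V (m + i) k) ∧
      (∀ i, r ≤ i → i < m + d → V' (m + i) = V (m + i)) ∧
      (∀ i, r ≤ i → i < m + d → V' (2 * m + d + i) = V (2 * m + d + i)) ∧
      V' (4 * m + 2 * d) = V (2 * m + k) ∧
      ∀ R, R < m ∨ 3 * m + 2 * d ≤ R ∧ R ≠ 4 * m + 2 * d ∧ R ≠ 4 * m + 2 * d + 7 ∧
        R ≠ 4 * m + 2 * d + 8 → V' R = V R)
    (fun r hr V₂ hV₂ => ?_) ⟨fun i hi => by omega, fun i hi => by omega, fun i _ hi => b0 _ (by omega),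
      fun i _ hi => b0 _ (by omega), b1, fun R hR => b0 R (by omega)⟩).mono le_rfl
    fun V' hV' => ⟨hV'.1, hV'.2.1, hV'.2.2.2.2.2⟩
  obtain ⟨h1, h2, h3, h4, h5, h6⟩ := hV₂
  refine (does_eliminateRow hk hr (by rw [h5]; exact hpiv.ne')).mono le_rfl fun V₃ hV₃ => ?_
  obtain ⟨g1, g2, g3⟩ := hV₃
  rw [h5, h3 r le_rfl hr] at g1
  rw [h5, h3 r le_rfl hr, h4 r le_rfl hr] at g2
  refine ⟨fun i hi => ?_, fun i hi => ?_, fun i hi hi' => ?_, fun i hi hi' => ?_, ?_, fun R hR => ?_⟩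
  · by_cases h : i = r
    · subst h; exact g1
    · rw [g3 _ (by omega) (by omega) (by omega) (by omega)]; exact h1 i (by omega)
  · by_cases h : i = r
    · subst h; exact g2
    · rw [g3 _ (by omega) (by omega) (by omega) (by omega)]; exact h2 i (by omega)
  · rw [g3 _ (by omega) (by omega) (by omega) (by omega)]; exact h3 i (by omega) hi'
  · rw [g3 _ (by omega) (by omega) (by omega) (by omega)]; exact h4 i (by omega) hi'
  · rw [g3 _ (by omega) (by omega) (by omega) (by omega)]; exact h5
  · rw [g3 _ (by omega) (by omega) (by omega) (by omega)]; exact h6 R hR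

/-- New coefficients from the leverages. -/
def updateCoefs : Program :=
  forLoop 12 0 (ifPos ⟨9, 17, 16⟩ ⟨7, 12, 16⟩ (rowOp .rpow ⟨8, 12, 13⟩ ⟨7, 12, 16⟩ ⟨9, 19, 16⟩))

/-- Powers are legal only for a positive base. Rows without a positive leverage keep their old
coefficient; they will be zero rows, whose coefficients do not matter. -/
theorem does_updateCoefs (hd : 0 < d) (hz : V (4 * m + 2 * d + 1) 0 = 0) :
    Does (rowCount m d) d p η updateCoefs (m * (15 * d + 13) + 2) (env m d 0 0 0) V fun V' =>
      (∀ i < m, 0 < V (2 * m + d + i) 0 → V' (3 * m + 2 * d + i) 0 =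
        V (2 * m + d + i) 0 ^ V (4 * m + 2 * d + 3) 0) ∧
      ∀ R, R < 3 * m + 2 * d ∨ 4 * m + 2 * d ≤ R → V' R = V R := by
  refine (doesInner (T := 15 * d + 11) (M := m) (by decide) rfl (by rw [rowCount]; omega)
    (fun r V' => (∀ i < r, 0 < V (2 * m + d + i) 0 → V' (3 * m + 2 * d + i) 0 =
        V (2 * m + d + i) 0 ^ V (4 * m + 2 * d + 3) 0) ∧
      ∀ R, R < 3 * m + 2 * d ∨ 4 * m + 2 * d ≤ R → V' R = V R)
    (fun r hr V₁ hV₁ => ?_) ⟨fun i hi => by omega, fun _ _ => rfl⟩)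
  have e1 : V₁ (2 * m + d + r) = V (2 * m + d + r) := hV₁.2 _ (by omega)
  have e3 : V₁ (4 * m + 2 * d + 3) = V (4 * m + 2 * d + 3) := hV₁.2 _ (by omega)
  refine doesIfPos (T := 15 * d + 2) (R := 2 * m + d + r) (j := 0) hd (by decide) rfl rfl
    (by rw [rowCount]; omega) hd (by rw [hV₁.2 _ (by omega)]; exact hz) (fun hpos => ?_)
    (fun hneg => ?_)
  · refine (doesRow (Ra := 3 * m + 2 * d + r) (Rb := 2 * m + d + r) (Rc := 4 * m + 2 * d + 3)
      (jb := fun _ => 0) (jc := fun _ => 0) isOp_pow (by decide) rfl rfl rfl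
      (by rw [rowCount]; omega) (fun _ => rfl) (fun _ => rfl) (fun j hj => ⟨hd, hd⟩) hd (by omega)
      (by omega) fun _ _ => hpos).mono le_rfl fun V' hV' => ?_
    rw [e1, e3] at hV'
    rw [hV']
    refine ⟨fun i hi hi0 => ?_, fun R hR => ?_⟩
    · by_cases h : i = r
      · subst h; rw [Function.update_self]
      · rw [Function.update_of_ne (by omega)]; exact hV₁.1 i (by omega) hi0
    · rw [Function.update_of_ne (by omega)]; exact hV₁.2 R hR
  · refine ⟨fun i hi hi0 => ?_, hV₁.2⟩
    by_cases h : i = r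
    · subst h; rw [e1] at hneg; linarith
    · exact hV₁.1 i (by omega) hi0

/-- The bound for the error is halved. -/
def halve : Program := rowOp .rtimes ⟨9, 21, 13⟩ ⟨9, 21, 13⟩ ⟨9, 25, 16⟩

theorem does_halve (hd : 0 < d) :
    Does (rowCount m d) d p η halve (15 * d + 2) (env m d 0 0 0) V fun V' =>
      V' = Function.update V (4 * m + 2 * d + 5)
        fun j => V (4 * m + 2 * d + 5) j * V (4 * m + 2 * d + 9) 0 :=
  doesRow (Ra := 4 * m + 2 * d + 5) (Rb := 4 * m + 2 * d + 5) (Rc := 4 * m + 2 * d + 9)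
    (jb := id) (jc := fun _ => 0) isOp_times (by decide) rfl rfl rfl
    (by rw [rowCount]; omega) (fun _ => rfl) (fun _ => rfl) (fun j hj => ⟨hj, hd⟩) hd (.inr rfl)
    (by omega) fun _ _ => trivial

end Phases

/-! ### Elimination -/

section Elimination

open Matrix

variable {m d : ℕ} {p η : ℝ}

/-- The form after the elimination of the variable `k`. -/
def schur (U : Matrix (Fin d) (Fin d) ℝ) (k : Fin d) : Matrix (Fin d) (Fin d) ℝ :=
  of fun i j => U i j - U i k / U k k * U k j

theorem schur_mulVec (U : Matrix (Fin d) (Fin d) ℝ) (k : Fin d) (z : Fin d → ℝ) (i : Fin d) :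
    (schur U k *ᵥ z) i = (U *ᵥ z) i - U i k / U k k * (U *ᵥ z) k := by
  simp only [schur, mulVec, dotProduct, of_apply, sub_mul, Finset.sum_sub_distrib, Finset.mul_sum,
    mul_assoc]

theorem mulVec_apply_eq {U : Matrix (Fin d) (Fin d) ℝ} (hU : U.PosSemidef) (i j : Fin d) :
    U i j = U j i := by
  have := congrFun (congrFun (PosSemidef.transpose_eq hU) j) i
  rwa [transpose_apply] at this

theorem schur_mulVec' {U : Matrix (Fin d) (Fin d) ℝ} (hU : U.PosSemidef) (k : Fin d)
    (z : Fin d → ℝ) :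
    schur U k *ᵥ z = fun j => (U *ᵥ z) j - (U *ᵥ z) k / U k k * U k j := by
  funext j
  rw [schur_mulVec, mulVec_apply_eq hU j k]
  ring

/-- Completing the square in the variable `k`: what the quadratic form loses at a pivot is the
increment of the leverage. -/
theorem schur_quad {U : Matrix (Fin d) (Fin d) ℝ} (hU : U.PosSemidef) (k : Fin d) (z : Fin d → ℝ) :
    (U *ᵥ z) k / U k k * (U *ᵥ z) k + z ⬝ᵥ schur U k *ᵥ z = z ⬝ᵥ U *ᵥ z := by
  have h1 : z ⬝ᵥ schur U k *ᵥ z = z ⬝ᵥ U *ᵥ z - (U *ᵥ z) k / U k k * (z ⬝ᵥ fun j => U k j) := by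
    rw [schur_mulVec' hU, dotProduct, dotProduct, dotProduct, Finset.mul_sum,
      ← Finset.sum_sub_distrib]
    exact Finset.sum_congr rfl fun j _ => by ring
  have h2 : (z ⬝ᵥ fun j => U k j) = (U *ᵥ z) k := dotProduct_comm _ _
  rw [h1, h2]
  ring

theorem schur_posSemidef {U : Matrix (Fin d) (Fin d) ℝ} (hU : U.PosSemidef) {k : Fin d}
    (hk : 0 < U k k) : (schur U k).PosSemidef := by
  refine .of_dotProduct_mulVec_nonneg ?_ fun z => ?_
  · ext i j
    simp only [conjTranspose_apply, schur, of_apply, star_trivial]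
    rw [mulVec_apply_eq hU j i, mulVec_apply_eq hU j k, mulVec_apply_eq hU k i]
    ring
  · rw [star_trivial]
    -- `z - t e_k` minimizes the form over the variable `k`, and the minimum is the value of the
    -- Schur complement at `z`.
    set t := (U *ᵥ z) k / U k k with ht
    have h := quad_nonneg hU (z - t • Pi.single k 1)
    have e1 : U *ᵥ Pi.single k 1 = fun j => U k j := by
      funext j
      rw [mulVec_single_one, col_apply, mulVec_apply_eq hU]
    have e2 : (z ⬝ᵥ fun j => U k j) = (U *ᵥ z) k := dotProduct_comm _ _
    have e3 : (Pi.single k (1 : ℝ)) ⬝ᵥ U *ᵥ z = (U *ᵥ z) k := by simp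
    have e4 : (Pi.single k (1 : ℝ)) ⬝ᵥ (fun j => U k j) = U k k := by simp
    rw [mulVec_sub, mulVec_smul, e1, sub_dotProduct, dotProduct_sub, dotProduct_sub, dotProduct_smul,
      smul_dotProduct, smul_dotProduct, dotProduct_smul, e2, e3, e4] at h
    have hs := schur_quad hU k z
    have htk : t * U k k = (U *ᵥ z) k := div_mul_cancel₀ _ hk.ne'
    simp only [smul_eq_mul, htk] at h
    rw [← ht] at hs
    linarith

theorem schur_self {U : Matrix (Fin d) (Fin d) ℝ} {k : Fin d} (hk : 0 < U k k) (j : Fin d) :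
    schur U k k j = 0 := by
  simp only [schur, of_apply]
  rw [div_self hk.ne', one_mul, sub_self]

theorem schur_of_eq_zero {U : Matrix (Fin d) (Fin d) ℝ} {i k : Fin d} (hi : ∀ j, U i j = 0)
    (j : Fin d) : schur U k i j = 0 := by
  simp [schur, hi]

/-- A variable with a vanishing pivot is already eliminated, so the program may skip it. This covers
singular forms. -/
theorem row_eq_zero {U : Matrix (Fin d) (Fin d) ℝ} (hU : U.PosSemidef) {k : Fin d}
    (hk : U k k ≤ 0) (j : Fin d) : U k j = 0 := by
  have e1 : U *ᵥ Pi.single k 1 = fun j => U k j := by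
    funext j
    rw [mulVec_single_one, col_apply, mulVec_apply_eq hU]
  have h1 : (Pi.single k (1 : ℝ)) ⬝ᵥ U *ᵥ Pi.single k 1 = U k k := by rw [e1]; simp
  have h0 : U k k = 0 := le_antisymm hk (h1 ▸ quad_nonneg hU _)
  have := (hU.dotProduct_mulVec_zero_iff (Pi.single k 1)).1 (by rw [star_trivial, h1, h0])
  rw [e1] at this
  exact congrFun this j

/-- The first `d` entries of a row of memory. -/
def rowVec (d : ℕ) (V : ℕ → ℕ → ℝ) (R : ℕ) : Fin d → ℝ := fun j => V R j

/-- The matrix in `d` consecutive rows of memory. -/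
def formAt (d : ℕ) (V : ℕ → ℕ → ℝ) (R : ℕ) : Matrix (Fin d) (Fin d) ℝ :=
  of fun i j => V (R + i) j

/-- The state after the elimination of the first `k` variables. -/
structure Eliminated (m d : ℕ) (V₀ : ℕ → ℕ → ℝ) (k : ℕ) (V : ℕ → ℕ → ℝ) : Prop where
  frame : ∀ R, R < m ∨ 3 * m + 2 * d ≤ R ∧ R ≠ 4 * m + 2 * d ∧ R ≠ 4 * m + 2 * d + 7 ∧
    R ≠ 4 * m + 2 * d + 8 → V R = V₀ R
  posSemidef : (formAt d V (2 * m)).PosSemidef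
  eq_zero : ∀ i : Fin d, i.val < k → ∀ j, formAt d V (2 * m) i j = 0
  leverage : ∀ r < m, ∀ z, rowVec d V₀ (m + r) = formAt d V₀ (2 * m) *ᵥ z →
    rowVec d V (m + r) = formAt d V (2 * m) *ᵥ z ∧
    V (2 * m + d + r) 0 + z ⬝ᵥ formAt d V (2 * m) *ᵥ z = z ⬝ᵥ formAt d V₀ (2 * m) *ᵥ z

/-- The solution `z` of `u = U z` is never computed. It is a witness that stays the same throughout:
the reduced row equals the reduced form times `z`, and the collected leverage plus the remaining
quadratic form is conserved. -/
theorem Eliminated.pivot {V₀ V V' : ℕ → ℕ → ℝ} {k : ℕ} (h : Eliminated m d V₀ k V) (hk : k < d)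
    (hpiv : 0 < V (2 * m + k) k)
    (h1 : ∀ r < m + d, V' (m + r) = fun j => V (m + r) j -
        V (m + r) k / V (2 * m + k) k * V (2 * m + k) j)
    (h2 : ∀ r < m + d, V' (2 * m + d + r) = fun j => V (2 * m + d + r) j +
        V (m + r) k / V (2 * m + k) k * V (m + r) k)
    (h3 : ∀ R, R < m ∨ 3 * m + 2 * d ≤ R ∧ R ≠ 4 * m + 2 * d ∧ R ≠ 4 * m + 2 * d + 7 ∧
        R ≠ 4 * m + 2 * d + 8 → V' R = V R) : Eliminated m d V₀ (k + 1) V' := by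
  set U := formAt d V (2 * m) with hU
  set κ : Fin d := ⟨k, hk⟩ with hκ
  have hpiv' : 0 < U κ κ := hpiv
  have e : formAt d V' (2 * m) = schur U κ := by
    ext i j
    have := h1 (m + i) (by omega)
    rw [← add_assoc, ← two_mul] at this
    simp only [formAt, schur, of_apply, this, hU, hκ]
  refine ⟨fun R hR => (h3 R hR).trans (h.frame R hR), ?_, fun i hi j => ?_, fun r hr z hz => ?_⟩
  · rw [e]; exact schur_posSemidef h.posSemidef hpiv'
  · rw [e]
    rcases Nat.lt_succ_iff_lt_or_eq.1 hi with hlt | heq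
    · exact schur_of_eq_zero (h.eq_zero i hlt) j
    · obtain rfl : i = κ := Fin.ext heq
      exact schur_self hpiv' j
  · obtain ⟨g1, g2⟩ := h.leverage r hr z hz
    have g3 : ∀ j : Fin d, V (m + r) j = (U *ᵥ z) j := fun j => congrFun g1 j
    have g4 : V (m + r) k = (U *ᵥ z) κ := g3 κ
    have g5 : V (2 * m + k) k = U κ κ := rfl
    refine ⟨?_, ?_⟩
    · rw [e, schur_mulVec' h.posSemidef]
      funext j
      rw [rowVec, h1 r (by omega)]
      simp only
      rw [g4, g5, g3 j]
      rfl
    · rw [e, h2 r (by omega), ← g2]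
      simp only
      rw [g4, g5, ← schur_quad h.posSemidef κ z]
      ring

/-- The time of the elimination. -/
def eliminateTime (m d : ℕ) : ℕ := d * (pivotTime m d + 9 + 2) + 2

theorem does_eliminate {V : ℕ → ℕ → ℝ} (hd : 0 < d) (hz : V (4 * m + 2 * d + 1) 0 = 0)
    (hlev : ∀ r < m, V (2 * m + d + r) = 0) (hU : (formAt d V (2 * m)).PosSemidef) :
    Does (rowCount m d) d p η eliminate (eliminateTime m d) (env m d 0 0 0) V fun V' =>
      (∀ r < m, Dominated (formAt d V (2 * m)) (rowVec d V (m + r)) →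
        V' (2 * m + d + r) 0 = lev (formAt d V (2 * m)) (rowVec d V (m + r))) ∧
      ∀ R, R < m ∨ 3 * m + 2 * d ≤ R ∧ R ≠ 4 * m + 2 * d ∧ R ≠ 4 * m + 2 * d + 7 ∧
        R ≠ 4 * m + 2 * d + 8 → V' R = V R := by
  refine (doesOuter (M := d) (by decide) rfl (by rw [rowCount]; omega) (Eliminated m d V)
    (fun k hk V₁ hV₁ => ?_) ⟨fun _ _ => rfl, hU, fun i hi => by omega, fun r hr z hrz => ⟨hrz, ?_⟩⟩).mono
    le_rfl fun V' hV' => ⟨fun r hr hdom => ?_, hV'.frame⟩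
  · have hz1 : V₁ (4 * m + 2 * d + 1) 0 = 0 := by rw [hV₁.frame _ (by omega), hz]
    refine doesIfPos (R := 2 * m + k) (j := k) hd (by decide) rfl rfl
      (by rw [rowCount]; omega) hk hz1 (fun hpos => ?_) (fun hneg => ?_)
    · exact (does_pivot hk hz1 hpos).mono le_rfl fun V₂ hV₂ => hV₁.pivot hk hpos hV₂.1 hV₂.2.1 hV₂.2.2
    · refine ⟨hV₁.frame, hV₁.posSemidef, fun i hi j => ?_, hV₁.leverage⟩
      rcases Nat.lt_succ_iff_lt_or_eq.1 hi with hlt | heq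
      · exact hV₁.eq_zero i hlt j
      · obtain rfl : i = ⟨k, hk⟩ := Fin.ext heq
        exact row_eq_zero (k := ⟨k, hk⟩) hV₁.posSemidef hneg j
  · rw [hlev r hr]; simp
  · obtain ⟨z, h1, h2⟩ := exists_mulVec_eq hU hdom
    have h3 := (hV'.leverage r hr z h1).2
    -- After all `d` variables nothing remains of the form, so the collected sum is the whole `zᵀ U
    -- z`, which is the leverage.
    have h4 : formAt d V' (2 * m) = 0 := by
      ext i j
      exact hV'.eq_zero i i.isLt j
    rw [h4, zero_mulVec, dotProduct_zero, add_zero] at h3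
    rw [h3, h2]

end Elimination

/-! ### One iteration -/

section Iteration

open Matrix

variable {m d : ℕ} {p η : ℝ}

theorem wgram_congr {ι : Type*} [Fintype ι] {a : ι → Fin d → ℝ} {c c' : ι → ℝ}
    (h : ∀ i, a i ≠ 0 → c i = c' i) : wgram a c = wgram a c' := by
  refine Finset.sum_congr rfl fun i _ => ?_
  by_cases hi : a i = 0
  · simp [hi]
  · rw [h i hi]

/-- The constants and the input are in memory. -/
structure Ready (p η : ℝ) (x : Fin m → Fin d → ℝ) (V : ℕ → ℕ → ℝ) : Prop where
  zero : V (4 * m + 2 * d + 1) 0 = 0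
  exponent : V (4 * m + 2 * d + 3) 0 = p / 2 - 1
  half_p : V (4 * m + 2 * d + 4) 0 = p / 2
  threshold : V (4 * m + 2 * d + 6) 0 = η / 8
  half : V (4 * m + 2 * d + 9) 0 = 1 / 2
  rows : ∀ i : Fin m, rowVec d V i = x i

/-- The state after `k` iterations. -/
structure LoopInv (p η : ℝ) (x : Fin m → Fin d → ℝ) (k : ℕ) (V : ℕ → ℕ → ℝ) : Prop
    extends Ready p η x V where
  iterate : IsLewisIterate p x (Real.exp (Real.log m / 2 ^ k))
    (wgram x fun i => V (3 * m + 2 * d + i) 0)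
  -- The machine has no logarithm; `m / 2^k` serves as an upper bound for `log m / 2^k`.
  error : V (4 * m + 2 * d + 5) 0 = m / 2 ^ k
  -- The stored leverages are one iterate behind the stored coefficients, and there are none before
  -- the first iteration.
  leverage : ∀ l, l + 1 = k → ∃ U, IsLewisIterate p x (Real.exp (Real.log m / 2 ^ l)) U ∧
    ∀ i : Fin m, V (2 * m + d + i) 0 = lev U (x i)

/-- New leverages, coefficients and error bound. -/
def iteration : Program :=
  .seq copyRows (.seq (clearRows 6 1) (.seq (clearRows 7 0) (.seq accumulate
    (.seq eliminate (.seq updateCoefs halve)))))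

def iterationTime (m d : ℕ) : ℕ :=
  (m * (15 * d + 4) + 2) + ((d * (15 * d + 4) + 2) + ((m * (15 * d + 4) + 2) +
    ((m * ((15 * d + 2) + (d * (((15 * d + 2) + (15 * d + 2)) + 2) + 2) + 2) + 2) +
      (eliminateTime m d + ((m * (15 * d + 13) + 2) + (15 * d + 2))))))

theorem does_iteration (hp : 1 ≤ p) (hp2 : p ≤ 2) (hd : 0 < d)
    {x : Fin m → Fin d → ℝ} {k : ℕ} {V : ℕ → ℕ → ℝ} (h : LoopInv p η x k V) :
    Does (rowCount m d) d p η iteration (iterationTime m d) (env m d 0 0 0) V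
      (LoopInv p η x (k + 1)) := by
  set U := wgram x fun i => V (3 * m + 2 * d + i) 0 with hU
  refine Does.seq (does_copyRows hd h.zero) fun V₁ hV₁ => ?_
  have z1 : V₁ (4 * m + 2 * d + 1) 0 = 0 := by rw [hV₁.2 _ (by omega), h.zero]
  refine Does.seq (does_clearRows (B := 2 * m) (M := d) (by decide) (fun _ => rfl) rfl (by omega) hd
    z1) fun V₂ hV₂ => ?_
  have z2 : V₂ (4 * m + 2 * d + 1) 0 = 0 := by rw [hV₂.2 _ (by omega), z1]
  refine Does.seq (does_clearRows (B := 2 * m + d) (M := m) (by decide) (fun _ => rfl) rfl (by omega)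
    hd z2) fun V₃ hV₃ => ?_
  refine Does.seq (does_accumulate hd) fun V₄ hV₄ => ?_
  have g4 : ∀ R, R < m ∨ 3 * m + d ≤ R ∧ R ≠ 4 * m + 2 * d + 7 ∧ R ≠ 4 * m + 2 * d + 8 →
      V₄ R = V R := fun R hR => by
    rw [hV₄.2 R (by omega), hV₃.2 R (by omega), hV₂.2 R (by omega), hV₁.2 R (by omega)]
  have g3 : ∀ R, R < m ∨ 3 * m + d ≤ R → V₃ R = V R := fun R hR => by
    rw [hV₃.2 R (by omega), hV₂.2 R (by omega), hV₁.2 R (by omega)]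
  have hform : formAt d V₄ (2 * m) = U := by
    ext i j
    have e0 : V₃ (2 * m + i) = 0 := by rw [hV₃.2 _ (by omega), hV₂.1 i i.isLt]
    rw [formAt, of_apply, hV₄.1 i i.isLt, e0, hU, wgram, Matrix.sum_apply]
    simp only [Pi.zero_apply, zero_add]
    rw [← Fin.sum_univ_eq_sum_range (fun r => V₃ (3 * m + 2 * d + r) 0 * V₃ r i * V₃ r j)]
    refine Finset.sum_congr rfl fun r _ => ?_
    rw [g3 _ (by omega), g3 r (by omega), Matrix.smul_apply, vecMulVec_apply, ← h.rows r, smul_eq_mul,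
      mul_assoc]
    rfl
  have hrow : ∀ r : Fin m, rowVec d V₄ (m + r) = x r := fun r => by
    have e : V₄ (m + r) = V r := by
      rw [hV₄.2 _ (by omega), hV₃.2 _ (by omega), hV₂.2 _ (by omega), hV₁.1 r r.isLt]
    rw [← h.rows r]
    funext j
    rw [rowVec, e, rowVec]
  refine Does.seq (does_eliminate hd (by rw [g4 _ (by omega), h.zero]) (fun r hr => ?_)
    (by rw [hform]; exact h.iterate.posSemidef)) fun V₅ hV₅ => ?_
  · rw [hV₄.2 _ (by omega), hV₃.1 r hr]
  rw [hform] at hV₅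
  have hl5 : ∀ i : Fin m, V₅ (2 * m + d + i) 0 = lev U (x i) := fun i => by
    have := hV₅.1 i i.isLt
    rw [hrow i] at this
    exact this (h.iterate.dominated i)
  have g5 : ∀ R, R < m ∨ 3 * m + 2 * d ≤ R ∧ R ≠ 4 * m + 2 * d ∧ R ≠ 4 * m + 2 * d + 7 ∧
      R ≠ 4 * m + 2 * d + 8 → V₅ R = V R := fun R hR => by
    rw [hV₅.2 R hR, g4 R (by omega)]
  refine Does.seq (does_updateCoefs hd (by rw [g5 _ (by omega), h.zero])) fun V₆ hV₆ => ?_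
  have g6 : ∀ R, R < m ∨ 4 * m + 2 * d < R ∧ R ≠ 4 * m + 2 * d + 7 ∧
      R ≠ 4 * m + 2 * d + 8 → V₆ R = V R := fun R hR => by
    rw [hV₆.2 R (by omega), g5 R (by omega)]
  refine (does_halve hd).mono le_rfl fun V₇ hV₇ => ?_
  have g7 : ∀ R, R ≠ 4 * m + 2 * d + 5 → V₇ R = V₆ R := fun R hR => by
    rw [hV₇, Function.update_of_ne hR]
  have hlog : 0 ≤ Real.log m / 2 ^ k := div_nonneg (Real.log_natCast_nonneg m) (by positivity)
  have hnext := h.iterate.next hp hp2 (Real.one_le_exp hlog)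
  -- Taking the square root of the factor halves its logarithm.
  rw [← Real.exp_half, div_div, ← pow_succ] at hnext
  refine ⟨⟨?_, ?_, ?_, ?_, ?_, fun i => ?_⟩, ?_, ?_, ?_⟩
  · rw [g7 _ (by omega), g6 _ (by omega), h.zero]
  · rw [g7 _ (by omega), g6 _ (by omega), h.exponent]
  · rw [g7 _ (by omega), g6 _ (by omega), h.half_p]
  · rw [g7 _ (by omega), g6 _ (by omega), h.threshold]
  · rw [g7 _ (by omega), g6 _ (by omega), h.half]
  · rw [← h.rows i]
    funext j
    rw [rowVec, g7 _ (by omega), g6 _ (by omega), rowVec]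
  -- The stored coefficients agree with `lcoef` only on nonzero rows, which is all that the Gram
  -- matrix sees.
  · rw [wgram_congr (c' := lcoef p U x)]
    · exact hnext
    · intro i hi
      have hpos := lev_pos h.iterate.posSemidef (h.iterate.dominated i) hi
      rw [← hl5 i] at hpos
      rw [g7 _ (by omega), hV₆.1 i i.isLt hpos, hl5 i, g5 _ (by omega), h.exponent]
      rfl
  · rw [hV₇, Function.update_self, g6 _ (by omega), g6 _ (by omega), h.half, h.error, pow_succ]
    ring
  · rintro l hl
    obtain rfl : l = k := by omega
    exact ⟨U, h.iterate, fun i => by rw [g7 _ (by omega), hV₆.2 _ (by omega), hl5 i]⟩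

end Iteration

/-! ### The whole program -/

section Main

open Matrix

variable {m d : ℕ} {p η : ℝ} {V : ℕ → ℕ → ℝ}

theorem cell_ok {m d k r : ℕ} {c : Cell} {R : ℕ} (hd : 0 < d)
    (hregs : c.base < 30 ∧ c.var < 30 ∧ c.col < 30) (hR : c.row (env m d k r 0) = R)
    (hRN : R < rowCount m d) (hj : env m d k r 0 c.col = 0) :
    c.Ok (rowCount m d) d (env m d k r 0) :=
  ⟨hregs.1, hregs.2.1, hregs.2.2, hR ▸ hRN, by rw [hj]; exact hd⟩

theorem setCell_spec (V : ℕ → ℕ → ℝ) (R : ℕ) (v : ℝ) :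
    setCell V R 0 v R 0 = v ∧ ∀ R', R' ≠ R → setCell V R 0 v R' = V R' :=
  ⟨by simp [setCell], fun R' h => by rw [setCell, Function.update_of_ne h]⟩

theorem doesCast {k r y : ℕ} {a : Cell} {R : ℕ} (hd : 0 < d)
    (hregs : a.base < 30 ∧ a.var < 30 ∧ a.col < 30) (hR : a.row (env m d k r 0) = R)
    (hRN : R < rowCount m d) (hj : env m d k r 0 a.col = 0) (hy : y < 30) :
    Does (rowCount m d) d p η (castOp a y) 5 (env m d k r 0) V fun V' =>
      V' R 0 = env m d k r 0 y ∧ ∀ R', R' ≠ R → V' R' = V R' := by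
  refine (Does.castOp (std_env m d k r 0) (cell_ok hd hregs hR hRN hj) hy).mono le_rfl
    fun V' hV' => ?_
  rw [hV', hR, hj]
  exact setCell_spec _ _ _

theorem doesLoad {y : ℕ} {a : Cell} {R : ℕ} (hd : 0 < d)
    (hregs : a.base < 30 ∧ a.var < 30 ∧ a.col < 30) (hR : a.row (env m d 0 0 0) = R)
    (hRN : R < rowCount m d) (hj : env m d 0 0 0 a.col = 0) (hy : y < 30)
    (hy1 : env m d 0 0 0 y < 2) (hz : V (4 * m + 2 * d + 1) 0 = 0) :
    Does (rowCount m d) d p η (loadOp a ⟨9, 17, 16⟩ y) 9 (env m d 0 0 0) V fun V' =>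
      V' R 0 = (if env m d 0 0 0 y = 0 then p else η) ∧ ∀ R', R' ≠ R → V' R' = V R' := by
  refine (Does.loadOp (std_env m d 0 0 0) (cell_ok hd hregs hR hRN hj)
    (cell_ok (R := 4 * m + 2 * d + 1) hd (by decide) rfl (by rw [rowCount]; omega) rfl) hz hy
    hy1).mono le_rfl fun V' hV' => ?_
  rw [hV', hR, hj]
  exact setCell_spec _ _ _

theorem doesCell {o : ℕ → ℕ → ℕ → Instr} {f : ℝ → ℝ → ℝ} {D : ℝ → ℝ → Prop} (ho : IsOp o f D)
    {ta tb tc Ra Rb Rc : ℕ} (hd : 0 < d) (ht : 16 + ta < 30 ∧ 16 + tb < 30 ∧ 16 + tc < 30)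
    (ha : Cell.row ⟨9, 16 + ta, 16⟩ (env m d 0 0 0) = Ra)
    (hb : Cell.row ⟨9, 16 + tb, 16⟩ (env m d 0 0 0) = Rb)
    (hc : Cell.row ⟨9, 16 + tc, 16⟩ (env m d 0 0 0) = Rc)
    (hN : Ra < rowCount m d ∧ Rb < rowCount m d ∧ Rc < rowCount m d) (hD : D (V Rb 0) (V Rc 0)) :
    Does (rowCount m d) d p η (cellOp o ⟨9, 16 + ta, 16⟩ ⟨9, 16 + tb, 16⟩ ⟨9, 16 + tc, 16⟩) 13
      (env m d 0 0 0) V fun V' => V' Ra 0 = f (V Rb 0) (V Rc 0) ∧ ∀ R', R' ≠ Ra → V' R' = V R' := by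
  subst ha hb hc
  refine (Does.cellOp ho (std_env m d 0 0 0)
    (cell_ok hd ⟨by norm_num, ht.1, by norm_num⟩ rfl hN.1 rfl)
    (cell_ok hd ⟨by norm_num, ht.2.1, by norm_num⟩ rfl hN.2.1 rfl)
    (cell_ok hd ⟨by norm_num, ht.2.2, by norm_num⟩ rfl hN.2.2 rfl) hD).mono le_rfl fun V' hV' => ?_
  rw [hV']
  exact setCell_spec _ _ _

/-- The constants are computed, and all coefficients are set to `1`. -/
def setup : Program :=
  .seq (castOp ⟨9, 17, 16⟩ 16) (.seq (castOp ⟨9, 18, 16⟩ 17) (.seq (castOp ⟨9, 25, 16⟩ 18)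
  (.seq (cellOp .rdiv ⟨9, 16 + 9, 16⟩ ⟨9, 16 + 2, 16⟩ ⟨9, 16 + 9, 16⟩)
  (.seq (loadOp ⟨9, 20, 16⟩ ⟨9, 17, 16⟩ 16)
  (.seq (cellOp .rtimes ⟨9, 16 + 4, 16⟩ ⟨9, 16 + 4, 16⟩ ⟨9, 16 + 9, 16⟩)
  (.seq (cellOp .rminus ⟨9, 16 + 3, 16⟩ ⟨9, 16 + 4, 16⟩ ⟨9, 16 + 2, 16⟩)
  (.seq (loadOp ⟨9, 22, 16⟩ ⟨9, 17, 16⟩ 17) (.seq (castOp ⟨9, 23, 16⟩ 24)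
  (.seq (cellOp .rdiv ⟨9, 16 + 6, 16⟩ ⟨9, 16 + 6, 16⟩ ⟨9, 16 + 7, 16⟩)
  (.seq (castOp ⟨9, 21, 16⟩ 0) (forLoop 12 0 (castOp ⟨8, 12, 16⟩ 17))))))))))))

theorem does_setup (hp : 1 ≤ p) (hp2 : p ≤ 2) (hm : 0 < m) (hd : 0 < d) {x : Fin m → Fin d → ℝ}
    (hV : ∀ i : Fin m, rowVec d V i = x i) :
    Does (rowCount m d) d p η setup (m * 7 + 100) (env m d 0 0 0) V (LoopInv p η x 0) := by
  have hN : ∀ t, t ≤ 9 → 4 * m + 2 * d + t < rowCount m d := fun t ht => by rw [rowCount]; omega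
  refine (Does.seq (doesCast (R := 4 * m + 2 * d + 1) hd (by decide) rfl (hN _ (by decide)) rfl
    (by decide)) fun V₁ h₁ => ?_).mono (T := 5 + (5 + (5 + (13 + (9 + (13 + (13 + (9 + (5 + (13 +
      (5 + (m * (5 + 2) + 2)))))))))))) (by omega) fun _ h => h
  refine Does.seq (doesCast (R := 4 * m + 2 * d + 2) hd (by decide) rfl (hN _ (by decide)) rfl
    (by decide)) fun V₂ h₂ => ?_
  refine Does.seq (doesCast (R := 4 * m + 2 * d + 9) hd (by decide) rfl (hN _ (by decide)) rfl
    (by decide)) fun V₃ h₃ => ?_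
  have v1 : V₁ (4 * m + 2 * d + 1) 0 = 0 := h₁.1.trans Nat.cast_zero
  have v2 : V₂ (4 * m + 2 * d + 2) 0 = 1 := h₂.1.trans Nat.cast_one
  have v3 : V₃ (4 * m + 2 * d + 9) 0 = 2 := h₃.1.trans Nat.cast_two
  refine Does.seq (doesCell (Ra := 4 * m + 2 * d + 9) (Rb := 4 * m + 2 * d + 2)
    (Rc := 4 * m + 2 * d + 9) isOp_div hd (by decide) rfl rfl rfl (by rw [rowCount]; omega)
    (by rw [v3]; norm_num)) fun V₄ h₄ => ?_
  rw [v3, h₃.2 (4 * m + 2 * d + 2) (by omega), v2] at h₄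
  refine Does.seq (doesLoad (R := 4 * m + 2 * d + 4) hd (by decide) rfl (hN _ (by decide)) rfl
    (by decide) (by exact Nat.zero_lt_two) (by rw [h₄.2 _ (by omega), h₃.2 _ (by omega), h₂.2 _ (by omega), v1]))
    fun V₅ h₅ => ?_
  have v5 : V₅ (4 * m + 2 * d + 4) 0 = p := h₅.1.trans (if_pos rfl)
  refine Does.seq (doesCell (Ra := 4 * m + 2 * d + 4) (Rb := 4 * m + 2 * d + 4)
    (Rc := 4 * m + 2 * d + 9) isOp_times hd (by decide) rfl rfl rfl (by rw [rowCount]; omega)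
    trivial) fun V₆ h₆ => ?_
  rw [v5, h₅.2 (4 * m + 2 * d + 9) (by omega), h₄.1] at h₆
  refine Does.seq (doesCell (Ra := 4 * m + 2 * d + 3) (Rb := 4 * m + 2 * d + 4)
    (Rc := 4 * m + 2 * d + 2) isOp_minus hd (by decide) rfl rfl rfl (by rw [rowCount]; omega)
    trivial) fun V₇ h₇ => ?_
  rw [h₆.1, h₆.2 (4 * m + 2 * d + 2) (by omega), h₅.2 (4 * m + 2 * d + 2) (by omega),
    h₄.2 (4 * m + 2 * d + 2) (by omega), h₃.2 (4 * m + 2 * d + 2) (by omega), v2] at h₇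
  have g7 : ∀ R, R < 4 * m + 2 * d ∨ R = 4 * m + 2 * d + 1 → V₇ R = V₁ R := fun R hR => by
    rw [h₇.2 _ (by omega), h₆.2 _ (by omega), h₅.2 _ (by omega), h₄.2 _ (by omega),
      h₃.2 _ (by omega), h₂.2 _ (by omega)]
  refine Does.seq (doesLoad (R := 4 * m + 2 * d + 6) hd (by decide) rfl (hN _ (by decide)) rfl
    (by decide) (by exact Nat.one_lt_two) (by rw [g7 _ (by omega), v1])) fun V₈ h₈ => ?_
  have v8 : V₈ (4 * m + 2 * d + 6) 0 = η := h₈.1.trans (if_neg (by exact one_ne_zero))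
  refine Does.seq (doesCast (R := 4 * m + 2 * d + 7) hd (by decide) rfl (hN _ (by decide)) rfl
    (by decide)) fun V₉ h₉ => ?_
  have v9 : V₉ (4 * m + 2 * d + 7) 0 = 8 := h₉.1.trans (Nat.cast_ofNat (R := ℝ) (n := 8))
  refine Does.seq (doesCell (Ra := 4 * m + 2 * d + 6) (Rb := 4 * m + 2 * d + 6)
    (Rc := 4 * m + 2 * d + 7) isOp_div hd (by decide) rfl rfl rfl (by rw [rowCount]; omega)
    (by rw [v9]; norm_num)) fun W h => ?_
  rw [v9, h₉.2 (4 * m + 2 * d + 6) (by omega), v8] at h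
  refine Does.seq (doesCast (R := 4 * m + 2 * d + 5) hd (by decide) rfl (hN _ (by decide)) rfl
    (by decide)) fun W' h' => ?_
  have v5' : W' (4 * m + 2 * d + 5) 0 = m := h'.1
  have gW : ∀ R, R ≠ 4 * m + 2 * d + 5 → R ≠ 4 * m + 2 * d + 6 → R ≠ 4 * m + 2 * d + 7 →
      W' R = V₇ R := fun R h1 h2 h3 => by
    rw [h'.2 _ h1, h.2 _ h2, h₉.2 _ h3, h₈.2 _ h2]
  refine (doesInner (M := m) (by decide) rfl (by rw [rowCount]; omega)
    (fun r V' => (∀ i < r, V' (3 * m + 2 * d + i) 0 = 1) ∧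
      ∀ R, R < 3 * m + 2 * d ∨ 4 * m + 2 * d ≤ R → V' R = W' R) (fun r hr W₁ hW₁ => ?_)
    ⟨fun i hi => by omega, fun _ _ => rfl⟩).mono le_rfl fun V' hV' => ?_
  · refine (doesCast (R := 3 * m + 2 * d + r) hd (by decide) rfl (by rw [rowCount]; omega) rfl
      (by decide)).mono le_rfl fun W₂ hW₂ => ⟨fun i hi => ?_, fun R hR => ?_⟩
    · by_cases hir : i = r
      · subst hir; exact hW₂.1.trans Nat.cast_one
      · rw [hW₂.2 _ (by omega)]; exact hW₁.1 i (by omega)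
    · rw [hW₂.2 _ (by omega)]; exact hW₁.2 R hR
  · refine ⟨⟨?_, ?_, ?_, ?_, ?_, fun i => ?_⟩, ?_, ?_, fun l hl => by omega⟩
    · rw [hV'.2 _ (by omega), gW _ (by omega) (by omega) (by omega), g7 _ (by omega), v1]
    · rw [hV'.2 _ (by omega), gW _ (by omega) (by omega) (by omega), h₇.1]; ring
    · rw [hV'.2 _ (by omega), gW _ (by omega) (by omega) (by omega), h₇.2 _ (by omega), h₆.1]; ring
    · rw [hV'.2 _ (by omega), h'.2 _ (by omega), h.1]
    · rw [hV'.2 _ (by omega), gW _ (by omega) (by omega) (by omega), h₇.2 _ (by omega),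
        h₆.2 _ (by omega), h₅.2 _ (by omega), h₄.1]
    · rw [← hV i]
      funext j
      rw [rowVec, hV'.2 _ (by omega), gW _ (by omega) (by omega) (by omega), g7 _ (by omega),
        h₁.2 _ (by omega), rowVec]
    · have e : (fun i : Fin m => V' (3 * m + 2 * d + i) 0) = 1 := funext fun i => hV'.1 i i.isLt
      -- The initial factor `m` is `exp (log m / 2^0)`.
      rw [e, pow_zero, div_one, Real.exp_log (by exact_mod_cast hm)]
      have := isLewisIterate_one hp hp2 x
      rwa [Fintype.card_fin] at this
    · rw [hV'.2 _ (by omega), v5', pow_zero, div_one]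

/-- The registers are set. -/
def prelude : List Instr :=
  [.const 17 1, .const 18 2, .const 19 3, .const 20 4, .const 21 5, .const 22 6, .const 23 7,
    .const 24 8, .const 25 9, .plus 2 0 1, .plus 5 0 16, .plus 6 0 0, .plus 7 6 1, .plus 8 7 2,
    .plus 9 8 0, .minus 10 0 17, .plus 14 9 22, .times 14 14 1, .plus 14 14 18, .plus 15 9 21,
    .times 15 15 1, .plus 15 15 18]

def LegalList (S : ℕ) : List Instr → MachineState → Prop
  | [], _ => True
  | i :: l, s => i.Legal S s ∧ LegalList S l (i.effect s)

theorem exec_block {S : ℕ} : ∀ {l : List Instr} {s : MachineState}, LegalList S l s →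
    Exec S (block l) s l.length (l.foldl Instr.effect s)
  | [], s, _ => .skip s
  | i :: l, s, h => by
    rw [List.length_cons, add_comm]
    exact .seq (.instr i s h.1) (exec_block h.2)

theorem exec_prelude (hd : 0 < d) {X : Rows d} (hm : X.length = m) :
    ∃ s, Exec (memSize (rowCount m d) d) (block prelude) (machineInput p η X) 22 s ∧
      Sim d p η (env m d 0 0 0) (fun R j => (machineInput p η X).mem (2 + (R * d + j))) s := by
  -- All address products are expressed through the one product `(4m + 2d + 4) d`, so that the
  -- remaining goals are linear.
  have hs : (rowCount m d) * d = (4 * m + 2 * d + 4) * d + 6 * d := by rw [rowCount]; ring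
  have h1 : (4 * m + 2 * d + 6) * d = (4 * m + 2 * d + 4) * d + 2 * d := by ring
  have h2 : (4 * m + 2 * d + 5) * d = (4 * m + 2 * d + 4) * d + d := by ring
  have e9 : m + m + d + (m + d) + m = 4 * m + 2 * d := by ring
  refine ⟨_, exec_block (l := prelude) ?_, ?_⟩
  · simp only [prelude, LegalList, Instr.Legal, Instr.effect, MachineState.setReg, machineInput,
      Function.update_apply, memSize]
    simp [hm, rowCount, e9]
    rw [rowCount] at hs
    omega
  · refine ⟨fun x hx => ?_, ?_, ?_, fun _ _ _ => rfl⟩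
    · simp only [prelude, List.foldl, Instr.effect, MachineState.setReg, machineInput, hm]
      interval_cases x <;> simp [env, e9] <;> omega
    · simp [prelude, Instr.effect, MachineState.setReg, machineInput]
    · simp [prelude, Instr.effect, MachineState.setReg, machineInput]

/-- The power `p / 2` of the last leverage is written to cell `0`. -/
def output : Program :=
  .seq (addr 30 ⟨9, 17, 16⟩) (.seq (addr 31 ⟨7, 10, 16⟩) (.seq (addr 32 ⟨9, 20, 16⟩)
    (.ite (.rlt 30 31) (.instr (.rpow 16 31 32)) (.instr (.rplus 16 30 30)))))

/-- A zero leverage admits no power instruction; the other branch writes `0 + 0` instead, and takes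
equally long. -/
theorem exec_output (hm : 0 < m) (hd : 0 < d) (hp : 0 < p) {s : MachineState}
    (hs : Sim d p η (env m d 0 0 0) V s) (hz : V (4 * m + 2 * d + 1) 0 = 0)
    (hq : V (4 * m + 2 * d + 4) 0 = p / 2) (hl : 0 ≤ V (2 * m + d + (m - 1)) 0) :
    ∃ s', Exec (memSize (rowCount m d) d) output s 14 s' ∧
      s'.mem 0 = V (2 * m + d + (m - 1)) 0 ^ (p / 2) := by
  have ok1 : Cell.Ok (rowCount m d) d (env m d 0 0 0) ⟨9, 17, 16⟩ :=
    cell_ok (R := 4 * m + 2 * d + 1) hd (by decide) rfl (by rw [rowCount]; omega) rfl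
  have ok2 : Cell.Ok (rowCount m d) d (env m d 0 0 0) ⟨7, 10, 16⟩ :=
    cell_ok (R := 2 * m + d + (m - 1)) hd (by decide) rfl (by rw [rowCount]; omega) rfl
  have ok3 : Cell.Ok (rowCount m d) d (env m d 0 0 0) ⟨9, 20, 16⟩ :=
    cell_ok (R := 4 * m + 2 * d + 4) hd (by decide) rfl (by rw [rowCount]; omega) rfl
  have l1 := address_lt ok1.row_lt ok1.col_lt
  have l2 := address_lt ok2.row_lt ok2.col_lt
  have l3 := address_lt ok3.row_lt ok3.col_lt
  have std := std_env m d 0 0 0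
  set s₁ := s.setReg 30 (2 + (Cell.row ⟨9, 17, 16⟩ (env m d 0 0 0) * d + env m d 0 0 0 16)) with h1
  set s₂ := s₁.setReg 31 (2 + (Cell.row ⟨7, 10, 16⟩ (env m d 0 0 0) * d + env m d 0 0 0 16)) with h2
  set s₃ := s₂.setReg 32 (2 + (Cell.row ⟨9, 20, 16⟩ (env m d 0 0 0) * d + env m d 0 0 0 16)) with h3
  have hs1 : Sim d p η (env m d 0 0 0) V s₁ := hs.setReg (by norm_num) _
  have hs2 : Sim d p η (env m d 0 0 0) V s₂ := hs1.setReg (by norm_num) _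
  have hs3 : Sim d p η (env m d 0 0 0) V s₃ := hs2.setReg (by norm_num) _
  have r1 : s₃.reg 30 = 2 + (Cell.row ⟨9, 17, 16⟩ (env m d 0 0 0) * d + env m d 0 0 0 16) := by
    simp [h3, h2, h1, MachineState.setReg]
  have r2 : s₃.reg 31 = 2 + (Cell.row ⟨7, 10, 16⟩ (env m d 0 0 0) * d + env m d 0 0 0 16) := by
    simp [h3, h2, MachineState.setReg]
  have r3 : s₃.reg 32 = 2 + (Cell.row ⟨9, 20, 16⟩ (env m d 0 0 0) * d + env m d 0 0 0 16) := by
    simp [h3, MachineState.setReg]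
  have r0 : s₃.reg 16 = 0 := hs3.reg 16 (by norm_num)
  have e1 : s₃.read 30 = 0 := (hs3.read r1 ok1.col_lt).trans hz
  have e2 : s₃.read 31 = V (2 * m + d + (m - 1)) 0 := hs3.read r2 ok2.col_lt
  have e3 : s₃.read 32 = p / 2 := (hs3.read r3 ok3.col_lt).trans hq
  have q0 : s₃.reg 16 < memSize (rowCount m d) d := by rw [r0, memSize]; omega
  have q1 : s₃.reg 30 < memSize (rowCount m d) d := by
    rw [r1, memSize]; exact l1.trans_le (by omega)
  have q2 : s₃.reg 31 < memSize (rowCount m d) d := by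
    rw [r2, memSize]; exact l2.trans_le (by omega)
  have q3 : s₃.reg 32 < memSize (rowCount m d) d := by
    rw [r3, memSize]; exact l3.trans_le (by omega)
  by_cases h : 0 < V (2 * m + d + (m - 1)) 0
  · have hpos : 0 < s₃.read 31 := e2.symm ▸ h
    refine ⟨_, .seq (T' := 10) (exec_addr hs.reg std ok1 (by norm_num)) (.seq (T' := 6)
      (exec_addr hs1.reg std ok2 (by norm_num)) (.seq (T' := 2)
        (exec_addr hs2.reg std ok3 (by norm_num)) (.iteTrue (T := 1) ⟨q1, q2⟩ ?_
          (.instr _ _ ⟨q0, q2, q3, hpos⟩)))), ?_⟩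
    · simp only [Test.Holds]
      rw [e1]
      exact hpos
    · simp only [Instr.effect, MachineState.setMem]
      rw [r0, Function.update_self, e2, e3]
  · have h0 : V (2 * m + d + (m - 1)) 0 = 0 := le_antisymm (not_lt.1 h) hl
    refine ⟨_, .seq (T' := 10) (exec_addr hs.reg std ok1 (by norm_num)) (.seq (T' := 6)
      (exec_addr hs1.reg std ok2 (by norm_num)) (.seq (T' := 2)
        (exec_addr hs2.reg std ok3 (by norm_num)) (.iteFalse (T := 1) ⟨q1, q2⟩ ?_
          (.instr _ _ ⟨q0, q1, q1⟩)))), ?_⟩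
    · simp only [Test.Holds]
      rw [e1, e2]
      exact h
    · simp only [Instr.effect, MachineState.setMem]
      rw [r0, Function.update_self, e1, h0, add_zero, Real.zero_rpow (by positivity)]

/-- The program that computes the last Lewis weight. -/
def lewisProgram : Program :=
  .seq (block prelude) (.seq setup (.seq (.while (.rlt 14 15) iteration) output))

/-- A bound for the number of iterations. -/
def iterationBound (m : ℕ) (η : ℝ) : ℕ := ⌊Real.logb 2 (8 * m / η)⌋₊ + 1

theorem lt_iterationBound {k : ℕ} (hm : 0 < m) (hη : 0 < η) (h : η / 8 < m / 2 ^ k) :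
    k < iterationBound m η := by
  have hm' : (0 : ℝ) < m := by exact_mod_cast hm
  rw [iterationBound, Nat.lt_succ_iff]
  apply Nat.le_floor
  rw [Real.le_logb_iff_rpow_le one_lt_two (by positivity), Real.rpow_natCast, le_div_iff₀ hη]
  rw [lt_div_iff₀ (by positivity)] at h
  linarith

theorem computesLastWeight_lewisProgram (hp : 1 ≤ p) (hp2 : p ≤ 2) (hη : 0 < η) (hη1 : η < 1)
    (hd : 0 < d) {X : Rows d} (hX : 0 < X.length) :
    ComputesLastWeight lewisProgram (memSize (rowCount X.length d) d)
      (22 + ((X.length * 7 + 100) +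
        ((iterationBound X.length η * (iterationTime X.length d + 1) + 1) + 14))) p η X := by
  set m := X.length with hm
  have hm0 : (0 : ℝ) < m := by exact_mod_cast hX
  obtain ⟨s₀, ex0, hs0⟩ := exec_prelude (p := p) (η := η) hd hm.symm
  have hrows : ∀ i : Fin m,
      rowVec d (fun R j => (machineInput p η X).mem (2 + (R * d + j))) i = X.toMatrix i := fun i => by
    funext j
    have e1 : (i.val * d + j) / d = i := by
      rw [add_comm, Nat.add_mul_div_right _ _ hd, Nat.div_eq_of_lt j.isLt, zero_add]
    have e2 : (i.val * d + j) % d = j := by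
      rw [add_comm, Nat.add_mul_mod_self_right, Nat.mod_eq_of_lt j.isLt]
    simp only [rowVec, machineInput]
    rw [if_neg (by omega), if_neg (by omega)]
    simp only [Nat.add_sub_cancel_left, e1, e2]
    rw [dif_pos ⟨i.isLt, j.isLt⟩]
    rfl
  obtain ⟨T₁, s₁, V₁, hT1, ex1, hs1, hI⟩ := does_setup hp hp2 hX hd hrows s₀ hs0
  obtain ⟨T₂, s₂, V₂, hT2, ex2, hs2, ⟨k, hk⟩, hend⟩ := Does.while
    (N := rowCount m d) (M := iterationBound m η) (x := 14)
    (y := 15) (by norm_num) (by norm_num) (R := 4 * m + 2 * d + 6) (R' := 4 * m + 2 * d + 5)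
    hd (by rw [rowCount]; omega) (by rw [rowCount]; omega) rfl rfl (LoopInv p η X.toMatrix)
    (fun k V hV hlt => by
      rw [hV.threshold, hV.error] at hlt
      exact ⟨lt_iterationBound hX hη hlt, does_iteration hp hp2 hd hV⟩) hI s₁ hs1
  rw [hk.threshold, hk.error, not_lt] at hend
  -- At least one iteration takes place, because the initial bound `m ≥ 1` exceeds `η/8`.
  obtain ⟨l, rfl⟩ : ∃ l, k = l + 1 := by
    rcases k with _ | l
    · rw [pow_zero, div_one] at hend
      have : (1 : ℝ) ≤ m := by exact_mod_cast hX
      linarith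
    · exact ⟨l, rfl⟩
  obtain ⟨U, hU, hlev⟩ := hk.leverage l rfl
  set last : Fin m := ⟨m - 1, Nat.sub_lt hX Nat.one_pos⟩ with hlast
  have hl : V₂ (2 * m + d + (m - 1)) 0 = lev U (X.toMatrix last) := hlev last
  obtain ⟨s₃, ex3, hs3⟩ := exec_output hX hd (by linarith) hs2 hk.zero hk.half_p
    (by rw [hl]; exact lev_nonneg hU.posSemidef (hU.dominated last))
  refine ⟨22 + (T₁ + (T₂ + 14)), s₃, by omega, .seq ex0 (.seq ex1 (.seq ex2 ex3)), ?_⟩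
  obtain ⟨W, hW, hw⟩ := exists_lewisForm hp hp2 X.toMatrix
  obtain ⟨b1, b2⟩ := hU.bounds hW hp hp2 (Real.exp_pos _) last
  have hlw : lastLewisWeight p X = lev W (X.toMatrix last) ^ (p / 2) := by
    rw [lastLewisWeight, dif_pos hX]
    exact hw last
  have hw0 : 0 ≤ lastLewisWeight p X := by
    rw [hlw]
    exact Real.rpow_nonneg (lev_nonneg hW.posSemidef (hW.dominated last)) _
  rw [hs3, hl]
  rw [← hlw] at b1 b2
  -- The loop ends with `m / 2^(l+1) ≤ η/8`. The leverages belong to iterate `l`, which explains the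
  -- `η/4`; then `exp (η/4) ≤ 1/(1 - η/4) ≤ 1 + η`.
  have hexp : Real.exp (Real.log m / 2 ^ l) ≤ 1 + η := by
    have h1 : Real.log m / 2 ^ l ≤ η / 4 := by
      have h2 : Real.log m ≤ m := (Real.log_le_sub_one_of_pos hm0).trans (by linarith)
      have h3 : (m : ℝ) / 2 ^ l ≤ η / 4 := by
        rw [pow_succ, ← div_div] at hend
        linarith
      exact (div_le_div_of_nonneg_right h2 (by positivity)).trans h3
    have h4 : Real.exp (η / 4) * (1 - η / 4) ≤ 1 := by
      have := Real.add_one_le_exp (-(η / 4))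
      calc Real.exp (η / 4) * (1 - η / 4) ≤ Real.exp (η / 4) * Real.exp (-(η / 4)) := by
            gcongr; linarith
        _ = 1 := by rw [← Real.exp_add]; simp
    refine (Real.exp_le_exp.2 h1).trans ?_
    have h5 : 1 ≤ (1 + η) * (1 - η / 4) := by nlinarith
    have h6 : 0 < 1 - η / 4 := by linarith
    by_contra hcon
    push Not at hcon
    nlinarith [mul_lt_mul_of_pos_right hcon h6]
  constructor
  · nlinarith
  · exact b2.trans (mul_le_mul_of_nonneg_right hexp hw0)

end Main

/-! ### Resources -/

section Resources

variable {n m d : ℕ} {p β Q η δ : ℝ}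

theorem iterationTime_le (hd : 1 ≤ d) : iterationTime m d ≤ 500 * ((m + d) * d ^ 2) := by
  have h1 : d ≤ d ^ 2 := by nlinarith
  have h2 : d ^ 2 ≤ d ^ 3 := by nlinarith [sq_nonneg d]
  have h3 : m ≤ m * d := Nat.le_mul_of_pos_right m hd
  have h4 : m * d ≤ m * d ^ 2 := Nat.mul_le_mul_left m h1
  have h0 : 1 ≤ d ^ 3 := Nat.one_le_pow _ _ hd
  simp only [iterationTime, eliminateTime, pivotTime]
  ring_nf at *
  linarith

theorem iterationBound_le (hm : 0 < m) (hmn : m ≤ n) (hη : 0 < η) (hη1 : η < 1) (hδ : 0 < δ)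
    (hδ1 : δ < 1) (hn : 2 ≤ n) : (iterationBound m η : ℝ) ≤ 14 * Real.log (n / (δ * η)) := by
  have hm' : (1 : ℝ) ≤ m := by exact_mod_cast hm
  have hmn' : (m : ℝ) ≤ n := by exact_mod_cast hmn
  have hn' : (0 : ℝ) < n := by linarith
  have hl2 := Real.log_two_gt_d9
  have hx : 1 ≤ 8 * m / η := by rw [le_div_iff₀ hη]; linarith
  have h1 : Real.log (8 * m / η) ≤ 3 * Real.log 2 + Real.log (n / (δ * η)) := by
    have h8 : Real.log 8 = 3 * Real.log 2 := by
      rw [show (8 : ℝ) = 2 ^ 3 by norm_num, Real.log_pow]; norm_num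
    rw [← h8, ← Real.log_mul (by norm_num) (by positivity)]
    refine Real.log_le_log (by positivity) ?_
    rw [mul_div_assoc]
    have : (m : ℝ) / η ≤ n / (δ * η) := by
      apply div_le_div₀ hn'.le hmn' (by positivity)
      nlinarith
    linarith
  have h2 : Real.log 2 ≤ Real.log (n / (δ * η)) := by
    refine Real.log_le_log (by norm_num) ?_
    rw [le_div_iff₀ (by positivity)]
    have : (2 : ℝ) ≤ n := by exact_mod_cast hn
    nlinarith [mul_lt_mul hδ1 hη1.le hη zero_le_one]
  have h3 : (⌊Real.logb 2 (8 * m / η)⌋₊ : ℝ) ≤ Real.logb 2 (8 * m / η) :=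
    Nat.floor_le (Real.logb_nonneg one_lt_two hx)
  have h4 : Real.logb 2 (8 * m / η) ≤ 2 * Real.log (8 * m / η) := by
    rw [← Real.log_div_log, div_le_iff₀ (by linarith)]
    nlinarith [Real.log_nonneg hx]
  rw [iterationBound]
  push_cast
  linarith

/-- The bound for the number of rows. -/
theorem length_bound_le (c : ℕ) {b₁ q₁ : ℝ} (hn : 2 ≤ n) (hd : 1 ≤ d) (hη : 0 < η) (hη1 : η < 1)
    (hδ : 0 < δ) (hδ1 : δ < 1)
    (hβ : β ≤ b₁ * (η⁻¹ ^ 2 * Real.log (n / δ) * Real.log n ^ 2))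
    (hQ : Q ≤ q₁ * (η⁻¹ ^ 2 * d * Real.log n ^ 3)) :
    max Q d + 1 + topIndex n * (2 * (β * d) + (c + 4 : ℕ) * Real.log (n / δ)) ≤
      (2 * |q₁| + 4 * |b₁| + 8 * (c + 4) + 32) * (d * η⁻¹ ^ 2 * Real.log (n / δ) ^ 4) := by
  have hl := half_le_log hn
  have hlΛ := log_le_log_div hn hδ hδ1
  have hJ := (topIndex_le hn).trans (mul_le_mul_of_nonneg_left hlΛ zero_le_two)
  have hE : 1 ≤ η⁻¹ ^ 2 := one_le_pow₀ ((one_le_inv₀ hη).2 hη1.le)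
  have hd1 : (1 : ℝ) ≤ d := by exact_mod_cast hd
  set Λ := Real.log (n / δ)
  set l := Real.log n
  set E := η⁻¹ ^ 2
  have hΛ : 1 / 2 ≤ Λ := hl.trans hlΛ
  have hl0 : 0 ≤ l := by linarith
  have hΛ0 : 0 ≤ Λ := by linarith
  have hΛ1 : 1 ≤ 2 * Λ := by linarith
  set G := d * E * Λ ^ 4 with hG
  have hdE : 1 ≤ d * E := one_le_mul_of_one_le_of_one_le hd1 hE
  have hdE0 : (0 : ℝ) ≤ d * E := by linarith
  have hΛ4 : 1 ≤ 16 * Λ ^ 4 := by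
    have : 1 ≤ (2 * Λ) ^ 4 := one_le_pow₀ hΛ1
    rw [mul_pow] at this
    linarith
  have g1 : 1 ≤ 16 * G := by
    have := one_le_mul_of_one_le_of_one_le hdE hΛ4
    rw [hG]; linarith
  have g2 : (d : ℝ) ≤ 16 * G := by
    calc (d : ℝ) = d * 1 * 1 := by ring
      _ ≤ d * E * (16 * Λ ^ 4) := by gcongr
      _ = 16 * G := by rw [hG]; ring
  have g3 : d * E * Λ ^ 3 ≤ 2 * G := by
    calc d * E * Λ ^ 3 = d * E * Λ ^ 3 * 1 := by ring
      _ ≤ d * E * Λ ^ 3 * (2 * Λ) := by gcongr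
      _ = 2 * G := by rw [hG]; ring
  have hG0 : 0 ≤ G := by linarith
  have g4 : Λ ^ 2 ≤ 4 * G := by
    calc Λ ^ 2 = 1 * (Λ ^ 2 * (1 * 1)) := by ring
      _ ≤ (d * E) * (Λ ^ 2 * ((2 * Λ) * (2 * Λ))) := by gcongr
      _ = 4 * G := by rw [hG]; ring
  have hQ' : Q ≤ 2 * |q₁| * G := by
    calc Q ≤ q₁ * (E * d * l ^ 3) := hQ
      _ ≤ |q₁| * (E * d * Λ ^ 3) := by
        gcongr; exact le_abs_self _
      _ = |q₁| * (d * E * Λ ^ 3) := by ring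
      _ ≤ |q₁| * (2 * G) := by gcongr
      _ = _ := by ring
  have hβ' : β * d ≤ |b₁| * (d * E * Λ ^ 3) := by
    calc β * d ≤ (b₁ * (E * Λ * l ^ 2)) * d := by gcongr
      _ ≤ (|b₁| * (E * Λ * Λ ^ 2)) * d := by gcongr; exact le_abs_self _
      _ = _ := by ring
  have hmax : max Q (d : ℝ) ≤ 2 * |q₁| * G + 16 * G := by
    have : 0 ≤ 2 * |q₁| * G := by positivity
    exact max_le (by linarith) (by linarith)
  have hB0 : 0 ≤ 2 * (|b₁| * (d * E * Λ ^ 3)) + (c + 4 : ℕ) * Λ := by positivity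
  have hsum : topIndex n * (2 * (β * d) + (c + 4 : ℕ) * Λ) ≤ (4 * |b₁| + 8 * (c + 4)) * G := by
    calc topIndex n * (2 * (β * d) + (c + 4 : ℕ) * Λ)
        ≤ topIndex n * (2 * (|b₁| * (d * E * Λ ^ 3)) + (c + 4 : ℕ) * Λ) := by gcongr
      _ ≤ (2 * Λ) * (2 * (|b₁| * (d * E * Λ ^ 3)) + (c + 4 : ℕ) * Λ) := by gcongr
      _ = 4 * |b₁| * G + 2 * (c + 4) * Λ ^ 2 := by rw [hG]; push_cast; ring
      _ ≤ 4 * |b₁| * G + 2 * (c + 4) * (4 * G) := by gcongr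
      _ = _ := by ring
  calc _ ≤ 2 * |q₁| * G + 16 * G + 16 * G + (4 * |b₁| + 8 * (c + 4)) * G := by linarith
    _ = _ := by ring

theorem memSize_le {L : ℝ} (hd : 1 ≤ d) (hL1 : 1 ≤ L) (hdL : (d : ℝ) ≤ L) (hmL : (m : ℝ) ≤ L) :
    (memSize (rowCount m d) d : ℝ) ≤ 48 * (d * L) := by
  have hd1 : (1 : ℝ) ≤ d := by exact_mod_cast hd
  rw [memSize, rowCount]
  push_cast
  have h1 : (m : ℝ) * d ≤ d * L := by nlinarith
  have h2 : (d : ℝ) * d ≤ d * L := by nlinarith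
  have h3 : L ≤ d * L := by nlinarith
  nlinarith

theorem words_le {L : ℝ} {z : Snapshot d} (hd : 1 ≤ d) (h1 : ((z.current n).length : ℝ) ≤ L)
    (h2 : ((z.post.concat (topIndex n + 1)).length : ℝ) ≤ L) : (z.words n : ℝ) ≤ 4 * (d * L) := by
  have hd1 : (1 : ℝ) ≤ d := by exact_mod_cast hd
  have hL : 0 ≤ L := (Nat.cast_nonneg _).trans h1
  rw [Snapshot.words]
  push_cast
  have e1 : (d : ℝ) * (z.current n).length ≤ d * L := by gcongr
  have e2 : (d : ℝ) * (z.post.concat (topIndex n + 1)).length ≤ d * L := by gcongr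
  have e3 : L ≤ d * L := by nlinarith
  linarith

theorem totalTime_le {L M : ℝ} {N : ℕ} (hd : 1 ≤ d) (hL1 : 1 ≤ L) (hdL : (d : ℝ) ≤ L)
    (hmL : (m : ℝ) ≤ L) (hM : 1 / 2 ≤ M) (hN : (N : ℝ) ≤ 14 * M) :
    ((22 + ((m * 7 + 100) + ((N * (iterationTime m d + 1) + 1) + 14)) : ℕ) : ℝ) ≤
      15000 * (d ^ 2 * L * M) := by
  have hd1 : (1 : ℝ) ≤ d := by exact_mod_cast hd
  have hd2 : (1 : ℝ) ≤ (d : ℝ) ^ 2 := one_le_pow₀ hd1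
  have h1 : (iterationTime m d : ℝ) ≤ 500 * ((m + d) * d ^ 2) := by
    exact_mod_cast iterationTime_le hd
  have h2 : (iterationTime m d : ℝ) + 1 ≤ 1001 * (d ^ 2 * L) := by
    have : ((m : ℝ) + d) * d ^ 2 ≤ (L + L) * d ^ 2 := by gcongr
    have : 1 ≤ (d : ℝ) ^ 2 * L := one_le_mul_of_one_le_of_one_le hd2 hL1
    linarith
  have h3 : (N : ℝ) * (iterationTime m d + 1) ≤ 14 * M * (1001 * (d ^ 2 * L)) := by gcongr
  have h4 : L ≤ d ^ 2 * L := le_mul_of_one_le_left (by linarith) hd2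
  have h5 : (d : ℝ) ^ 2 * L ≤ 2 * (d ^ 2 * L * M) := by
    nlinarith [mul_le_mul_of_nonneg_left hM (by positivity : (0 : ℝ) ≤ d ^ 2 * L)]
  push_cast
  linarith

end Resources

end OnlineLewis

end

/-! ### Assembly of the guarantees for accuracy, space and time. -/

theorem mainTheorem7 :
    -- one program and one power `k` of the logarithm, then any polynomial `n ^ c`
    ∃ (P : OnlineLewis.Program) (k : ℕ), ∀ c : ℕ,
      -- the parameters `β` and `Q` of the algorithm may have any large enough constants
      ∃ b₀ q₀ : ℝ, 0 < b₀ ∧ 0 < q₀ ∧ ∀ b₁ q₁ : ℝ, ∃ C : ℝ, 0 < C ∧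
        ∀ (n d : ℕ) (p η δ β Q : ℝ) (A : Matrix (Fin n) (Fin d) ℝ),
          2 ≤ n → 1 ≤ d → 1 ≤ p → p ≤ 2 → 0 < η → η < 1 → 0 < δ → δ < 1 →
          b₀ * (η⁻¹ ^ 2 * Real.log (n / δ) * Real.log n ^ 2) ≤ β →
          β ≤ b₁ * (η⁻¹ ^ 2 * Real.log (n / δ) * Real.log n ^ 2) →
          q₀ * (η⁻¹ ^ 2 * d * Real.log n ^ 3) ≤ Q →
          Q ≤ q₁ * (η⁻¹ ^ 2 * d * Real.log n ^ 3) →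
          ENNReal.ofReal (1 - δ / (n : ℝ) ^ c) ≤
            (OnlineLewis.run p β Q A).toOuterMeasure
              {hist | ∀ t : Fin n,
                -- the estimates are `(1 ± η)`-approximations of the online Lewis weights
                (1 - η) * OnlineLewis.onlineLewisWeight p A t ≤ (hist t).estimate p n ∧
                (hist t).estimate p n ≤ (1 + η) * OnlineLewis.onlineLewisWeight p A t ∧
                -- only the blocks `B_0, …, B_{log n}` are in use
                (∀ i, OnlineLewis.topIndex n < i → (hist t).pre i = [] ∧ (hist t).post i = []) ∧
                -- the space of the algorithm
                ((hist t).words n : ℝ) ≤ C * ((d : ℝ) ^ 2 / η ^ 2 * Real.log (n / δ) ^ k) ∧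
                -- the time (and the space) in which the estimate is computed
                ∃ S T : ℕ,
                  (S : ℝ) ≤ C * ((d : ℝ) ^ 2 / η ^ 2 * Real.log (n / δ) ^ k) ∧
                  (T : ℝ) ≤ C * ((d : ℝ) ^ 3 / η ^ 2 * Real.log (n / (δ * η)) ^ k) ∧
                  OnlineLewis.ComputesLastWeight P S T p η ((hist t).current n)} := by
  -- The number of rows is bounded with four logarithmic factors, and the number of iterations adds
  -- a fifth one to the time.
  refine ⟨OnlineLewis.lewisProgram, 5, fun c => ⟨1024 * (c + 4), 8, by positivity, by norm_num,
    fun b₁ q₁ => ?_⟩⟩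
  set K : ℝ := 2 * |q₁| + 4 * |b₁| + 8 * (c + 4) + 32 with hK
  have hK0 : 0 < K := by positivity
  refine ⟨15000 * K, by positivity, ?_⟩
  intro n d p η δ β Q A hn hd hp hp2 hη hη1 hδ hδ1 hβ hβ' hQ hQ'
  refine (OnlineLewis.stream_guarantee c hn hd hp hp2 hη hη1 hδ hδ1 hβ hQ A).trans
    (MeasureTheory.OuterMeasure.mono _ fun hist hgood t => ?_)
  have hz := hgood t
  have hLK := OnlineLewis.length_bound_le c hn hd hη hη1 hδ hδ1 hβ' hQ'
  rw [← hK] at hLK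
  set L : ℝ := max Q d + 1 + OnlineLewis.topIndex n *
    (2 * (β * d) + (c + 4 : ℕ) * Real.log (n / δ)) with hL
  have hn0 : (0 : ℝ) < n := by positivity
  have hl := OnlineLewis.half_le_log hn
  have hlΛ := OnlineLewis.log_le_log_div hn hδ hδ1
  have hΛM : Real.log (n / δ) ≤ Real.log (n / (δ * η)) := by
    refine Real.log_le_log (by positivity) ?_
    gcongr
    nlinarith
  set Λ := Real.log (n / δ)
  set M := Real.log (n / (δ * η))
  have hΛ : 1 / 2 ≤ Λ := hl.trans hlΛ
  have hβ0 : 0 ≤ β := le_trans (by positivity) hβ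
  have hdL : (d : ℝ) ≤ L := by
    have h1 : 0 ≤ OnlineLewis.topIndex n * (2 * (β * d) + (c + 4 : ℕ) * Λ) := by positivity
    linarith [le_max_right Q (d : ℝ)]
  have hL1 : 1 ≤ L := le_trans (by exact_mod_cast hd) hdL
  -- The space needs only `Λ⁴`; the exponent is raised to the common value `5` by means of `1 ≤ 2
  -- Λ`.
  have hdLK : d * L ≤ 2 * K * ((d : ℝ) ^ 2 / η ^ 2 * Λ ^ 5) := by
    calc d * L ≤ d * (K * (d * η⁻¹ ^ 2 * Λ ^ 4)) := by gcongr
      _ = K * ((d : ℝ) ^ 2 / η ^ 2 * Λ ^ 4) * 1 := by field_simp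
      _ ≤ K * ((d : ℝ) ^ 2 / η ^ 2 * Λ ^ 4) * (2 * Λ) := by gcongr; linarith
      _ = _ := by ring
  have hpos : 0 ≤ K * ((d : ℝ) ^ 2 / η ^ 2 * Λ ^ 5) := by positivity
  refine ⟨hz.lower, hz.upper, hz.empty, ?_, _, _, ?_, ?_,
    OnlineLewis.computesLastWeight_lewisProgram hp hp2 hη hη1 hd hz.pos⟩
  · linarith [OnlineLewis.words_le hd hz.pre_length hz.post_length]
  · linarith [OnlineLewis.memSize_le hd hL1 hdL hz.pre_length]
  · refine (OnlineLewis.totalTime_le hd hL1 hdL hz.pre_length (hΛ.trans hΛM)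
      (OnlineLewis.iterationBound_le hz.pos hz.length_le hη hη1 hδ hδ1 hn)).trans ?_
    calc 15000 * ((d : ℝ) ^ 2 * L * M)
        ≤ 15000 * ((d : ℝ) ^ 2 * (K * (d * η⁻¹ ^ 2 * M ^ 4)) * M) := by
          have : L ≤ K * (d * η⁻¹ ^ 2 * M ^ 4) := hLK.trans (by gcongr)
          have hM : 0 ≤ M := by linarith
          gcongr
      _ = _ := by field_simp
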